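/- Let $D,d\ge 0$ be integers and consider bosonic modes $a_{\bm j,\ell}$, $\bm j\in\mathbb Z^D$, $\ell=1,\dots,d$, with $[a_{\bm j,\ell},a_{\bm j',\ell'}]=0$ and $[a_{\bm j,\ell},a^\dagger_{\bm j',\ell'}]=\delta_{\bm j\bm j'}\delta_{\ell\ell'}$. A translationally invariant quadratic bosonic Hamiltonian (QBH) is a formal sum $$H=\sum_{\bm j,\bm r,\ell,\ell'} a_{\bm j,\ell}^\dagger (K_{\bm r})_{\ell\ell'}a_{\bm j+\bm r,\ell'}+\tfrac12\big[a_{\bm j,\ell}^\dagger(\Delta_{\bm r})_{\ell\ell'}a^\dagger_{\bm j+\bm r,\ell'}+\mathrm{H.c.}\big],$$ with complex $d\times d$ matrices $K_{\bm r}=K_{-\bm r}^\dagger$, $\Delta_{\bm r}=\Delta_{-\bm r}^T$ that vanish for all but finitely many $\bm r\in\mathbb Z^D$. With $K(\bm k)=\sum_{\bm r}e^{i\bm k\cdot\bm r}K_{\bm r}$ and $\Delta(\bm k)=\sum_{\bm r}e^{i\bm k\cdot\bm r}\Delta_{\bm r}$, its Bloch dynamical matrix is $$g(\bm k)=\begin{pmatrix}K(\bm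 k)&\Delta(\bm k)\\-\Delta^*(-\bm k)&-K^*(-\bm k)\end{pmatrix},\qquad \bm k\in\mathrm{BZ}=[-\pi,\pi]^D .$$ $H$ is dynamically stable if $g(\bm k)$ is diagonalizable with real spectrum for every $\bm k\in\mathrm{BZ}$. The quasiparticle energies $\omega_1(\bm k),\dots,\omega_d(\bm k)$ are then the eigenvalues of $g(\bm k)$ with eigenvectors $v$ of positive Krein signature, $v^\dagger\tau_3v>0$, $\tau_3=\mathrm{diag}(1_d,-1_d)$. The direct and indirect Krein gaps are (for $d\ge1$) $$\Delta_{\rm Krein}=\min_{\bm k,m,n}|\omega_n(\bm k)+\omega_m(-\bm k)|,\qquad \Delta'_{\rm Krein}=\min_{\bm k,\bm k',m,n}|\omega_n(\bm k)+\omega_m(\bm k')| .$$ A state is a normalized positive linear functional $\langle\cdot\rangle$ on the $*$-algebra of polynomials in the $a_{\bm j,\ell},a^\dagger_{\bm j,\ell}$; it is translationally invariant if it is invariant under all lattice translations $a_{\bm j,\ell}\mapsto a_{\bm j+\bm r,\ell}$. A quasiparticle vacuum (QPV) of $H$ is a state that (a) is obtained from the Fock vacuum by a homogeneous Bogoliubov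 transformation, i.e. is annihilated by all annihilation operators of a complete set of bosonic modes that are linear combinations, with square-summable coefficients, of the $a_{\bm j,\ell}$ and $a_{\bm j,\ell}^\dagger$ (a bounded invertible linear transformation of $\ell^2$ coefficient vectors that preserves commutators and adjoints), and (b) is an eigenstate of $H$, i.e. $\langle[H,X]\rangle=0$ for all $X$ in the algebra. **Theorem.** Let $H$ be a dynamically stable, translationally invariant QBH. Then: (i) if $\Delta'_{\rm Krein}>0$, there exists a unique QPV of $H$, and it is translationally invariant; (ii) if $\Delta_{\rm Krein}>0$, there exists a unique translationally invariant QPV of $H$. -/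

import Mathlib

open scoped Matrix

noncomputable section

/-! ### The CCR algebra -/

/-- The value of the commutator of two generators: the left summand labels the annihilation
operators `a i`, the right summand the creation operators `a† i`. -/
def ccrForm {ι : Type} [DecidableEq ι] : ι ⊕ ι → ι ⊕ ι → ℂ
  | .inl i, .inr j => if i = j then 1 else 0
  | .inr i, .inl j => if i = j then -1 else 0
  | .inl _, .inl _ => 0
  | .inr _, .inr _ => 0

/-- The canonical commutation relations `x y = y x + [x, y]` between generators. -/
inductive CCRRel (ι : Type) [DecidableEq ι] :
    FreeAlgebra ℂ (ι ⊕ ι) → FreeAlgebra ℂ (ι ⊕ ι) → Prop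
  | ccr (s t : ι ⊕ ι) : CCRRel ι
      (FreeAlgebra.ι ℂ s * FreeAlgebra.ι ℂ t)
      (FreeAlgebra.ι ℂ t * FreeAlgebra.ι ℂ s + algebraMap ℂ _ (ccrForm s t))

/-- The unital algebra generated by `a i` and `a† i`, subject to the canonical commutation
relations: the polynomials in finitely many creation and annihilation operators. -/
def CCRAlgebra (ι : Type) [DecidableEq ι] : Type := RingQuot (CCRRel ι)

namespace CCRAlgebra

variable {ι : Type} [DecidableEq ι]

instance : Ring (CCRAlgebra ι) := inferInstanceAs (Ring (RingQuot (CCRRel ι)))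

instance : Algebra ℂ (CCRAlgebra ι) := inferInstanceAs (Algebra ℂ (RingQuot (CCRRel ι)))

/-- The Nambu array: `nambu (inl i) = a i` and `nambu (inr i) = a† i`. -/
def nambu (s : ι ⊕ ι) : CCRAlgebra ι := RingQuot.mkAlgHom ℂ (CCRRel ι) (FreeAlgebra.ι ℂ s)

/-- The annihilation operator of mode `i`. -/
def ann (i : ι) : CCRAlgebra ι := nambu (.inl i)

/-- The creation operator of mode `i`. -/
def cre (i : ι) : CCRAlgebra ι := nambu (.inr i)

theorem nambu_mul (s t : ι ⊕ ι) :
    (nambu s : CCRAlgebra ι) * nambu t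
      = nambu t * nambu s + algebraMap ℂ (CCRAlgebra ι) (ccrForm s t) := by
  have h := RingQuot.mkAlgHom_rel ℂ (CCRRel.ccr (ι := ι) s t)
  rw [map_mul, map_add, map_mul, AlgHom.commutes] at h
  exact h

/-- The universal property of the CCR algebra. -/
def lift {A : Type} [Ring A] [Algebra ℂ A] (f : ι ⊕ ι → A)
    (hf : ∀ s t, f s * f t = f t * f s + algebraMap ℂ A (ccrForm s t)) :
    CCRAlgebra ι →ₐ[ℂ] A :=
  RingQuot.liftAlgHom ℂ ⟨FreeAlgebra.lift ℂ f, by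
    rintro _ _ ⟨s, t⟩
    simpa using hf s t⟩

theorem lift_nambu {A : Type} [Ring A] [Algebra ℂ A] (f : ι ⊕ ι → A)
    (hf : ∀ s t, f s * f t = f t * f s + algebraMap ℂ A (ccrForm s t)) (s : ι ⊕ ι) :
    lift f hf (nambu s) = f s := by
  have h := RingQuot.liftAlgHom_mkAlgHom_apply ℂ (FreeAlgebra.lift ℂ f)
    (s := CCRRel ι) (by
      rintro _ _ ⟨s, t⟩
      simpa using hf s t) (FreeAlgebra.ι ℂ s)
  rw [FreeAlgebra.lift_ι_apply] at h
  exact h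

theorem algHom_ext {A : Type} [Ring A] [Algebra ℂ A] {f g : CCRAlgebra ι →ₐ[ℂ] A}
    (h : ∀ s, f (nambu s) = g (nambu s)) : f = g := by
  refine RingQuot.ringQuot_ext' ℂ f g (FreeAlgebra.hom_ext (funext fun s => ?_))
  exact h s

/-- The opposite of the CCR algebra with complex conjugated scalars, the target of the adjoint
seen as a linear multiplicative map. -/
def ConjOp (ι : Type) [DecidableEq ι] : Type := (CCRAlgebra ι)ᵐᵒᵖ

instance : Ring (ConjOp ι) := inferInstanceAs (Ring (CCRAlgebra ι)ᵐᵒᵖ)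

instance : Algebra ℂ (ConjOp ι) := Algebra.compHom (CCRAlgebra ι)ᵐᵒᵖ (starRingEnd ℂ)

/-- The adjoint, as an algebra homomorphism to the conjugate opposite algebra; it exchanges
`a i` and `a† i`. -/
def adj : CCRAlgebra ι →ₐ[ℂ] ConjOp ι :=
  lift (fun s => (MulOpposite.op (nambu s.swap) : (CCRAlgebra ι)ᵐᵒᵖ)) (by
    intro s t
    have h := nambu_mul (ι := ι) t.swap s.swap
    have h2 : ccrForm t.swap s.swap = starRingEnd ℂ (ccrForm s t) := by
      rcases s with i | i <;> rcases t with j | j <;> simp [ccrForm, eq_comm, apply_ite]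
    rw [h2] at h
    exact congrArg MulOpposite.op h)

theorem adj_nambu (s : ι ⊕ ι) :
    adj (nambu s) = (MulOpposite.op (nambu s.swap) : (CCRAlgebra ι)ᵐᵒᵖ) :=
  lift_nambu _ _ s

theorem adj_algebraMap (c : ℂ) : adj (algebraMap ℂ (CCRAlgebra ι) c)
    = (MulOpposite.op (algebraMap ℂ (CCRAlgebra ι) (starRingEnd ℂ c)) : (CCRAlgebra ι)ᵐᵒᵖ) :=
  adj.commutes c

instance : Star (CCRAlgebra ι) := ⟨fun X => MulOpposite.unop (adj X : (CCRAlgebra ι)ᵐᵒᵖ)⟩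

theorem star_def (X : CCRAlgebra ι) :
    star X = MulOpposite.unop (adj X : (CCRAlgebra ι)ᵐᵒᵖ) := rfl

theorem star_nambu (s : ι ⊕ ι) : star (nambu s : CCRAlgebra ι) = nambu s.swap := by
  rw [star_def, adj_nambu]; rfl

theorem star_algebraMap (c : ℂ) : star (algebraMap ℂ (CCRAlgebra ι) c)
    = algebraMap ℂ (CCRAlgebra ι) (starRingEnd ℂ c) := by
  rw [star_def, adj_algebraMap]; rfl

theorem star_mul_rev (X Y : CCRAlgebra ι) : star (X * Y) = star Y * star X := by
  simp only [star_def]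
  rw [map_mul]
  rfl

theorem star_add_eq (X Y : CCRAlgebra ι) : star (X + Y) = star X + star Y := by
  simp only [star_def]
  rw [map_add]
  rfl

theorem star_invol (X : CCRAlgebra ι) : star (star X) = X := by
  let f : CCRAlgebra ι →ₐ[ℂ] CCRAlgebra ι :=
    { toFun := fun X => star (star X)
      map_one' := by
        have h := star_algebraMap (ι := ι) 1
        simp only [map_one] at h
        rw [h, h]
      map_mul' := fun X Y => by rw [star_mul_rev, star_mul_rev]
      map_zero' := by
        have h := star_algebraMap (ι := ι) 0
        simp only [map_zero] at h
        rw [h, h]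
      map_add' := fun X Y => by rw [star_add_eq, star_add_eq]
      commutes' := fun c => by rw [star_algebraMap, star_algebraMap]; simp }
  have h : f = AlgHom.id ℂ _ := algHom_ext fun s => by
    change star (star (nambu s)) = nambu s
    rw [star_nambu, star_nambu, Sum.swap_swap]
  exact DFunLike.congr_fun h X

/-- The adjoint makes the CCR algebra a complex *-algebra. -/
instance : StarRing (CCRAlgebra ι) where
  star_involutive := star_invol
  star_mul := star_mul_rev
  star_add := star_add_eq

instance : StarModule ℂ (CCRAlgebra ι) where
  star_smul c X := by
    rw [Algebra.smul_def, star_mul_rev, star_algebraMap, Algebra.smul_def, Algebra.commutes]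
    rfl

/-- A bijection of the modes acts on the CCR algebra. -/
def relabel (e : ι ≃ ι) : CCRAlgebra ι →ₐ[ℂ] CCRAlgebra ι :=
  lift (fun s => nambu (Sum.map e e s)) (by
    intro s t
    rw [nambu_mul]
    congr 2
    rcases s with i | i <;> rcases t with j | j <;> simp [ccrForm])

end CCRAlgebra

/-! ### States, Bogoliubov transformations and quasiparticle vacua -/

/-- A state: a normalized positive linear functional on the CCR algebra. -/
structure CCRState (ι : Type) [DecidableEq ι] where
  /-- the expectation value -/
  expect : CCRAlgebra ι →ₗ[ℂ] ℂ
  normalized : expect 1 = 1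
  re_nonneg : ∀ X, 0 ≤ (expect (star X * X)).re
  im_eq_zero : ∀ X, (expect (star X * X)).im = 0

/-- The square-summable coefficient vectors `F` of the linear expressions
`φ(F) = ∑ i, (F (inl i) a i + F (inr i) a† i)` in the creation and annihilation operators. -/
abbrev NambuSpace (ι : Type) : Type := lp (fun _ : ι ⊕ ι => ℂ) 2

namespace NambuSpace

variable {ι : Type}

/-- The coefficients of the adjoint: `φ(F)† = φ(conj F)`. -/
def conj (F : NambuSpace ι) : NambuSpace ι :=
  ⟨fun s => starRingEnd ℂ (F s.swap), by
    have h := (memℓp_gen_iff (p := 2) (by norm_num)).1 (lp.memℓp F)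
    refine memℓp_gen ?_
    simpa [Function.comp_def] using (Equiv.sumComm ι ι).summable_iff.2 h⟩

/-- The commutator: `[φ(F), φ(G)] = commutator F G`. -/
def commutator (F G : NambuSpace ι) : ℂ :=
  ∑' i : ι, (F (.inl i) * G (.inr i) - F (.inr i) * G (.inl i))

/-- The coefficient vectors of linear combinations of annihilation operators only. -/
def IsAnnihilation (F : NambuSpace ι) : Prop := ∀ i : ι, F (.inr i) = 0

end NambuSpace

/-- A (homogeneous) Bogoliubov transformation. The new modes are `β(f) = φ(B f)` for `f` with
`IsAnnihilation f`, in particular `β i = φ(B (single (inl i) 1))`; they obey the canonical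
commutation relations and are complete (`B` is onto). If the new Nambu array is
`ψ = L⁻¹ φ`, then `B` is the transpose of `L⁻¹`, and the two laws say
`L* = τ₁ L τ₁` and `L† τ₃ L = τ₃`. -/
structure Bogoliubov (ι : Type) where
  /-- the transformation of coefficient vectors -/
  B : NambuSpace ι ≃L[ℂ] NambuSpace ι
  map_commutator : ∀ F G, (B F).commutator (B G) = F.commutator G
  map_conj : ∀ F, B F.conj = (B F).conj

namespace CCRState

variable {ι : Type} [DecidableEq ι]

/-- `φ(F)` annihilates the state: `⟨X φ(F)⟩ = 0` for all `X`. -/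
def AnnihilatedBy (ω : CCRState ι) (F : NambuSpace ι) : Prop :=
  ∀ X : CCRAlgebra ι, HasSum (fun s => F s * ω.expect (X * CCRAlgebra.nambu s)) 0

/-- A quasiparticle vacuum, irrespective of a Hamiltonian: the image of the Fock vacuum under a
Bogoliubov transformation, i.e. the state annihilated by all the transformed annihilation
operators. -/
def IsQuasiparticleVacuum (ω : CCRState ι) : Prop :=
  ∃ T : Bogoliubov ι, ∀ f : NambuSpace ι, f.IsAnnihilation → ω.AnnihilatedBy (T.B f)

end CCRState

/-! ### Translationally invariant quadratic bosonic Hamiltonians -/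

/-- The modes: `d` bosons at each site of the lattice `ℤ^D`. -/
abbrev LatticeMode (D d : ℕ) : Type := (Fin D → ℤ) × Fin d

/-- The lattice translation by `r`, `a (j, ℓ) ↦ a (j + r, ℓ)`, as an automorphism. -/
def latticeTranslate {D d : ℕ} (r : Fin D → ℤ) :
    CCRAlgebra (LatticeMode D d) →ₐ[ℂ] CCRAlgebra (LatticeMode D d) :=
  CCRAlgebra.relabel ((Equiv.addRight r).prodCongr (Equiv.refl (Fin d)))

/-- Translationally invariant states. -/
def CCRState.TranslationInvariant {D d : ℕ} (ω : CCRState (LatticeMode D d)) : Prop :=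
  ∀ (r : Fin D → ℤ) (X : CCRAlgebra (LatticeMode D d)), ω.expect (latticeTranslate r X) = ω.expect X

/-- A translationally invariant quadratic bosonic Hamiltonian of finite range on `ℤ^D`, with `d`
bosons per site: hopping matrices `K r` and pairing matrices `Δ r`, zero for all but finitely
many `r`. -/
structure QBH (D d : ℕ) where
  /-- hopping matrices -/
  K : (Fin D → ℤ) →₀ Matrix (Fin d) (Fin d) ℂ
  /-- pairing matrices -/
  Δ : (Fin D → ℤ) →₀ Matrix (Fin d) (Fin d) ℂ
  K_adj : ∀ r, (K r)ᴴ = K (-r)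
  Δ_transpose : ∀ r, (Δ r)ᵀ = Δ (-r)

namespace QBH

variable {D d : ℕ} (H : QBH D d)

open CCRAlgebra in
/-- The terms of the Hamiltonian that start at the site `j`. -/
def siteTerm (j : Fin D → ℤ) : CCRAlgebra (LatticeMode D d) :=
  (H.K.sum fun r M => ∑ ℓ, ∑ ℓ', M ℓ ℓ' • (cre (j, ℓ) * ann (j + r, ℓ')))
  + (1 / 2 : ℂ) • (H.Δ.sum fun r M => ∑ ℓ, ∑ ℓ',
      (M ℓ ℓ' • (cre (j, ℓ) * cre (j + r, ℓ'))
        + star (M ℓ ℓ' • (cre (j, ℓ) * cre (j + r, ℓ')))))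

/-- The partial sum over the sites in `S` of the formal infinite sum `H`. -/
def partialSum (S : Finset (Fin D → ℤ)) : CCRAlgebra (LatticeMode D d) := ∑ j ∈ S, H.siteTerm j

/-- Eigenstates of `H` in infinite volume: `⟨[H, X]⟩ = 0` for every `X`, where `[H, X]` is the
eventually constant value of the commutators with the partial sums of `H`. -/
def IsEigenstate (ω : CCRState (LatticeMode D d)) : Prop :=
  ∀ X : CCRAlgebra (LatticeMode D d), ∀ᶠ S in (Filter.atTop : Filter (Finset (Fin D → ℤ))),
    ω.expect (H.partialSum S * X - X * H.partialSum S) = 0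

/-- A quasiparticle vacuum (QPV) of `H`. -/
def IsQPV (ω : CCRState (LatticeMode D d)) : Prop :=
  ω.IsQuasiparticleVacuum ∧ H.IsEigenstate ω

/-- The Fourier transform `∑ r, e^{i k·r} M r`. -/
def fourier (M : (Fin D → ℤ) →₀ Matrix (Fin d) (Fin d) ℂ) (k : Fin D → ℝ) :
    Matrix (Fin d) (Fin d) ℂ :=
  M.sum fun r A => Complex.exp (Complex.I * ((∑ i, k i * (r i : ℝ) : ℝ) : ℂ)) • A

/-- The Bloch dynamical matrix. -/
def bloch (k : Fin D → ℝ) : Matrix (Fin d ⊕ Fin d) (Fin d ⊕ Fin d) ℂ :=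
  Matrix.fromBlocks (fourier H.K k) (fourier H.Δ k)
    (-(fourier H.Δ (-k)).map (starRingEnd ℂ)) (-(fourier H.K (-k)).map (starRingEnd ℂ))

/-- The first Brillouin zone `[-π, π]^D`. -/
def brillouinZone (D : ℕ) : Set (Fin D → ℝ) := {k | ∀ i, k i ∈ Set.Icc (-Real.pi) Real.pi}

/-- Dynamical stability: all Bloch dynamical matrices are diagonalizable with real spectrum. -/
def DynamicallyStable : Prop :=
  ∀ k ∈ brillouinZone D, ∃ (P : Matrix (Fin d ⊕ Fin d) (Fin d ⊕ Fin d) ℂ)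
    (ev : Fin d ⊕ Fin d → ℝ),
    IsUnit P ∧ H.bloch k * P = P * Matrix.diagonal fun s => (ev s : ℂ)

/-- The Krein form `v† τ₃ v`, a real number. -/
def kreinForm (v : Fin d ⊕ Fin d → ℂ) : ℝ :=
  ∑ n, ‖v (.inl n)‖ ^ 2 - ∑ n, ‖v (.inr n)‖ ^ 2

/-- The set `{ω₁(k), …, ω_d(k)}` of quasiparticle energies at momentum `k`: the eigenvalues of
the Bloch dynamical matrix that have an eigenvector of Krein signature `+1`. -/
def quasiparticleEnergies (k : Fin D → ℝ) : Set ℝ :=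
  {w | ∃ v : Fin d ⊕ Fin d → ℂ, H.bloch k *ᵥ v = (w : ℂ) • v ∧ 0 < kreinForm v}

/-- The direct Krein gap, the minimum of `|ω_n(k) + ω_m(-k)|`. -/
def kreinGap : ℝ :=
  sInf {x | ∃ k ∈ brillouinZone D, ∃ w ∈ H.quasiparticleEnergies k,
    ∃ w' ∈ H.quasiparticleEnergies (-k), x = |w + w'|}

/-- The indirect Krein gap, the minimum of `|ω_n(k) + ω_m(k')|`. -/
def indirectKreinGap : ℝ :=
  sInf {x | ∃ k ∈ brillouinZone D, ∃ k' ∈ brillouinZone D, ∃ w ∈ H.quasiparticleEnergies k,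
    ∃ w' ∈ H.quasiparticleEnergies k', x = |w + w'|}

end QBH

end

/-! The coefficient vectors of linear expressions in `a`, `a†` form a Krein space with the
indefinite form `⟨F, τ₃ G⟩`. A Bogoliubov transformation `B` enters only through `S = B τ₃ B⁻¹`,
which is `1` on the new annihilation operators and `-1` on the new creation operators. Such an `S`
is a fundamental symmetry (`S² = 1`, `τ₃ S ≥ 0`) and anticommutes with the adjoint `conj`.
Conversely, every fundamental symmetry that anticommutes with `conj` arises in this way, from the
square root of `τ₃ S` (`Bogoliubov.exists_symmetry_eq`). Each such `S` has exactly one vacuum: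
existence is Wick's theorem with a positive two-point function, and uniqueness follows by moving
operators through words.

The derivation `[H, ·]` acts on coefficient vectors as convolution with the symbol `-g(k)ᵀ`. A
vacuum is an eigenstate of `H` iff its `S` commutes with this operator, and it is translationally
invariant iff `S` commutes with the lattice shifts. So the theorem concerns fundamental symmetries
that commute with the symbol.

Existence: a positive Krein gap (either one) excludes eigenvalues of `g(k)` with eigenvectors of
both signatures, because particle–hole symmetry would turn them into energies `a` at `k` and `-a` at
`-k`. Hence every eigenspace is definite. The matrix that equals the signature on each eigenspace is
a polynomial in `g(k)`, and it is continuous in `k`. It defines a fundamental symmetry `S₀` that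
commutes with the symbol and the shifts.

Uniqueness: two commuting fundamental symmetries are equal (`IsFundamentalSymmetry.eq_of_commute`),
so it suffices that any competing `S` commutes with `S₀`. If `S` is translationally invariant, it
commutes with the symbol and with all scalar functions of `k`, and `S₀` lies in the closed algebra
that these generate. If the indirect gap is positive, a single continuous function separates the two
signatures for all `k`, so `S₀` is a continuous function of the symbol alone and no translation
invariance is needed. -/

noncomputable section

/-! ### Coefficient vectors as a Krein space with conjugation -/

namespace NambuSpace

open scoped InnerProductSpace

variable {ι : Type}

section Basis

variable [DecidableEq ι]

/-- The coefficient vector of a single generator. -/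
def basisVec (s : ι ⊕ ι) : NambuSpace ι := lp.single 2 s (1 : ℂ)

theorem basisVec_apply (s t : ι ⊕ ι) : (basisVec s : NambuSpace ι) t = if t = s then 1 else 0 := by
  simp [basisVec, lp.single_apply, Pi.single_apply]

theorem hasSum_basisVec (F : NambuSpace ι) : HasSum (fun s => F s • basisVec s) F := by
  have h := lp.hasSum_single (p := 2) (by norm_num) F
  refine h.congr_fun ?_ |> id
  intro s
  rw [basisVec, ← lp.single_smul, smul_eq_mul, mul_one]

theorem hasSum_map_basisVec {E : Type*} [NormedAddCommGroup E] [NormedSpace ℂ E]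
    (A : NambuSpace ι →L[ℂ] E) (F : NambuSpace ι) :
    HasSum (fun s => F s • A (basisVec s)) (A F) := by
  simpa using (hasSum_basisVec F).mapL A

theorem hasSum_functional (A : NambuSpace ι →L[ℂ] ℂ) (F : NambuSpace ι) :
    HasSum (fun s => F s * A (basisVec s)) (A F) :=
  hasSum_map_basisVec A F

theorem clm_ext {E : Type*} [NormedAddCommGroup E] [NormedSpace ℂ E]
    {A A' : NambuSpace ι →L[ℂ] E} (h : ∀ s, A (basisVec s) = A' (basisVec s)) : A = A' := by
  ext1 F
  refine (hasSum_map_basisVec A F).unique ?_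
  simpa only [h] using hasSum_map_basisVec A' F

theorem inner_basisVec (s : ι ⊕ ι) (F : NambuSpace ι) : ⟪basisVec s, F⟫_ℂ = F s := by
  rw [basisVec, lp.inner_single_left]
  simp

end Basis

theorem conj_apply (F : NambuSpace ι) (s : ι ⊕ ι) : F.conj s = starRingEnd ℂ (F s.swap) := rfl

theorem conj_conj (F : NambuSpace ι) : F.conj.conj = F := by
  ext s; simp [conj_apply]

theorem conj_add (F G : NambuSpace ι) : (F + G).conj = F.conj + G.conj := by
  ext s; simp [conj_apply]

theorem conj_smul (c : ℂ) (F : NambuSpace ι) : (c • F).conj = starRingEnd ℂ c • F.conj := by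
  ext s; simp [conj_apply]

theorem conj_neg (F : NambuSpace ι) : (-F).conj = -F.conj := by
  ext s; simp [conj_apply]

theorem conj_zero : (0 : NambuSpace ι).conj = 0 := by
  ext s; simp [conj_apply]

theorem inner_conj_conj (F G : NambuSpace ι) : ⟪F.conj, G.conj⟫_ℂ = ⟪G, F⟫_ℂ := by
  rw [lp.inner_eq_tsum, lp.inner_eq_tsum, ← (Equiv.sumComm ι ι).tsum_eq]
  refine tsum_congr fun s => ?_
  simp [conj_apply, mul_comm]

theorem norm_conj (F : NambuSpace ι) : ‖F.conj‖ = ‖F‖ := by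
  have h := inner_conj_conj F F
  rw [inner_self_eq_norm_sq_to_K, inner_self_eq_norm_sq_to_K] at h
  have h2 : ‖F.conj‖ ^ 2 = ‖F‖ ^ 2 := by exact_mod_cast h
  exact (sq_eq_sq₀ (norm_nonneg _) (norm_nonneg _)).1 h2

theorem conj_basisVec [DecidableEq ι] (s : ι ⊕ ι) :
    (basisVec s : NambuSpace ι).conj = basisVec s.swap := by
  ext t
  rw [conj_apply, basisVec_apply, basisVec_apply]
  have : t.swap = s ↔ t = s.swap := by
    constructor <;> rintro h
    · rw [← h, Sum.swap_swap]
    · rw [h, Sum.swap_swap]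
  simp [this, apply_ite]

/-- The conjugate of an operator by the adjoint of linear expressions. -/
def conjOp (A : NambuSpace ι →L[ℂ] NambuSpace ι) : NambuSpace ι →L[ℂ] NambuSpace ι :=
  LinearMap.mkContinuous
    { toFun := fun F => (A F.conj).conj
      map_add' := fun F G => by rw [conj_add, map_add, conj_add]
      map_smul' := fun c F => by rw [conj_smul, map_smul, conj_smul]; simp } ‖A‖ fun F => by
    simpa [norm_conj] using A.le_opNorm F.conj

theorem conjOp_apply (A : NambuSpace ι →L[ℂ] NambuSpace ι) (F : NambuSpace ι) :
    conjOp A F = (A F.conj).conj := rfl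

theorem conjOp_mul (A A' : NambuSpace ι →L[ℂ] NambuSpace ι) :
    conjOp (A * A') = conjOp A * conjOp A' := by
  ext1 F; simp [conjOp_apply, conj_conj]

theorem conjOp_one : conjOp (1 : NambuSpace ι →L[ℂ] NambuSpace ι) = 1 := by
  ext1 F; simp [conjOp_apply, conj_conj]

theorem conjOp_nonneg {A : NambuSpace ι →L[ℂ] NambuSpace ι} (hA : 0 ≤ A) : 0 ≤ conjOp A := by
  rw [ContinuousLinearMap.nonneg_iff_isPositive, ContinuousLinearMap.isPositive_iff_complex] at *
  intro F
  have h := hA F.conj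
  have h2 : ⟪conjOp A F, F⟫_ℂ = starRingEnd ℂ ⟪A F.conj, F.conj⟫_ℂ := by
    rw [conjOp_apply, inner_conj_symm, ← inner_conj_conj, conj_conj]
  rw [h2]
  refine ⟨?_, by simpa only [RCLike.conj_re] using h.2⟩
  rw [← h.1]
  simp

/-- The sign of a generator in the Krein form. -/
def kreinSign : ι ⊕ ι → ℂ
  | .inl _ => 1
  | .inr _ => -1

theorem kreinSign_mul_self (s : ι ⊕ ι) : kreinSign s * kreinSign s = 1 := by
  rcases s with i | i <;> simp [kreinSign]

theorem kreinSign_swap (s : ι ⊕ ι) : kreinSign s.swap = -kreinSign s := by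
  rcases s with i | i <;> simp [kreinSign]

theorem conj_kreinSign (s : ι ⊕ ι) : starRingEnd ℂ (kreinSign s) = kreinSign s := by
  rcases s with i | i <;> simp [kreinSign]

theorem norm_kreinSign (s : ι ⊕ ι) : ‖kreinSign s‖ = 1 := by
  rcases s with i | i <;> simp [kreinSign]

/-- The operator `τ₃`. -/
def kreinOp : NambuSpace ι →L[ℂ] NambuSpace ι :=
  LinearIsometry.toContinuousLinearMap
    { toFun := fun F => ⟨fun s => kreinSign s * F s, by
        have h := (memℓp_gen_iff (p := 2) (by norm_num)).1 (lp.memℓp F)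
        refine memℓp_gen ?_
        simpa [norm_kreinSign] using h⟩
      map_add' := fun F G => by ext s; exact mul_add _ _ _
      map_smul' := fun c F => by ext s; exact mul_left_comm _ _ _
      norm_map' := fun F => by
        rw [lp.norm_eq_tsum_rpow (by norm_num), lp.norm_eq_tsum_rpow (by norm_num)]
        simp [norm_kreinSign] }

theorem kreinOp_apply (F : NambuSpace ι) (s : ι ⊕ ι) : kreinOp F s = kreinSign s * F s := rfl

theorem kreinOp_mul_self : (kreinOp : NambuSpace ι →L[ℂ] NambuSpace ι) * kreinOp = 1 := by
  ext F s
  simp [kreinOp_apply, ← mul_assoc, kreinSign_mul_self]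

theorem kreinOp_kreinOp (F : NambuSpace ι) : kreinOp (kreinOp F) = F :=
  DFunLike.congr_fun kreinOp_mul_self F

theorem kreinOp_conj (F : NambuSpace ι) : kreinOp F.conj = -(kreinOp F).conj := by
  ext s
  simp [kreinOp_apply, conj_apply, conj_kreinSign, kreinSign_swap]

/-- The adjoint exchanges annihilation and creation operators, hence the two signs of `τ₃`. -/
theorem conjOp_kreinOp : conjOp (kreinOp : NambuSpace ι →L[ℂ] NambuSpace ι) = -kreinOp := by
  ext1 F
  simp [conjOp_apply, kreinOp_conj, conj_neg, conj_conj]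

theorem inner_kreinOp_left (F G : NambuSpace ι) : ⟪kreinOp F, G⟫_ℂ = ⟪F, kreinOp G⟫_ℂ := by
  rw [lp.inner_eq_tsum, lp.inner_eq_tsum]
  refine tsum_congr fun s => ?_
  simp [kreinOp_apply, conj_kreinSign]
  ring

theorem star_kreinOp : star (kreinOp : NambuSpace ι →L[ℂ] NambuSpace ι) = kreinOp := by
  rw [ContinuousLinearMap.star_eq_adjoint, eq_comm, ContinuousLinearMap.eq_adjoint_iff]
  exact inner_kreinOp_left

/-- Rewrites the bilinear commutator as the sesquilinear Krein form, so that preserving commutators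
and adjoints becomes Krein unitarity. -/
theorem commutator_eq_inner (F G : NambuSpace ι) : F.commutator G = ⟪G.conj, kreinOp F⟫_ℂ := by
  have h := lp.hasSum_inner (𝕜 := ℂ) G.conj (kreinOp F)
  rw [commutator, ← h.tsum_eq]
  have hl := h.summable.comp_injective (Sum.inl_injective (α := ι) (β := ι))
  have hr := h.summable.comp_injective (Sum.inr_injective (α := ι) (β := ι))
  rw [Summable.tsum_sum hl hr, ← Summable.tsum_add (by exact hl) (by exact hr)]
  refine tsum_congr fun i => ?_
  simp [kreinOp_apply, conj_apply, kreinSign]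
  ring

theorem isAnnihilation_iff (F : NambuSpace ι) : F.IsAnnihilation ↔ kreinOp F = F := by
  constructor
  · intro h
    ext s
    rcases s with i | i
    · simp [kreinOp_apply, kreinSign]
    · simp [kreinOp_apply, kreinSign, h i]
  · intro h i
    have h2 : kreinOp F (.inr i) = F (.inr i) := by rw [h]
    rw [kreinOp_apply, kreinSign] at h2
    linear_combination (-1 / 2 : ℂ) * h2

end NambuSpace

/-! ### Positive square roots and fundamental symmetries -/

section OperatorSqrt

variable {E : Type*} [NormedAddCommGroup E] [InnerProductSpace ℂ E] [CompleteSpace E]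

theorem ContinuousLinearMap.exists_nonneg_mul_self_eq {A : E →L[ℂ] E} (hA : 0 ≤ A) :
    ∃ R : E →L[ℂ] E, 0 ≤ R ∧ R * R = A :=
  ⟨CFC.sqrt A, CFC.sqrt_nonneg A, CFC.sqrt_mul_sqrt_self A hA⟩

theorem ContinuousLinearMap.eq_of_mul_self_eq {R R' : E →L[ℂ] E} (hR : 0 ≤ R) (hR' : 0 ≤ R')
    (h : R * R = R' * R') : R = R' := by
  rw [← CFC.sqrt_unique h hR, CFC.sqrt_unique rfl hR']

end OperatorSqrt

namespace NambuSpace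

open scoped InnerProductSpace

variable {ι : Type}

/-- Fundamental symmetries of the Krein space of coefficient vectors: involutions `S` for which
`τ₃ S` is positive. -/
structure IsFundamentalSymmetry (S : NambuSpace ι →L[ℂ] NambuSpace ι) : Prop where
  mul_self : S * S = 1
  nonneg : 0 ≤ kreinOp * S

namespace IsFundamentalSymmetry

variable {S S' : NambuSpace ι →L[ℂ] NambuSpace ι}

theorem apply_apply (hS : IsFundamentalSymmetry S) (F : NambuSpace ι) : S (S F) = F :=
  DFunLike.congr_fun hS.mul_self F

/-- With `τ₃ S = R²` the inner product is `‖R F‖²`, so `τ₃ S F = R (R F) = 0`, and both `τ₃` and `S`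
are involutions. -/
theorem eq_zero_of_nonpos (hS : IsFundamentalSymmetry S) {F : NambuSpace ι}
    (h : (⟪F, kreinOp (S F)⟫_ℂ).re ≤ 0) : F = 0 := by
  obtain ⟨R, hR0, hR⟩ := ContinuousLinearMap.exists_nonneg_mul_self_eq hS.nonneg
  have hRF : R (R F) = kreinOp (S F) := DFunLike.congr_fun hR F
  rw [← hRF] at h
  have h1 : ⟪F, R (R F)⟫_ℂ = ⟪R F, R F⟫_ℂ := by
    have h2 := ContinuousLinearMap.adjoint_inner_right R F (R F)
    rw [← ContinuousLinearMap.star_eq_adjoint, (IsSelfAdjoint.of_nonneg hR0).star_eq] at h2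
    exact h2
  rw [h1, inner_self_eq_norm_sq_to_K] at h
  have h2 : R F = 0 := by
    have h3 : ‖R F‖ ^ 2 ≤ 0 := by exact_mod_cast h
    have h4 := sq_nonneg ‖R F‖
    have h5 : ‖R F‖ ^ 2 = 0 := le_antisymm h3 h4
    simpa using h5
  have h3 : kreinOp (S F) = 0 := by rw [← hRF, h2, map_zero]
  have h4 : S F = 0 := by rw [← kreinOp_kreinOp (S F), h3, map_zero]
  rw [← hS.apply_apply F, h4, map_zero]

/-- Commuting fundamental symmetries coincide. -/
theorem eq_of_commute (hS : IsFundamentalSymmetry S) (hS' : IsFundamentalSymmetry S')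
    (h : Commute S S') : S = S' := by
  -- On such an `F`, positivity of `τ₃ A'` makes the Krein square `⟨F, τ₃ F⟩` nonpositive, while it
  -- equals `⟨F, τ₃ A F⟩`.
  have key : ∀ {A A' : NambuSpace ι →L[ℂ] NambuSpace ι}, IsFundamentalSymmetry A →
      IsFundamentalSymmetry A' → ∀ F, A F = F → A' F = -F → F = 0 := by
    intro A A' hA hA' F h1 h2
    apply hA.eq_zero_of_nonpos
    have hp := (ContinuousLinearMap.nonneg_iff_isPositive _).1 hA'.nonneg
    have h3 := hp.re_inner_nonneg_right F
    have h4 : (kreinOp * A' : NambuSpace ι →L[ℂ] NambuSpace ι) F = -kreinOp F := by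
      change kreinOp (A' F) = _
      rw [h2, map_neg]
    rw [h4, inner_neg_right] at h3
    rw [h1]
    simpa using h3
  have hc : ∀ F, S (S' F) = S' (S F) := fun F => DFunLike.congr_fun h F
  -- `(1 + S)(1 - S')` and `(1 - S)(1 + S')` map into common eigenspaces with opposite signs, so
  -- both vanish; their difference is `2 (S - S')`.
  have h1 : ∀ F, F + S F - S' F - S (S' F) = 0 := fun F => key hS hS' _
    (by simp only [map_add, map_sub, hS.apply_apply]; abel)
    (by simp only [map_add, map_sub, hc, hS'.apply_apply]; abel)
  have h2 : ∀ F, F + S' F - S F - S (S' F) = 0 := fun F => key hS' hS _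
    (by simp only [map_add, map_sub, hc, hS'.apply_apply]; abel)
    (by simp only [map_add, map_sub, hS.apply_apply]; abel)
  ext1 F
  have h3 := h1 F
  have h4 := h2 F
  have h5 : (2 : ℂ) • (S F - S' F) = 0 := by
    rw [two_smul]
    calc _ = (F + S F - S' F - S (S' F)) - (F + S' F - S F - S (S' F)) := by abel
      _ = 0 := by rw [h3, h4, sub_zero]
  exact sub_eq_zero.1 ((smul_eq_zero.1 h5).resolve_left two_ne_zero)

end IsFundamentalSymmetry

end NambuSpace

/-! ### Bogoliubov transformations and their fundamental symmetries -/

namespace Bogoliubov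

open NambuSpace
open scoped InnerProductSpace

variable {ι : Type} (T : Bogoliubov ι)

/-- The fundamental symmetry of a Bogoliubov transformation: it is `1` on the new annihilation
operators and `-1` on the new creation operators. -/
def symmetry : NambuSpace ι →L[ℂ] NambuSpace ι :=
  (T.B : NambuSpace ι →L[ℂ] NambuSpace ι) * kreinOp * (T.B.symm : NambuSpace ι →L[ℂ] NambuSpace ι)

theorem symmetry_apply (F : NambuSpace ι) : T.symmetry F = T.B (kreinOp (T.B.symm F)) := rfl

theorem inner_kreinOp_map (F G : NambuSpace ι) :
    ⟪T.B F, kreinOp (T.B G)⟫_ℂ = ⟪F, kreinOp G⟫_ℂ := by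
  have h := T.map_commutator G F.conj
  rw [commutator_eq_inner, commutator_eq_inner, T.map_conj, conj_conj, conj_conj] at h
  exact h

/-- Krein unitarity moves `B` to the other side. The result says `τ₃ S = (B⁻¹)† B⁻¹`, which gives
positivity. -/
theorem inner_kreinOp_symmetry (F G : NambuSpace ι) :
    ⟪F, kreinOp (T.symmetry G)⟫_ℂ = ⟪T.B.symm F, T.B.symm G⟫_ℂ := by
  rw [symmetry_apply]
  conv_lhs => rw [← T.B.apply_symm_apply F]
  rw [inner_kreinOp_map, kreinOp_kreinOp]

theorem isFundamentalSymmetry_symmetry : IsFundamentalSymmetry T.symmetry where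
  mul_self := by
    ext1 F
    simp [symmetry_apply, kreinOp_kreinOp]
  nonneg := by
    rw [ContinuousLinearMap.nonneg_iff_isPositive]
    have h : kreinOp * T.symmetry = star (T.B.symm : NambuSpace ι →L[ℂ] NambuSpace ι)
        * (T.B.symm : NambuSpace ι →L[ℂ] NambuSpace ι) := by
      ext1 F
      refine ext_inner_left ℂ fun G => ?_
      rw [ContinuousLinearMap.star_eq_adjoint]
      refine (T.inner_kreinOp_symmetry G F).trans ?_
      exact (ContinuousLinearMap.adjoint_inner_right
        (T.B.symm : NambuSpace ι →L[ℂ] NambuSpace ι) G _).symm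
    rw [h, ← ContinuousLinearMap.nonneg_iff_isPositive]
    exact star_mul_self_nonneg _

theorem symmetry_eq_self_iff (F : NambuSpace ι) :
    T.symmetry F = F ↔ ∃ f : NambuSpace ι, f.IsAnnihilation ∧ T.B f = F := by
  constructor
  · intro h
    refine ⟨T.B.symm F, ?_, by simp⟩
    rw [isAnnihilation_iff]
    apply T.B.injective
    rw [← symmetry_apply, h, T.B.apply_symm_apply]
  · rintro ⟨f, hf, rfl⟩
    rw [isAnnihilation_iff] at hf
    simp [symmetry_apply, hf]

theorem symm_conj (F : NambuSpace ι) : T.B.symm F.conj = (T.B.symm F).conj := by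
  apply T.B.injective
  rw [T.map_conj]
  simp

theorem symmetry_conj (F : NambuSpace ι) : T.symmetry F.conj = -(T.symmetry F).conj := by
  simp [symmetry_apply, symm_conj, kreinOp_conj, T.map_conj]

/-- An operator compatible with the adjoint that preserves the new annihilation operators
commutes with the fundamental symmetry. -/
theorem commute_symmetry {A : NambuSpace ι →L[ℂ] NambuSpace ι} {ε : ℂ}
    (hA : ∀ F, A F.conj = ε • (A F).conj) (h : ∀ F, T.symmetry F = F → T.symmetry (A F) = A F) :
    Commute T.symmetry A := by
  have hS := T.isFundamentalSymmetry_symmetry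
  -- The new creation operators are the adjoints of the new annihilation operators, so the
  -- hypothesis passes from the eigenvalue `1` to `-1`.
  have h' : ∀ F, T.symmetry F = -F → T.symmetry (A F) = -A F := by
    intro F hF
    have h1 : T.symmetry F.conj = F.conj := by rw [symmetry_conj, hF, conj_neg, neg_neg]
    have h2 := h _ h1
    have h3 : A F = ε • (A F.conj).conj := by rw [← hA, conj_conj]
    rw [h3, map_smul, symmetry_conj, h2, smul_neg]
  have h1 : ∀ F, T.symmetry (A (F + T.symmetry F)) = A (F + T.symmetry F) := fun F =>
    h _ (by rw [map_add, hS.apply_apply, add_comm])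
  have h2 : ∀ F, T.symmetry (A (F - T.symmetry F)) = -A (F - T.symmetry F) := fun F =>
    h' _ (by rw [map_sub, hS.apply_apply, neg_sub])
  ext1 F
  have h3 := h1 F
  have h4 := h2 F
  simp only [map_add, map_sub] at h3 h4
  have h5 : (2 : ℂ) • (T.symmetry (A F) - A (T.symmetry F)) = 0 := by
    rw [two_smul]
    have h6 : T.symmetry (A F) = A F + A (T.symmetry F) - T.symmetry (A (T.symmetry F)) := by
      rw [← h3]; abel
    have h7 : T.symmetry (A F) = -(A F - A (T.symmetry F)) + T.symmetry (A (T.symmetry F)) := by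
      rw [← h4]; abel
    calc T.symmetry (A F) - A (T.symmetry F) + (T.symmetry (A F) - A (T.symmetry F))
        = T.symmetry (A F) + T.symmetry (A F) - A (T.symmetry F) - A (T.symmetry F) := by abel
      _ = (A F + A (T.symmetry F) - T.symmetry (A (T.symmetry F)))
        + (-(A F - A (T.symmetry F)) + T.symmetry (A (T.symmetry F)))
          - A (T.symmetry F) - A (T.symmetry F) := by rw [← h6, ← h7]
      _ = 0 := by abel
  exact sub_eq_zero.1 ((smul_eq_zero.1 h5).resolve_left two_ne_zero)

/-- Every fundamental symmetry compatible with the adjoint comes from a Bogoliubov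
transformation. -/
theorem exists_symmetry_eq {S : NambuSpace ι →L[ℂ] NambuSpace ι} (hS : IsFundamentalSymmetry S)
    (hc : conjOp S = -S) : ∃ T : Bogoliubov ι, T.symmetry = S := by
  set τ : NambuSpace ι →L[ℂ] NambuSpace ι := kreinOp with hτ
  have hττ : τ * τ = 1 := kreinOp_mul_self
  have hSS : S * S = 1 := hS.mul_self
  set η := τ * S with hη
  have hη0 : 0 ≤ η := hS.nonneg
  -- The transformation will be `B = τ R τ = R⁻¹`; then `B τ B⁻¹ = τ R τ τ R = τ R² = S`.
  obtain ⟨R, hR0, hRR⟩ := ContinuousLinearMap.exists_nonneg_mul_self_eq hη0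
  have hRs : star R = R := (IsSelfAdjoint.of_nonneg hR0).star_eq
  have hinv : η * (S * τ) = 1 := by
    rw [hη, mul_assoc, ← mul_assoc S S τ, hSS, one_mul, hττ]
  have hinv' : (S * τ) * η = 1 := by
    rw [hη, mul_assoc, ← mul_assoc τ τ S, hττ, one_mul, hSS]
  -- `R` is invertible, with inverse `τ R τ`
  set R' := τ * R * τ with hR'
  have hR'0 : 0 ≤ R' := by
    have := star_left_conjugate_nonneg hR0 τ
    rwa [star_kreinOp] at this
  have hR'R' : R' * R' = S * τ := by
    calc R' * R' = τ * R * (τ * τ) * R * τ := by rw [hR']; noncomm_ring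
      _ = τ * (R * R) * τ := by rw [hττ]; noncomm_ring
      _ = (τ * τ) * S * τ := by rw [hRR, hη]; noncomm_ring
      _ = S * τ := by rw [hττ, one_mul]
  have hl : (R * (S * τ)) * R = 1 := by
    have h1 : R * (R * (S * τ)) = 1 := by rw [← mul_assoc, hRR, hinv]
    have h2 : ((S * τ) * R) * R = 1 := by rw [mul_assoc, hRR, hinv']
    have h3 : (S * τ) * R = R * (S * τ) := left_inv_eq_right_inv h2 h1
    rw [← h3, h2]
  have hr : R * (R * (S * τ)) = 1 := by rw [← mul_assoc, hRR, hinv]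
  -- Both sides are positive square roots of `S * τ`, the inverse of `η`: the left one is the
  -- inverse of the positive operator `R`, the right one is `R` conjugated by the self-adjoint `τ`.
  have hRinv : R * (S * τ) = R' := by
    set Q := R * (S * τ) with hQ
    have hQs : star Q = Q := by
      have h1 : star Q * R = 1 := by
        have := congrArg star hr
        rwa [star_mul, hRs, star_one] at this
      exact left_inv_eq_right_inv h1 hr
    have hQ0 : 0 ≤ Q := by
      have h1 : Q = star Q * R * Q := by rw [hQs, mul_assoc, hr, mul_one]
      rw [h1]
      exact star_left_conjugate_nonneg hR0 Q
    have hQQ : Q * Q = S * τ := by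
      calc Q * Q = (Q * R) * (S * τ) := by rw [mul_assoc Q R (S * τ)]
        _ = S * τ := by rw [hl, one_mul]
    exact ContinuousLinearMap.eq_of_mul_self_eq hQ0 hR'0 (hQQ.trans hR'R'.symm)
  rw [hRinv] at hl hr
  -- compatibility with the adjoint
  have hcη : conjOp η = η := by
    rw [hη, conjOp_mul, hc, conjOp_kreinOp, neg_mul_neg]
  have hcR : conjOp R = R := by
    have h1 : conjOp R * conjOp R = η := by rw [← conjOp_mul, hRR, hcη]
    exact ContinuousLinearMap.eq_of_mul_self_eq (conjOp_nonneg hR0) hR0 (h1.trans hRR.symm)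
  have hcR' : conjOp R' = R' := by
    rw [hR', conjOp_mul, conjOp_mul, conjOp_kreinOp, hcR]
    noncomm_ring
  let e : NambuSpace ι ≃L[ℂ] NambuSpace ι :=
    ContinuousLinearEquiv.equivOfInverse R' R (fun F => DFunLike.congr_fun hr F)
      (fun F => DFunLike.congr_fun hl F)
  have hconj : ∀ F : NambuSpace ι, R' F.conj = (R' F).conj := by
    intro F
    conv_lhs => rw [← hcR']
    rw [conjOp_apply, conj_conj]
  have hkrein : star R' * τ * R' = τ := by
    rw [(IsSelfAdjoint.of_nonneg hR'0).star_eq]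
    calc R' * τ * R' = R' * (τ * τ) * R * τ := by
          conv_lhs => rw [hR']
          rw [hR']; noncomm_ring
      _ = τ := by rw [hττ, mul_one, hl, one_mul]
  refine ⟨⟨e, fun F G => ?_, hconj⟩, ?_⟩
  · rw [commutator_eq_inner, commutator_eq_inner]
    change ⟪(R' G).conj, τ (R' F)⟫_ℂ = ⟪G.conj, τ F⟫_ℂ
    rw [← hconj]
    have := ContinuousLinearMap.adjoint_inner_right R' G.conj (τ (R' F))
    rw [← this]
    have h2 := DFunLike.congr_fun hkrein F
    exact congrArg _ h2
  · change R' * τ * R = S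
    calc R' * τ * R = τ * R * (τ * τ) * R := by rw [hR']; noncomm_ring
      _ = τ * (R * R) := by rw [hττ]; noncomm_ring
      _ = S := by rw [hRR, hη, ← mul_assoc, hττ, one_mul]

end Bogoliubov

/-! ### Words in the generators and uniqueness of the vacuum -/

namespace CCRAlgebra

variable {ι : Type} [DecidableEq ι]

theorem ccrForm_eq (s t : ι ⊕ ι) :
    ccrForm s t = if t = s.swap then NambuSpace.kreinSign s else 0 := by
  rcases s with i | i <;> rcases t with j | j <;>
    simp [ccrForm, NambuSpace.kreinSign, eq_comm]

/-- The product of a list of generators. -/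
def word (l : List (ι ⊕ ι)) : CCRAlgebra ι := (l.map nambu).prod

theorem word_nil : word ([] : List (ι ⊕ ι)) = 1 := rfl

theorem word_cons (s : ι ⊕ ι) (l : List (ι ⊕ ι)) : word (s :: l) = nambu s * word l := by
  simp [word]

theorem word_concat (l : List (ι ⊕ ι)) (s : ι ⊕ ι) : word (l ++ [s]) = word l * nambu s := by
  simp [word]

theorem word_append (l l' : List (ι ⊕ ι)) : word (l ++ l') = word l * word l' := by
  simp [word]

theorem adjoin_nambu : Algebra.adjoin ℂ (Set.range (nambu : ι ⊕ ι → CCRAlgebra ι)) = ⊤ := by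
  let P := Algebra.adjoin ℂ (Set.range (nambu : ι ⊕ ι → CCRAlgebra ι))
  have hmem : ∀ s : ι ⊕ ι, (nambu s : CCRAlgebra ι) ∈ P := fun s =>
    Algebra.subset_adjoin ⟨s, rfl⟩
  let f : CCRAlgebra ι →ₐ[ℂ] P := lift (fun s => ⟨nambu s, hmem s⟩) (by
    intro s t
    apply Subtype.ext
    exact nambu_mul s t)
  have h : P.val.comp f = AlgHom.id ℂ _ := algHom_ext fun s => by
    change ((f (nambu s) : P) : CCRAlgebra ι) = nambu s
    rw [lift_nambu]
  rw [eq_top_iff]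
  intro X _
  have h2 : ((f X : P) : CCRAlgebra ι) = X := DFunLike.congr_fun h X
  rw [← h2]
  exact (f X).2

theorem span_word : Submodule.span ℂ (Set.range (word : List (ι ⊕ ι) → CCRAlgebra ι)) = ⊤ := by
  rw [eq_top_iff]
  intro X _
  have hX : X ∈ Algebra.adjoin ℂ (Set.range (nambu : ι ⊕ ι → CCRAlgebra ι)) := by
    rw [adjoin_nambu]; trivial
  induction hX using Algebra.adjoin_induction with
  | mem x hx =>
    obtain ⟨s, rfl⟩ := hx
    exact Submodule.subset_span ⟨[s], by simp [word]⟩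
  | algebraMap c =>
    rw [Algebra.algebraMap_eq_smul_one]
    exact Submodule.smul_mem _ _ (Submodule.subset_span ⟨[], rfl⟩)
  | add x y _ _ hx hy => exact Submodule.add_mem _ (hx trivial) (hy trivial)
  | mul x y _ _ hx hy =>
    have hx := hx trivial
    have hy := hy trivial
    clear * - hx hy
    induction hx using Submodule.span_induction with
    | zero => rw [zero_mul]; exact Submodule.zero_mem _
    | add a b _ _ ha hb => rw [add_mul]; exact Submodule.add_mem _ ha hb
    | smul c a _ ha => rw [smul_mul_assoc]; exact Submodule.smul_mem _ _ ha
    | mem a ha =>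
      obtain ⟨l, rfl⟩ := ha
      induction hy using Submodule.span_induction with
      | zero => rw [mul_zero]; exact Submodule.zero_mem _
      | add a b _ _ ha hb => rw [mul_add]; exact Submodule.add_mem _ ha hb
      | smul c a _ ha => rw [mul_smul_comm]; exact Submodule.smul_mem _ _ ha
      | mem b hb =>
        obtain ⟨l', rfl⟩ := hb
        exact Submodule.subset_span ⟨l ++ l', word_append l l'⟩

theorem induction_word {p : CCRAlgebra ι → Prop} (hw : ∀ l, p (word l))
    (hadd : ∀ X Y, p X → p Y → p (X + Y)) (hsmul : ∀ (c : ℂ) X, p X → p (c • X))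
    (X : CCRAlgebra ι) : p X := by
  have hX : X ∈ Submodule.span ℂ (Set.range (word : List (ι ⊕ ι) → CCRAlgebra ι)) := by
    rw [span_word]; trivial
  induction hX using Submodule.span_induction with
  | mem x hx => obtain ⟨l, rfl⟩ := hx; exact hw l
  | zero => simpa using hsmul 0 1 (hw [])
  | add x y _ _ hx hy => exact hadd x y hx hy
  | smul c x _ hx => exact hsmul c x hx

/-- The commutator of a product of generators with a generator. -/
theorem word_commutator (l : List (ι ⊕ ι)) (s : ι ⊕ ι) :
    word l * nambu s = nambu s * word l
      + ∑ k : Fin l.length, ccrForm l[k] s • word (l.eraseIdx k) := by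
  induction l with
  | nil => simp [word]
  | cons t l ih =>
    rw [word_cons, mul_assoc, ih, mul_add, ← mul_assoc, nambu_mul, add_mul, mul_assoc,
      Algebra.algebraMap_eq_smul_one, smul_mul_assoc, one_mul, add_assoc]
    congr 1
    change _ = ∑ k : Fin (l.length + 1), _
    rw [Fin.sum_univ_succ, Finset.mul_sum]
    congr 1
    refine Finset.sum_congr rfl fun k _ => ?_
    rw [mul_smul_comm]
    simp [word_cons]

end CCRAlgebra

namespace NambuSpace

open CCRAlgebra

variable {ι : Type} [DecidableEq ι]

/-- A functional that vanishes on `X φ(F)` and `φ(conj F) X` for all `F` in the positive part of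
a fundamental symmetry and on `1` is zero. -/
theorem functional_eq_zero {S : NambuSpace ι →L[ℂ] NambuSpace ι} (hS : S * S = 1)
    (η : CCRAlgebra ι →ₗ[ℂ] ℂ) (h1 : η 1 = 0)
    (hr : ∀ F : NambuSpace ι, S F = F → ∀ X, HasSum (fun s => F s * η (X * nambu s)) 0)
    (hl : ∀ F : NambuSpace ι, S F = -F → ∀ X, HasSum (fun s => F s * η (nambu s * X)) 0) :
    η = 0 := by
  have hS' : ∀ F, S (S F) = F := fun F => DFunLike.congr_fun hS F
  -- Strong induction on the length. The last letter is split as `f + g` along the eigenspaces of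
  -- `S`. The part `f` gives zero on the right and `g` gives zero on the left; moving a letter from
  -- the right end to the left end costs only shorter words, on which `η` vanishes by induction.
  have hw : ∀ n : ℕ, ∀ l : List (ι ⊕ ι), l.length = n → η (word l) = 0 := by
    intro n
    induction n using Nat.strong_induction_on with
    | _ n ih =>
      intro l hn
      rcases List.eq_nil_or_concat l with rfl | ⟨l, s, rfl⟩
      · exact h1
      · rw [List.concat_eq_append, List.length_append, List.length_singleton] at hn
        rw [List.concat_eq_append, word_concat]
        set f : NambuSpace ι := (1 / 2 : ℂ) • (basisVec s + S (basisVec s)) with hf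
        set g : NambuSpace ι := (1 / 2 : ℂ) • (basisVec s - S (basisVec s)) with hg
        have hfS : S f = f := by rw [hf, map_smul, map_add, hS', add_comm]
        have hgS : S g = -g := by rw [hg, map_smul, map_sub, hS', ← smul_neg, neg_sub]
        have hfg : basisVec s = f + g := by
          rw [hf, hg, ← smul_add, add_add_sub_cancel, ← two_smul ℂ, smul_smul]; norm_num
        have e1 := hr f hfS (word l)
        have e2 := hl g hgS (word l)
        have e3 : HasSum (fun t => (basisVec s : NambuSpace ι) t * η (word l * nambu t))
            (η (word l * nambu s)) := by
          have := hasSum_single (f := fun t => (basisVec s : NambuSpace ι) t *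
            η (word l * nambu t)) s (fun t ht => by simp [basisVec_apply, ht])
          simpa [basisVec_apply] using this
        have e4 := (e3.sub e1).sub e2
        have e5 : ∀ t, (basisVec s : NambuSpace ι) t * η (word l * nambu t)
            - f t * η (word l * nambu t) - g t * η (nambu t * word l) = 0 := by
          intro t
          have h6 : (basisVec s : NambuSpace ι) t = f t + g t := by rw [hfg]; rfl
          have h7 : η (word l * nambu t) = η (nambu t * word l) := by
            rw [word_commutator, map_add, map_sum, Finset.sum_eq_zero, add_zero]
            intro k _
            rw [map_smul, ih (l.eraseIdx k).length _ _ rfl, smul_zero]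
            rw [List.length_eraseIdx]
            split_ifs <;> omega
          rw [h6, h7]; ring
        simp only [e5] at e4
        simpa using e4.unique hasSum_zero
  ext X
  refine induction_word (p := fun X => η X = 0) (fun l => hw _ l rfl) ?_ ?_ X
  · intro X Y hX hY; rw [map_add, hX, hY, add_zero]
  · intro c X hX; rw [map_smul, hX, smul_zero]

end NambuSpace

namespace CCRState

open CCRAlgebra NambuSpace

variable {ι : Type} [DecidableEq ι]

/-- Positivity at `X + 1` and at `i X + 1` forces `⟨X†⟩ + ⟨X⟩` and `i (⟨X⟩ - ⟨X†⟩)` to be real. -/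
theorem expect_star (ω : CCRState ι) (X : CCRAlgebra ι) :
    ω.expect (star X) = starRingEnd ℂ (ω.expect X) := by
  have h1 := ω.im_eq_zero (X + 1)
  have h2 := ω.im_eq_zero (Complex.I • X + 1)
  have h0 := ω.im_eq_zero X
  have e1 : star (X + 1) * (X + 1) = star X * X + star X + X + 1 := by
    rw [star_add, star_one]; noncomm_ring
  have e2 : star (Complex.I • X + 1) * (Complex.I • X + 1)
      = star X * X + (-Complex.I) • star X + Complex.I • X + 1 := by
    rw [star_add, star_one, star_smul, add_mul, mul_add, mul_add, smul_mul_smul_comm]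
    simp
    abel
  rw [e1] at h1
  rw [e2] at h2
  simp only [map_add, map_smul, ω.normalized, Complex.add_im, h0, smul_eq_mul, Complex.mul_im,
    Complex.neg_re, Complex.neg_im, Complex.I_re, Complex.I_im, Complex.one_im] at h1 h2
  apply Complex.ext
  · simp only [Complex.conj_re]; linarith
  · simp only [Complex.conj_im]; linarith

theorem ext_expect {ω ω' : CCRState ι} (h : ω.expect = ω'.expect) : ω = ω' := by
  cases ω; cases ω'; congr

/-- The state is annihilated by all the annihilation operators of a fundamental symmetry. -/
def IsVacuumOf (ω : CCRState ι) (S : NambuSpace ι →L[ℂ] NambuSpace ι) : Prop :=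
  ∀ F, S F = F → ω.AnnihilatedBy F

theorem isQuasiparticleVacuum_iff (ω : CCRState ι) :
    ω.IsQuasiparticleVacuum ↔ ∃ T : Bogoliubov ι, ω.IsVacuumOf T.symmetry := by
  refine exists_congr fun T => ⟨fun h F hF => ?_, fun h f hf => ?_⟩
  · obtain ⟨f, hf, rfl⟩ := (T.symmetry_eq_self_iff F).1 hF
    exact h f hf
  · exact h _ ((T.symmetry_eq_self_iff _).2 ⟨f, hf, rfl⟩)

theorem hasSum_left_of_annihilatedBy {ω : CCRState ι} {F : NambuSpace ι}
    (h : ω.AnnihilatedBy F.conj) (X : CCRAlgebra ι) :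
    HasSum (fun s => F s * ω.expect (nambu s * X)) 0 := by
  have h1 := Complex.hasSum_conj'.2 (h (star X))
  have h2 := (Equiv.sumComm ι ι).hasSum_iff.2 h1
  simp only [Equiv.sumComm_apply, map_zero, Function.comp_def] at h2
  refine h2.congr_fun ?_ |> id
  intro s
  have h3 : star (nambu s * X) = star X * nambu s.swap := by rw [star_mul, star_nambu]
  have h4 : ω.expect (star X * nambu s.swap) = starRingEnd ℂ (ω.expect (nambu s * X)) := by
    rw [← h3, expect_star]
  simp [NambuSpace.conj_apply, h4]

variable {T : Bogoliubov ι} {ω ω' : CCRState ι}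

theorem IsVacuumOf.hasSum_left (h : ω.IsVacuumOf T.symmetry) {F : NambuSpace ι}
    (hF : T.symmetry F = -F) (X : CCRAlgebra ι) :
    HasSum (fun s => F s * ω.expect (nambu s * X)) 0 :=
  hasSum_left_of_annihilatedBy (h _ (by rw [T.symmetry_conj, hF, NambuSpace.conj_neg, neg_neg])) X

theorem IsVacuumOf.unique (h : ω.IsVacuumOf T.symmetry) (h' : ω'.IsVacuumOf T.symmetry) :
    ω = ω' := by
  apply ext_expect
  rw [← sub_eq_zero]
  refine functional_eq_zero T.isFundamentalSymmetry_symmetry.mul_self _ ?_ ?_ ?_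
  · simp [ω.normalized, ω'.normalized]
  · intro F hF X
    simpa [mul_sub] using (h F hF X).sub (h' F hF X)
  · intro F hF X
    simpa [mul_sub] using (h.hasSum_left hF X).sub (h'.hasSum_left hF X)

/-- Expectation values of the form `⟨X φ(F)⟩`, as continuous functionals of `F`. -/
theorem IsVacuumOf.exists_functional (h : ω.IsVacuumOf T.symmetry) (X : CCRAlgebra ι) :
    ∃ A : NambuSpace ι →L[ℂ] ℂ, ∀ s, A (basisVec s) = ω.expect (X * nambu s) := by
  have hS := T.isFundamentalSymmetry_symmetry
  set S := T.symmetry with hSdef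
  refine induction_word (p := fun X => ∃ A : NambuSpace ι →L[ℂ] ℂ,
    ∀ s, A (basisVec s) = ω.expect (X * nambu s)) ?_ ?_ ?_ X
  · intro l
    -- `Q` projects onto the new creation operators. In `⟨word l φ(F)⟩` only `φ(Q F)` contributes,
    -- and it gives zero when moved to the far left. What remains is a finite sum over the letters
    -- of `l`, each term reading off one coordinate of `Q F`; hence continuity in `F`.
    set Q : NambuSpace ι →L[ℂ] NambuSpace ι := (1 / 2 : ℂ) • (1 - S) with hQ
    have hQa : ∀ F, Q F = (1 / 2 : ℂ) • (F - S F) := fun F => rfl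
    have hQS : ∀ F, S (Q F) = -Q F := fun F => by
      rw [hQa, map_smul, map_sub, hS.apply_apply, ← smul_neg, neg_sub]
    have hPS : ∀ F, S (F - Q F) = F - Q F := fun F => by
      have h2 : F - Q F = (1 / 2 : ℂ) • (F + S F) := by
        rw [hQa]
        module
      rw [h2, map_smul, map_add, hS.apply_apply, add_comm]
    refine ⟨∑ k : Fin l.length, (ω.expect (word (l.eraseIdx k)) * kreinSign l[k]) •
      ((innerSL ℂ (basisVec l[k].swap)).comp Q), fun s => ?_⟩
    have e1 := h _ (hPS (basisVec s)) (word l)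
    have e2 := h.hasSum_left (hQS (basisVec s)) (word l)
    have e3 : HasSum (fun t => (basisVec s : NambuSpace ι) t * ω.expect (word l * nambu t))
        (ω.expect (word l * nambu s)) := by
      have := hasSum_single (f := fun t => (basisVec s : NambuSpace ι) t *
        ω.expect (word l * nambu t)) s (fun t ht => by simp [basisVec_apply, ht])
      simpa [basisVec_apply] using this
    have e4 := (e3.sub e1).sub e2
    have e5 : HasSum (fun t => ∑ k : Fin l.length, Q (basisVec s) t * (ccrForm l[k] t
        * ω.expect (word (l.eraseIdx k)))) (∑ k : Fin l.length,
          Q (basisVec s) l[k].swap * (kreinSign l[k] * ω.expect (word (l.eraseIdx k)))) := by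
      refine hasSum_sum fun k _ => ?_
      have := hasSum_single (f := fun t => Q (basisVec s) t * (ccrForm l[k] t
        * ω.expect (word (l.eraseIdx k)))) l[k].swap
        (fun t ht => by rw [ccrForm_eq, if_neg ht]; simp)
      simpa [ccrForm_eq] using this
    have e6 : (fun t => (basisVec s : NambuSpace ι) t * ω.expect (word l * nambu t)
        - (basisVec s - Q (basisVec s) : NambuSpace ι) t * ω.expect (word l * nambu t)
        - Q (basisVec s) t * ω.expect (nambu t * word l)) = fun t => ∑ k : Fin l.length,
        Q (basisVec s) t * (ccrForm l[k] t * ω.expect (word (l.eraseIdx k))) := by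
      funext t
      have h6 : (basisVec s - Q (basisVec s) : NambuSpace ι) t
        = (basisVec s : NambuSpace ι) t - Q (basisVec s) t := rfl
      rw [h6, word_commutator, map_add, map_sum, ← Finset.mul_sum]
      simp only [map_smul, smul_eq_mul]
      ring
    rw [e6] at e4
    have e7 := e4.unique e5
    rw [sub_zero, sub_zero] at e7
    rw [e7]
    simp only [sum_apply, smul_apply,
      ContinuousLinearMap.comp_apply, innerSL_apply_apply, inner_basisVec, smul_eq_mul]
    exact Finset.sum_congr rfl fun k _ => by ring
  · rintro X Y ⟨A, hA⟩ ⟨A', hA'⟩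
    exact ⟨A + A', fun s => by rw [add_apply, hA, hA', add_mul, map_add]⟩
  · rintro c X ⟨A, hA⟩
    exact ⟨c • A, fun s => by rw [smul_apply, hA, smul_mul_assoc, map_smul]⟩

/-- Only the annihilation operators of a quasiparticle vacuum annihilate it. -/
theorem IsVacuumOf.symmetry_eq_self (h : ω.IsVacuumOf T.symmetry) {F : NambuSpace ι}
    (hF : ∀ t, HasSum (fun s => F s * ω.expect (nambu t * nambu s)) 0) : T.symmetry F = F := by
  have hS := T.isFundamentalSymmetry_symmetry
  set f : NambuSpace ι := (1 / 2 : ℂ) • (F + T.symmetry F) with hf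
  set g : NambuSpace ι := (1 / 2 : ℂ) • (F - T.symmetry F) with hg
  have hfS : T.symmetry f = f := by rw [hf, map_smul, map_add, hS.apply_apply, add_comm]
  have hgS : T.symmetry g = -g := by
    rw [hg, map_smul, map_sub, hS.apply_apply, ← smul_neg, neg_sub]
  have hfg : F = f + g := by
    rw [hf, hg, ← smul_add, add_add_sub_cancel, ← two_smul ℂ, smul_smul]; norm_num
  -- Once `f` is removed on the right and `g` on the left, only `∑ s, g s [nambu t.swap, nambu s]`
  -- is left, which is the coordinate `g t` up to sign.
  have hg0 : g = 0 := by
    ext t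
    have e1 := ((hF t.swap).sub (h f hfS (nambu t.swap))).sub (h.hasSum_left hgS (nambu t.swap))
    have e2 : (fun s => F s * ω.expect (nambu t.swap * nambu s)
        - f s * ω.expect (nambu t.swap * nambu s) - g s * ω.expect (nambu s * nambu t.swap))
        = fun s => g s * ccrForm t.swap s := by
      funext s
      have h6 : F s = f s + g s := by conv_lhs => rw [hfg]
                                      rfl
      rw [nambu_mul, map_add, Algebra.algebraMap_eq_smul_one, map_smul, ω.normalized, h6]
      simp only [smul_eq_mul, mul_one]
      ring
    rw [e2] at e1
    have e3 := hasSum_single (f := fun s => g s * ccrForm t.swap s) t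
      (fun s hs => by simp [ccrForm_eq, hs])
    have e4 := e1.unique e3
    simp only [ccrForm_eq, Sum.swap_swap, if_true, sub_zero] at e4
    have e5 : kreinSign t.swap ≠ 0 := fun h0 => by
      have := norm_kreinSign t.swap
      rw [h0] at this
      simp at this
    exact (mul_eq_zero.1 e4.symm).resolve_right e5
  rw [hfg, hg0, add_zero, hfS]

end CCRState

/-! ### The Fock inner product on polynomials -/

namespace FockForm

open MvPolynomial

variable {σ : Type} [Fintype σ]

/-- The squared norm of a monomial in the Fock space of polynomials. -/
def weight (m : σ →₀ ℕ) : ℕ := ∏ i, (m i).factorial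

/-- The Fock inner product of polynomials, in which different monomials are orthogonal. -/
def form (p q : MvPolynomial σ ℂ) : ℂ :=
  ∑ m ∈ p.support, (weight m : ℂ) * (starRingEnd ℂ (coeff m p) * coeff m q)

theorem form_eq_sum {p : MvPolynomial σ ℂ} {s : Finset (σ →₀ ℕ)} (hs : p.support ⊆ s)
    (q : MvPolynomial σ ℂ) :
    form p q = ∑ m ∈ s, (weight m : ℂ) * (starRingEnd ℂ (coeff m p) * coeff m q) := by
  refine Finset.sum_subset hs fun m _ hm => ?_
  rw [notMem_support_iff.1 hm]; simp

theorem form_add_left (p p' q : MvPolynomial σ ℂ) : form (p + p') q = form p q + form p' q := by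
  classical
  rw [form_eq_sum (s := p.support ∪ p'.support) support_add,
    form_eq_sum (s := p.support ∪ p'.support) Finset.subset_union_left,
    form_eq_sum (s := p.support ∪ p'.support) Finset.subset_union_right, ← Finset.sum_add_distrib]
  refine Finset.sum_congr rfl fun m _ => ?_
  rw [coeff_add, map_add]; ring

theorem form_add_right (p q q' : MvPolynomial σ ℂ) : form p (q + q') = form p q + form p q' := by
  rw [form, form, form, ← Finset.sum_add_distrib]
  refine Finset.sum_congr rfl fun m _ => ?_
  rw [coeff_add]; ring

theorem form_smul_right (c : ℂ) (p q : MvPolynomial σ ℂ) : form p (c • q) = c * form p q := by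
  rw [form, form, Finset.mul_sum]
  refine Finset.sum_congr rfl fun m _ => ?_
  rw [coeff_smul, smul_eq_mul]; ring

theorem form_symm (p q : MvPolynomial σ ℂ) : starRingEnd ℂ (form p q) = form q p := by
  classical
  rw [form_eq_sum (s := p.support ∪ q.support) Finset.subset_union_left,
    form_eq_sum (s := p.support ∪ q.support) Finset.subset_union_right, map_sum]
  refine Finset.sum_congr rfl fun m _ => ?_
  rw [map_mul, map_mul, Complex.conj_conj, Complex.conj_natCast, mul_comm (coeff m p)]

theorem form_smul_left (c : ℂ) (p q : MvPolynomial σ ℂ) :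
    form (c • p) q = starRingEnd ℂ c * form p q := by
  rw [← form_symm, form_smul_right, map_mul, form_symm]

theorem form_monomial (m : σ →₀ ℕ) (a : ℂ) (q : MvPolynomial σ ℂ) :
    form (monomial m a) q = weight m * (starRingEnd ℂ a * coeff m q) := by
  classical
  rw [form_eq_sum (s := {m}) support_monomial_subset]
  simp

theorem form_one (q : MvPolynomial σ ℂ) : form 1 q = constantCoeff q := by
  have := form_monomial (0 : σ →₀ ℕ) 1 q
  simpa [weight, constantCoeff_eq] using this

theorem form_self_nonneg (p : MvPolynomial σ ℂ) : 0 ≤ (form p p).re ∧ (form p p).im = 0 := by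
  have h : form p p = ((∑ m ∈ p.support, (weight m : ℝ) * ‖coeff m p‖ ^ 2 : ℝ) : ℂ) := by
    rw [form]
    push_cast
    refine Finset.sum_congr rfl fun m _ => ?_
    rw [Complex.conj_mul']
  rw [h]
  refine ⟨?_, Complex.ofReal_im _⟩
  rw [Complex.ofReal_re]
  positivity

theorem weight_add_single (m : σ →₀ ℕ) (i : σ) :
    weight (m + Finsupp.single i 1) = weight m * (m i + 1) := by
  classical
  rw [weight, weight, ← Finset.mul_prod_erase _ _ (Finset.mem_univ i),
    ← Finset.mul_prod_erase (a := i) _ (fun i => (m i).factorial) (Finset.mem_univ i)]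
  have : ∏ j ∈ Finset.univ.erase i, ((m + Finsupp.single i 1 : σ →₀ ℕ) j).factorial
      = ∏ j ∈ Finset.univ.erase i, (m j).factorial := by
    refine Finset.prod_congr rfl fun j hj => ?_
    rw [Finsupp.add_apply, Finsupp.single_apply, if_neg (Finset.ne_of_mem_erase hj).symm, add_zero]
  rw [this]
  simp [Nat.factorial_succ]
  ring

/-- The factorial weights are made for this: raising the exponent of `X i` multiplies the weight by
`m i + 1`, the factor that `pderiv i` brings down. -/
theorem form_X_mul (i : σ) (p q : MvPolynomial σ ℂ) : form (X i * p) q = form p (pderiv i q) := by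
  induction p using MvPolynomial.induction_on' with
  | monomial m a =>
    rw [mul_comm, ← pow_one (X i), X_pow_eq_monomial, monomial_mul, form_monomial, form_monomial,
      coeff_pderiv, weight_add_single, mul_one]
    push_cast
    ring
  | add p p' hp hp' => rw [mul_add, form_add_left, form_add_left, hp, hp']

/-- Multiplication by a linear polynomial. -/
def creation (c : σ → ℂ) : Module.End ℂ (MvPolynomial σ ℂ) :=
  LinearMap.mulLeft ℂ (∑ i, c i • X i)

/-- The adjoint of multiplication by a linear polynomial. -/
def annihilation (c : σ → ℂ) : Derivation ℂ (MvPolynomial σ ℂ) (MvPolynomial σ ℂ) :=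
  ∑ i, starRingEnd ℂ (c i) • pderiv i

theorem creation_apply (c : σ → ℂ) (p : MvPolynomial σ ℂ) :
    creation c p = (∑ i, c i • X i) * p := rfl

theorem annihilation_apply (c : σ → ℂ) (p : MvPolynomial σ ℂ) :
    annihilation c p = ∑ i, starRingEnd ℂ (c i) • pderiv i p := by
  rw [annihilation, ← Derivation.coeFnAddMonoidHom_apply, map_sum, Finset.sum_apply]
  rfl

theorem annihilation_X (c : σ → ℂ) (i : σ) : annihilation c (X i) = C (starRingEnd ℂ (c i)) := by
  classical
  rw [annihilation_apply, Finset.sum_eq_single i]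
  · simp [smul_eq_C_mul]
  · intro j _ hj; rw [pderiv_X_of_ne (Ne.symm hj), smul_zero]
  · simp

theorem form_sum_left {κ : Type*} (s : Finset κ) (p : κ → MvPolynomial σ ℂ) (q : MvPolynomial σ ℂ) :
    form (∑ i ∈ s, p i) q = ∑ i ∈ s, form (p i) q := by
  classical
  induction s using Finset.induction_on with
  | empty => simp [form]
  | insert a s ha ih => rw [Finset.sum_insert ha, Finset.sum_insert ha, form_add_left, ih]

theorem form_sum_right {κ : Type*} (s : Finset κ) (p : MvPolynomial σ ℂ) (q : κ → MvPolynomial σ ℂ) :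
    form p (∑ i ∈ s, q i) = ∑ i ∈ s, form p (q i) := by
  rw [← form_symm, form_sum_left, map_sum]
  exact Finset.sum_congr rfl fun i _ => form_symm _ _

theorem form_creation (c : σ → ℂ) (p q : MvPolynomial σ ℂ) :
    form (creation c p) q = form p (annihilation c q) := by
  rw [creation_apply, annihilation_apply, Finset.sum_mul, form_sum_left, form_sum_right]
  refine Finset.sum_congr rfl fun i _ => ?_
  rw [smul_mul_assoc, form_smul_left, form_smul_right, form_X_mul]

theorem form_annihilation (c : σ → ℂ) (p q : MvPolynomial σ ℂ) :
    form (annihilation c p) q = form p (creation c q) := by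
  rw [← form_symm, ← form_creation, form_symm]

end FockForm

/-! ### The Wick functional and existence of the vacuum -/

namespace CCRAlgebra

open MvPolynomial FockForm
open scoped InnerProductSpace

variable {ι : Type}

/-- The derivation that contracts with a generator. -/
def contraction (w : ι ⊕ ι → ι ⊕ ι → ℂ) (s : ι ⊕ ι) :
    Derivation ℂ (MvPolynomial (ι ⊕ ι) ℂ) (MvPolynomial (ι ⊕ ι) ℂ) :=
  mkDerivation ℂ fun t => C (w s t)

theorem contraction_X (w : ι ⊕ ι → ι ⊕ ι → ℂ) (s t : ι ⊕ ι) :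
    contraction w s (X t) = C (w s t) := mkDerivation_X _ _ _

theorem contraction_comm (w : ι ⊕ ι → ι ⊕ ι → ℂ) (s t : ι ⊕ ι) (p : MvPolynomial (ι ⊕ ι) ℂ) :
    contraction w s (contraction w t p) = contraction w t (contraction w s p) := by
  have h : ⁅contraction w s, contraction w t⁆ = 0 := by
    refine derivation_ext fun i => ?_
    rw [Derivation.commutator_apply, contraction_X, contraction_X, derivation_C, derivation_C]
    simp
  have h2 := DFunLike.congr_fun h p
  rw [Derivation.commutator_apply] at h2
  exact sub_eq_zero.1 h2

variable [DecidableEq ι]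

/-- The representation of the CCR algebra on polynomials in the generators that belongs to a
two-point function. -/
def wickRep (w : ι ⊕ ι → ι ⊕ ι → ℂ) (hw : ∀ s t, w s t - w t s = ccrForm s t) :
    CCRAlgebra ι →ₐ[ℂ] Module.End ℂ (MvPolynomial (ι ⊕ ι) ℂ) :=
  lift (fun s => LinearMap.mulLeft ℂ (X s) + (contraction w s : _ →ₗ[ℂ] _)) (by
    intro s t
    -- Multiplications commute with each other, and so do contractions; the cross terms contribute
    -- `w s t - w t s`.
    refine LinearMap.ext fun p => ?_
    simp only [Module.End.mul_apply, LinearMap.add_apply, LinearMap.mulLeft_apply,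
      Derivation.coeFn_coe, map_add, Derivation.leibniz, contraction_X, contraction_comm w s t,
      Module.algebraMap_end_apply, smul_eq_mul, smul_eq_C_mul]
    rw [← hw s t, map_sub]
    ring)

variable {w : ι ⊕ ι → ι ⊕ ι → ℂ} (hw : ∀ s t, w s t - w t s = ccrForm s t)

theorem wickRep_nambu (s : ι ⊕ ι) (p : MvPolynomial (ι ⊕ ι) ℂ) :
    wickRep w hw (nambu s) p = X s * p + contraction w s p := by
  rw [wickRep, lift_nambu]; rfl

/-- The functional given by Wick's theorem. -/
def wickFunctional : CCRAlgebra ι →ₗ[ℂ] ℂ :=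
  { toFun := fun Y => constantCoeff (wickRep w hw Y 1)
    map_add' := fun Y Z => by simp
    map_smul' := fun c Y => by simp [constantCoeff_smul] }

theorem wickFunctional_apply (Y : CCRAlgebra ι) :
    wickFunctional hw Y = constantCoeff (wickRep w hw Y 1) := rfl

/-- On the polynomial `1` the generator `s` acts as multiplication by `X s`. A later generator `t`
either keeps the factor `X s` or contracts it to `w t s`. The contractions cancel in the sum over
`s` by `hF`, and a factor `X s` that survives to the end has no constant coefficient. -/
theorem hasSum_wickFunctional {F : ι ⊕ ι → ℂ} (hF : ∀ t, HasSum (fun s => F s * w t s) 0)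
    (Y : CCRAlgebra ι) : HasSum (fun s => F s * wickFunctional hw (Y * nambu s)) 0 := by
  have key : ∀ Y : CCRAlgebra ι, ∀ q : MvPolynomial (ι ⊕ ι) ℂ,
      HasSum (fun s => F s * constantCoeff (wickRep w hw Y (X s * q))) 0 := by
    intro Y
    refine induction_word (p := fun Y => ∀ q : MvPolynomial (ι ⊕ ι) ℂ,
      HasSum (fun s => F s * constantCoeff (wickRep w hw Y (X s * q))) 0) ?_ ?_ ?_ Y
    · intro l
      -- The last letter acts first, whence the induction from the right.
      induction l using List.reverseRecOn with
      | nil => intro q; simp [word_nil]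
      | append_singleton l t ih =>
        intro q
        have h1 := ih (X t * q)
        have h2 := ih (contraction w t q)
        have h3 := (hF t).mul_right (constantCoeff (wickRep w hw (word l) q))
        have h4 := (h1.add h2).add h3
        simp only [add_zero, zero_mul] at h4
        refine h4.congr_fun ?_ |> id
        intro s
        have h5 : wickRep w hw (word (l ++ [t])) (X s * q) = wickRep w hw (word l) (X s * (X t * q))
            + wickRep w hw (word l) (X s * contraction w t q) + w t s • wickRep w hw (word l) q := by
          rw [word_concat, map_mul (wickRep w hw), Module.End.mul_apply, wickRep_nambu, Derivation.leibniz,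
            contraction_X, ← map_smul (wickRep w hw (word l)), ← map_add, ← map_add]
          congr 1
          simp only [smul_eq_mul, smul_eq_C_mul]
          ring
        rw [h5, map_add, map_add, constantCoeff_smul]
        simp only [smul_eq_mul]
        ring
    · intro Y Z hY hZ q
      simpa [mul_add] using (hY q).add (hZ q)
    · intro c Y hY q
      have := (hY q).mul_left c
      simp only [mul_zero] at this
      refine this.congr_fun ?_ |> id
      intro s
      simp only [map_smul, LinearMap.smul_apply, constantCoeff_smul, smul_eq_mul]
      ring
  refine (key Y 1).congr_fun ?_ |> id
  intro s
  rw [wickFunctional_apply, map_mul, Module.End.mul_apply, wickRep_nambu, Derivation.map_one_eq_zero,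
    add_zero]

theorem exists_finset_mem_adjoin (Y : CCRAlgebra ι) :
    ∃ S : Finset (ι ⊕ ι), Y ∈ Algebra.adjoin ℂ (nambu '' (S : Set (ι ⊕ ι))) := by
  refine induction_word (p := fun Y => ∃ S : Finset (ι ⊕ ι),
    Y ∈ Algebra.adjoin ℂ (nambu '' (S : Set (ι ⊕ ι)))) ?_ ?_ ?_ Y
  · intro l
    refine ⟨l.toFinset, Subalgebra.list_prod_mem _ fun x hx => ?_⟩
    obtain ⟨s, hs, rfl⟩ := List.mem_map.1 hx
    exact Algebra.subset_adjoin ⟨s, by simpa using hs, rfl⟩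
  · rintro Y Z ⟨S, hS⟩ ⟨S', hS'⟩
    refine ⟨S ∪ S', add_mem ?_ ?_⟩
    · exact Algebra.adjoin_mono (Set.image_mono (by simp)) hS
    · exact Algebra.adjoin_mono (Set.image_mono (by simp)) hS'
  · rintro c Y ⟨S, hS⟩
    exact ⟨S, Subalgebra.smul_mem _ hS c⟩

/-- Only finitely many generators occur in `Y`, so the vectors `u` involved span a
finite-dimensional space. In orthonormal coordinates of that space, `A` sends the generator `t` to
the linear polynomial with the coefficients of `u t`, and it turns the contraction with `s` into the
annihilation operator of `u s.swap`. After `A`, `star Y` acts as the Fock adjoint of `Y`, and the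
value becomes the Fock norm square of `P 1`. -/
theorem wickFunctional_nonneg {E : Type*} [NormedAddCommGroup E] [InnerProductSpace ℂ E]
    (u : ι ⊕ ι → E) (hu : ∀ s t, w s t = ⟪u s.swap, u t⟫_ℂ) (Y : CCRAlgebra ι) :
    0 ≤ (wickFunctional hw (star Y * Y)).re ∧ (wickFunctional hw (star Y * Y)).im = 0 := by
  obtain ⟨S, hS⟩ := exists_finset_mem_adjoin Y
  let U : Submodule ℂ E := Submodule.span ℂ (u '' ((S ∪ S.image Sum.swap : Finset (ι ⊕ ι)) : Set _))
  have : FiniteDimensional ℂ U :=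
    FiniteDimensional.span_of_finite ℂ ((Finset.finite_toSet _).image _)
  let b := stdOrthonormalBasis ℂ U
  let κ := Fin (Module.finrank ℂ U)
  let c : ι ⊕ ι → κ → ℂ := fun t i => ⟪(b i : E), u t⟫_ℂ
  have hc : ∀ s t, u s.swap ∈ U → ∑ i, c t i * starRingEnd ℂ (c s.swap i) = w s t := by
    intro s t hs
    have h1 := congrArg (Subtype.val) (b.sum_repr' ⟨u s.swap, hs⟩)
    rw [hu]
    conv_rhs => rw [show u s.swap = _ from h1.symm]
    simp only [AddSubmonoidClass.coe_finsetSum, SetLike.val_smul, Submodule.coe_inner, sum_inner,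
      inner_smul_left]
    exact Finset.sum_congr rfl fun i _ => mul_comm _ _
  let A : MvPolynomial (ι ⊕ ι) ℂ →ₐ[ℂ] MvPolynomial κ ℂ := aeval fun t => ∑ i, c t i • X i
  have hAX : ∀ t, A (X t) = ∑ i, c t i • X i := fun t => aeval_X _ _
  have hA1 : ∀ p, constantCoeff (A p) = constantCoeff p := by
    intro p
    have : (constantCoeff.comp (A : MvPolynomial (ι ⊕ ι) ℂ →+* MvPolynomial κ ℂ))
        = constantCoeff := by
      refine MvPolynomial.ringHom_ext (fun a => ?_) fun t => ?_
      · simp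
      · simp [hAX, constantCoeff_smul]
    exact DFunLike.congr_fun this p
  have hAD : ∀ s, u s.swap ∈ U → ∀ p, A (contraction w s p) = annihilation (c s.swap) (A p) := by
    intro s hs p
    induction p using MvPolynomial.induction_on with
    | C a =>
      rw [derivation_C, map_zero]
      have : A (C a) = C a := A.commutes a
      rw [this, derivation_C]
    | add p q hp hq => rw [map_add, map_add, map_add, map_add, hp, hq]
    | mul_X p t hp =>
      rw [Derivation.leibniz, map_mul, Derivation.leibniz, map_add, smul_eq_mul, smul_eq_mul,
        smul_eq_mul, smul_eq_mul, map_mul, map_mul, hp, contraction_X]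
      congr 2
      have : A (C (w s t)) = C (w s t) := A.commutes _
      rw [this, hAX, map_sum, ← hc s t hs, map_sum]
      refine Finset.sum_congr rfl fun i _ => ?_
      rw [Derivation.map_smul, annihilation_X, smul_eq_C_mul, map_mul]
  have key : ∃ P P' : Module.End ℂ (MvPolynomial κ ℂ), (∀ p q, form (P p) q = form p (P' q)) ∧
      (∀ p, A (wickRep w hw Y p) = P (A p)) ∧ (∀ p, A (wickRep w hw (star Y) p) = P' (A p)) := by
    induction hS using Algebra.adjoin_induction with
    | mem x hx =>
      obtain ⟨s, hs, rfl⟩ := hx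
      have hs1 : u s ∈ U := Submodule.subset_span ⟨s, by simp at hs; simp [hs], rfl⟩
      have hs2 : u s.swap ∈ U := Submodule.subset_span ⟨s.swap, by
        simp only [Finset.mem_coe] at hs
        simp only [Finset.coe_union, Set.mem_union, Finset.mem_coe, Finset.mem_image]
        exact Or.inr ⟨s, hs, rfl⟩, rfl⟩
      refine ⟨creation (c s) + (annihilation (c s.swap) : _ →ₗ[ℂ] _),
        creation (c s.swap) + (annihilation (c s) : _ →ₗ[ℂ] _), ?_, ?_, ?_⟩
      · intro p q
        simp only [LinearMap.add_apply, Derivation.coeFn_coe]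
        rw [form_add_left, form_add_right, form_creation, form_annihilation, add_comm]
      · intro p
        rw [wickRep_nambu, map_add, map_mul, hAX, hAD s hs2]
        rfl
      · intro p
        rw [star_nambu, wickRep_nambu, map_add, map_mul, hAX,
          hAD s.swap (by rwa [Sum.swap_swap]), Sum.swap_swap]
        rfl
    | algebraMap a =>
      refine ⟨algebraMap ℂ _ a, algebraMap ℂ _ (starRingEnd ℂ a), ?_, ?_, ?_⟩
      · intro p q
        simp only [Module.algebraMap_end_apply]
        rw [form_smul_left, form_smul_right]
      · intro p
        rw [AlgHom.commutes, Module.algebraMap_end_apply, Module.algebraMap_end_apply, map_smul]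
      · intro p
        rw [star_algebraMap, AlgHom.commutes, Module.algebraMap_end_apply,
          Module.algebraMap_end_apply, map_smul]
    | add Y Z _ _ hY hZ =>
      obtain ⟨P, P', h1, h2, h3⟩ := hY
      obtain ⟨Q, Q', g1, g2, g3⟩ := hZ
      refine ⟨P + Q, P' + Q', ?_, ?_, ?_⟩
      · intro p q
        simp only [LinearMap.add_apply]
        rw [form_add_left, form_add_right, h1, g1]
      · intro p
        simp only [map_add, LinearMap.add_apply, h2, g2]
      · intro p
        simp only [star_add, map_add, LinearMap.add_apply, h3, g3]
    | mul Y Z _ _ hY hZ =>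
      obtain ⟨P, P', h1, h2, h3⟩ := hY
      obtain ⟨Q, Q', g1, g2, g3⟩ := hZ
      refine ⟨P * Q, Q' * P', ?_, ?_, ?_⟩
      · intro p q
        simp only [Module.End.mul_apply]
        rw [h1, g1]
      · intro p
        simp only [map_mul, Module.End.mul_apply, h2, g2]
      · intro p
        simp only [star_mul, map_mul, Module.End.mul_apply, h3, g3]
  obtain ⟨P, P', h1, h2, h3⟩ := key
  have h4 : wickFunctional hw (star Y * Y) = form (P 1) (P 1) := by
    rw [wickFunctional_apply, map_mul, Module.End.mul_apply, ← hA1, h3, h2, map_one, h1, form_one]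
  rw [h4]
  exact form_self_nonneg _

end CCRAlgebra

namespace CCRState

open CCRAlgebra NambuSpace
open scoped InnerProductSpace

variable {ι : Type} [DecidableEq ι]

/-- The image of the Fock vacuum under a Bogoliubov transformation. -/
theorem exists_isVacuumOf (T : Bogoliubov ι) : ∃ ω : CCRState ι, ω.IsVacuumOf T.symmetry := by
  -- `N F` is the creation part of `φ(F)` in the new modes, that is, the vector that `φ(F)` creates
  -- from the vacuum. The two-point function `⟨φ_s φ_t⟩` is then the inner product of the vectors
  -- created by `φ_s†` and `φ_t`.
  let N : NambuSpace ι →L[ℂ] NambuSpace ι :=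
    ((1 / 2 : ℂ) • (1 - kreinOp)) * (T.B.symm : NambuSpace ι →L[ℂ] NambuSpace ι)
  have hN : ∀ F, N F = (1 / 2 : ℂ) • (T.B.symm F - kreinOp (T.B.symm F)) := fun F => rfl
  let u : ι ⊕ ι → NambuSpace ι := fun s => N (basisVec s)
  let w : ι ⊕ ι → ι ⊕ ι → ℂ := fun s t => ⟪u s.swap, u t⟫_ℂ
  have hNN : ∀ F G : NambuSpace ι, ⟪N F, N G⟫_ℂ
      = (1 / 2 : ℂ) * (⟪T.B.symm F, T.B.symm G⟫_ℂ - ⟪F, kreinOp G⟫_ℂ) := by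
    intro F G
    have h1 := T.inner_kreinOp_map (T.B.symm F) (T.B.symm G)
    rw [T.B.apply_symm_apply, T.B.apply_symm_apply] at h1
    rw [hN, hN, inner_smul_left, inner_smul_right, inner_sub_left, inner_sub_right, inner_sub_right,
      inner_kreinOp_left, inner_kreinOp_left, kreinOp_kreinOp, h1,
      show starRingEnd ℂ (1 / 2 : ℂ) = 1 / 2 by simp [Complex.conj_ofNat]]
    ring
  have hw : ∀ s t, w s t - w t s = ccrForm s t := by
    intro s t
    change ⟪N _, N _⟫_ℂ - ⟪N _, N _⟫_ℂ = _
    -- The positive part of the two-point function is symmetric in `s`, `t` because `B` respects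
    -- `conj`; it drops out of the commutator.
    have h1 : ⟪T.B.symm (basisVec t.swap), T.B.symm (basisVec s)⟫_ℂ
        = ⟪T.B.symm (basisVec s.swap), T.B.symm (basisVec t)⟫_ℂ := by
      rw [← conj_basisVec t, ← conj_basisVec s, T.symm_conj, T.symm_conj, ← inner_conj_conj,
        conj_conj]
    rw [hNN, hNN, h1, inner_basisVec, inner_basisVec, kreinOp_apply, kreinOp_apply, basisVec_apply,
      basisVec_apply, ccrForm_eq, kreinSign_swap, kreinSign_swap]
    by_cases h : t = s.swap
    · subst h
      simp [kreinSign_swap]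
      ring
    · have h2 : s.swap ≠ t := Ne.symm h
      have h3 : t.swap ≠ s := fun h3 => h (by rw [← h3, Sum.swap_swap])
      simp [h, h2, h3]
  refine ⟨⟨wickFunctional hw, ?_, fun Y => (wickFunctional_nonneg hw u (fun _ _ => rfl) Y).1,
    fun Y => (wickFunctional_nonneg hw u (fun _ _ => rfl) Y).2⟩, ?_⟩
  · rw [wickFunctional_apply, map_one (wickRep w hw)]; simp
  · intro F hF Y
    refine hasSum_wickFunctional hw (fun t => ?_) Y
    have h1 := hasSum_functional ((innerSL ℂ (u t.swap)).comp N) F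
    have h2 : N F = 0 := by
      obtain ⟨f, hf, rfl⟩ := (T.symmetry_eq_self_iff F).1 hF
      rw [hN, T.B.symm_apply_apply, (isAnnihilation_iff f).1 hf, sub_self, smul_zero]
    rw [ContinuousLinearMap.comp_apply, h2, map_zero] at h1
    exact h1

end CCRState

/-! ### Invariance of a vacuum under derivations and relabellings -/

namespace CCRState

open CCRAlgebra NambuSpace

variable {ι : Type} [DecidableEq ι] {T : Bogoliubov ι} {ω : CCRState ι}

/-- If `φ(F) ↦ φ(A F)` on generators, expectation values of images are given by the
functionals of `exists_functional`. -/
theorem IsVacuumOf.hasSum_map (h : ω.IsVacuumOf T.symmetry) {A : NambuSpace ι →L[ℂ] NambuSpace ι}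
    {δ : ι ⊕ ι → CCRAlgebra ι}
    (hδ : ∀ s, ∃ c : ι ⊕ ι →₀ ℂ, A (basisVec s) = c.sum (fun t a => a • basisVec t) ∧
      δ s = c.sum fun t a => a • nambu t) (X : CCRAlgebra ι) (F : NambuSpace ι) :
    ∃ x : ℂ, HasSum (fun s => F s * ω.expect (X * δ s)) x ∧
      HasSum (fun s => A F s * ω.expect (X * nambu s)) x := by
  obtain ⟨Λ, hΛ⟩ := h.exists_functional X
  refine ⟨Λ (A F), ?_, by simpa only [hΛ] using hasSum_functional Λ (A F)⟩
  have h1 := hasSum_functional (Λ.comp A) F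
  refine h1.congr_fun ?_ |> id
  intro s
  obtain ⟨c, hc, hc'⟩ := hδ s
  rw [ContinuousLinearMap.comp_apply, hc, hc', Finsupp.sum, Finsupp.sum, Finset.mul_sum, map_sum,
    map_sum]
  congr 1
  refine Finset.sum_congr rfl fun t _ => ?_
  rw [map_smul, hΛ, mul_smul_comm, map_smul]

/-- A quasiparticle vacuum is invariant under a derivation that acts on coefficient vectors by `G`
if and only if `G` commutes with the fundamental symmetry. -/
theorem IsVacuumOf.derivation_invariant_iff (h : ω.IsVacuumOf T.symmetry)
    {G : NambuSpace ι →L[ℂ] NambuSpace ι} (hG : ∀ F, G F.conj = -(G F).conj)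
    (δ : CCRAlgebra ι →ₗ[ℂ] CCRAlgebra ι) (hmul : ∀ X Y, δ (X * Y) = δ X * Y + X * δ Y)
    (hδ : ∀ s, ∃ c : ι ⊕ ι →₀ ℂ, G (basisVec s) = c.sum (fun t a => a • basisVec t) ∧
      δ (nambu s) = c.sum fun t a => a • nambu t) (hstar : ∀ X, δ (star X) = -star (δ X)) :
    (∀ X, ω.expect (δ X) = 0) ↔ Commute T.symmetry G := by
  constructor
  · intro h0
    -- In `0 = ⟨δ(b φ(F))⟩ = ⟨δ(b) φ(F)⟩ + ⟨b φ(G F)⟩`, with `b` a generator, the first term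
    -- vanishes if `F` is a new annihilation operator. So `⟨b φ(G F)⟩ = 0` for every `b`, and `G F`
    -- is a new annihilation operator as well.
    refine T.commute_symmetry (ε := -1) (fun F => by rw [hG, neg_one_smul]) fun F hF => ?_
    refine h.symmetry_eq_self fun t => ?_
    obtain ⟨x, hx, hx'⟩ := h.hasSum_map hδ (nambu t) F
    have h1 := h F hF (δ (nambu t))
    have h2 := h1.add hx
    have h3 : x = 0 := by
      rw [zero_add] at h2
      refine h2.unique ?_
      have h4 : (fun s => F s * ω.expect (δ (nambu t) * nambu s)
          + F s * ω.expect (nambu t * δ (nambu s))) = fun _ => 0 := by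
        funext s
        rw [← mul_add, ← map_add, ← hmul, h0, mul_zero]
      rw [h4]
      exact hasSum_zero
    rwa [h3] at hx'
  · intro hc
    have hcF : ∀ F, T.symmetry (G F) = G (T.symmetry F) := fun F => DFunLike.congr_fun hc F
    -- Conversely `X ↦ ⟨δ X⟩` meets the hypotheses of `functional_eq_zero`: on the right because `G`
    -- preserves the annihilation operators, on the left by taking adjoints.
    have hright : ∀ F : NambuSpace ι, T.symmetry F = F → ∀ X,
        HasSum (fun s => F s * (ω.expect ∘ₗ δ) (X * nambu s)) 0 := by
      intro F hF X
      obtain ⟨x, hx, hx'⟩ := h.hasSum_map hδ X F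
      have h1 : T.symmetry (G F) = G F := by rw [hcF, hF]
      have h2 : x = 0 := hx'.unique (h _ h1 X)
      rw [h2] at hx
      have h3 := (h F hF (δ X)).add hx
      rw [add_zero] at h3
      refine h3.congr_fun ?_ |> id
      intro s
      rw [← mul_add, ← map_add, ← hmul]; rfl
    have hω : ∀ X, (ω.expect ∘ₗ δ) (star X) = -starRingEnd ℂ ((ω.expect ∘ₗ δ) X) := by
      intro X
      simp only [LinearMap.comp_apply, hstar, map_neg, ω.expect_star]
    have hz : ω.expect ∘ₗ δ = 0 := by
      refine functional_eq_zero T.isFundamentalSymmetry_symmetry.mul_self _ ?_ hright ?_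
      · have h1 : δ 1 = 0 := by
          have := hmul 1 1
          simpa using this
        simp [h1]
      · intro F hF X
        have h1 := Complex.hasSum_conj'.2 (hright F.conj (by
          rw [T.symmetry_conj, hF, NambuSpace.conj_neg, neg_neg]) (star X))
        have h2 := ((Equiv.sumComm ι ι).hasSum_iff.2 h1).neg
        simp only [Equiv.sumComm_apply, map_zero, Function.comp_def, neg_zero] at h2
        refine h2.congr_fun ?_ |> id
        intro s
        have h3 : star X * nambu s.swap = star (nambu s * X) := by rw [star_mul, star_nambu]
        rw [h3, hω]
        simp [NambuSpace.conj_apply]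
    exact fun X => DFunLike.congr_fun hz X

/-- A quasiparticle vacuum is invariant under a relabelling of the modes if and only if the
relabelling commutes with the fundamental symmetry. -/
theorem IsVacuumOf.relabel_invariant_iff (h : ω.IsVacuumOf T.symmetry) (e : ι ≃ ι)
    {U : NambuSpace ι →L[ℂ] NambuSpace ι} (hU : ∀ s, U (basisVec s) = basisVec (Sum.map e e s)) :
    (∀ X, ω.expect (relabel e X) = ω.expect X) ↔ Commute T.symmetry U := by
  have hnambu : ∀ s, relabel e (nambu s) = nambu (Sum.map e e s) := fun s => lift_nambu _ _ s
  have hUc : ∀ F : NambuSpace ι, U F.conj = (1 : ℂ) • (U F).conj := by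
    intro F
    have h1 : conjOp U = U := clm_ext fun s => by
      rw [conjOp_apply, conj_basisVec, hU, hU, conj_basisVec]
      rcases s with i | i <;> rfl
    rw [one_smul]
    conv_lhs => rw [← h1]
    rw [conjOp_apply, NambuSpace.conj_conj]
  have hδ : ∀ s, ∃ c : ι ⊕ ι →₀ ℂ, U (basisVec s) = c.sum (fun t a => a • basisVec t) ∧
      relabel e (nambu s) = c.sum fun t a => a • nambu t := fun s =>
    ⟨Finsupp.single (Sum.map e e s) 1, by simp [hU], by simp [hnambu]⟩
  constructor
  · intro h0
    refine T.commute_symmetry hUc fun F hF => ?_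
    refine h.symmetry_eq_self fun t => ?_
    obtain ⟨x, hx, hx'⟩ := h.hasSum_map hδ (nambu t) F
    -- The left factor is relabelled backwards, so that invariance turns its expectation values with
    -- `φ(F)` into those of `t` with `φ(U F)`.
    have h1 := h F hF (nambu (Sum.map e.symm e.symm t))
    have h2 : x = 0 := by
      refine hx.unique (h1.congr_fun ?_ |> id)
      intro s
      have h3 : Sum.map e e (Sum.map e.symm e.symm t) = t := by rcases t with i | i <;> simp
      rw [← h0 (nambu (Sum.map e.symm e.symm t) * nambu s), map_mul (relabel e),
        hnambu (Sum.map e.symm e.symm t), h3]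
    rwa [h2] at hx'
  · intro hc
    have hz : ω.expect ∘ₗ (relabel e).toLinearMap - ω.expect = 0 := by
      have hr : ∀ F : NambuSpace ι, T.symmetry F = F → ∀ X,
          HasSum (fun s => F s * ω.expect (relabel e (X * nambu s))) 0 := by
        intro F hF X
        obtain ⟨x, hx, hx'⟩ := h.hasSum_map hδ (relabel e X) F
        have h1 : T.symmetry (U F) = U F := by
          have : T.symmetry (U F) = U (T.symmetry F) := DFunLike.congr_fun hc F
          rw [this, hF]
        have h2 : x = 0 := hx'.unique (h _ h1 _)
        rw [h2] at hx
        simpa only [map_mul] using hx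
      have hstar : ∀ X : CCRAlgebra ι, relabel e (star X) = star (relabel e X) := by
        refine induction_word ?_ ?_ ?_
        · intro l
          induction l with
          | nil => simp [word_nil]
          | cons s l ih =>
            rw [word_cons, star_mul, map_mul, map_mul, star_mul, ih, star_nambu, hnambu, hnambu,
              star_nambu]
            rcases s with i | i <;> rfl
        · intro X Y hX hY
          rw [star_add, map_add, map_add, star_add, hX, hY]
        · intro c X hX
          rw [star_smul, map_smul, map_smul, star_smul, hX]
      refine functional_eq_zero T.isFundamentalSymmetry_symmetry.mul_self _ ?_ ?_ ?_
      · simp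
      · intro F hF X
        simpa [mul_sub] using (hr F hF X).sub (h F hF X)
      · intro F hF X
        have h1 := Complex.hasSum_conj'.2 (hr F.conj (by
          rw [T.symmetry_conj, hF, NambuSpace.conj_neg, neg_neg]) (star X))
        have h2 := (Equiv.sumComm ι ι).hasSum_iff.2 h1
        simp only [Equiv.sumComm_apply, map_zero, Function.comp_def] at h2
        have h4 := h2.sub (h.hasSum_left hF X)
        rw [sub_zero] at h4
        refine h4.congr_fun ?_ |> id
        intro s
        have h3 : star X * nambu s.swap = star (nambu s * X) := by rw [star_mul, star_nambu]
        rw [h3, hstar, ω.expect_star]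
        simp [NambuSpace.conj_apply, mul_sub]
    intro X
    exact sub_eq_zero.1 (DFunLike.congr_fun hz X)

end CCRState

/-! ### The derivation `[H, ·]` in infinite volume -/

namespace CCRAlgebra

variable {ι : Type} [DecidableEq ι]

theorem mul_nambu_commutator (a b c : ι ⊕ ι) :
    (nambu a * nambu b : CCRAlgebra ι) * nambu c - nambu c * (nambu a * nambu b)
      = ccrForm b c • nambu a + ccrForm a c • nambu b := by
  have h1 : (nambu a * nambu b : CCRAlgebra ι) * nambu c
      = nambu a * (nambu c * nambu b + algebraMap ℂ _ (ccrForm b c)) := by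
    rw [mul_assoc, nambu_mul]
  have h2 : (nambu c * (nambu a * nambu b) : CCRAlgebra ι)
      = (nambu a * nambu c - algebraMap ℂ _ (ccrForm a c)) * nambu b := by
    rw [nambu_mul a c, add_sub_cancel_right, mul_assoc]
  rw [h1, h2, Algebra.algebraMap_eq_smul_one, Algebra.algebraMap_eq_smul_one, mul_add, sub_mul,
    mul_smul_comm, smul_mul_assoc, mul_one, one_mul, ← mul_assoc]
  abel

end CCRAlgebra

namespace QBH

open CCRAlgebra NambuSpace

variable {D d : ℕ} (H : QBH D d)

/-- The generators at a site. -/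
def siteIndex (j : Fin D → ℤ) (s : Fin d ⊕ Fin d) : LatticeMode D d ⊕ LatticeMode D d :=
  Sum.map (Prod.mk j) (Prod.mk j) s

/-- A finite symmetric set of vectors that contains the range of the Hamiltonian. -/
def rangeSet : Finset (Fin D → ℤ) :=
  insert 0 ((H.K.support ∪ H.Δ.support) ∪ (H.K.support ∪ H.Δ.support).image Neg.neg)

theorem zero_mem_rangeSet : 0 ∈ H.rangeSet := Finset.mem_insert_self _ _

theorem neg_mem_rangeSet {r : Fin D → ℤ} (h : r ∈ H.rangeSet) : -r ∈ H.rangeSet := by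
  simp only [rangeSet, Finset.mem_insert, Finset.mem_union, Finset.mem_image] at h ⊢
  rcases h with rfl | h | ⟨r', h, rfl⟩
  · left; simp
  · right; right; exact ⟨r, h, rfl⟩
  · right; left; simpa using h

/-- The dynamical matrices in real space, with Fourier transform `bloch`. -/
def dynamicalMatrix (r : Fin D → ℤ) : Matrix (Fin d ⊕ Fin d) (Fin d ⊕ Fin d) ℂ :=
  Matrix.fromBlocks (H.K r) (H.Δ r) (-(H.Δ r).map (starRingEnd ℂ)) (-(H.K r).map (starRingEnd ℂ))

theorem siteTerm_eq (j : Fin D → ℤ) : H.siteTerm j =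
    (∑ r ∈ H.rangeSet, ∑ ℓ, ∑ ℓ', H.K r ℓ ℓ' • (cre (j, ℓ) * ann (j + r, ℓ')))
    + (1 / 2 : ℂ) • ∑ r ∈ H.rangeSet, ∑ ℓ, ∑ ℓ',
      (H.Δ r ℓ ℓ' • (cre (j, ℓ) * cre (j + r, ℓ'))
        + starRingEnd ℂ (H.Δ r ℓ ℓ') • (ann (j + r, ℓ') * ann (j, ℓ))) := by
  have hs : ∀ (c : ℂ) (a b : LatticeMode D d), star (c • (cre a * cre b : CCRAlgebra _))
      = starRingEnd ℂ c • (ann b * ann a) := by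
    intro c a b
    rw [star_smul, star_mul, cre, cre, star_nambu, star_nambu]
    rfl
  have hK : H.K.support ⊆ H.rangeSet := fun r hr => by
    simp only [rangeSet, Finset.mem_insert, Finset.mem_union]; tauto
  have hΔ : H.Δ.support ⊆ H.rangeSet := fun r hr => by
    simp only [rangeSet, Finset.mem_insert, Finset.mem_union]; tauto
  rw [siteTerm, Finsupp.sum_of_support_subset _ hK, Finsupp.sum_of_support_subset _ hΔ]
  · simp only [hs]
  · intro r _; simp
  · intro r _; simp

section Sums

variable {E : Type*} [AddCommMonoid E] [Module ℂ E] {R S : Finset (Fin D → ℤ)} {i : Fin D → ℤ}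
  (M : (Fin D → ℤ) → Matrix (Fin d) (Fin d) ℂ) (f : LatticeMode D d → E) (p : Fin d)

theorem sum_site_left (hi : i ∈ S) : ∑ j ∈ S, ∑ r ∈ R, ∑ ℓ, ∑ ℓ',
      M r ℓ ℓ' • ((if (j, ℓ) = (i, p) then (1 : ℂ) else 0) • f (j + r, ℓ'))
    = ∑ r ∈ R, ∑ ℓ', M r p ℓ' • f (i + r, ℓ') := by
  rw [Finset.sum_eq_single i]
  · refine Finset.sum_congr rfl fun r _ => ?_
    rw [Finset.sum_eq_single p]
    · simp
    · intro ℓ _ hℓ; simp [hℓ]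
    · simp
  · intro j _ hj; simp [hj]
  · intro h; exact absurd hi h

/-- A bond that ends at `i` is reindexed by `-r` as a bond seen from `i`; hence the symmetric `R`,
and `S` has to contain every site where such a bond starts. -/
theorem sum_site_right (hR : ∀ r ∈ R, -r ∈ R) (hi : ∀ r ∈ R, i + r ∈ S) :
    ∑ j ∈ S, ∑ r ∈ R, ∑ ℓ, ∑ ℓ',
      M r ℓ ℓ' • ((if (j + r, ℓ') = (i, p) then (1 : ℂ) else 0) • f (j, ℓ))
    = ∑ r ∈ R, ∑ ℓ, M (-r) ℓ p • f (i + r, ℓ) := by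
  rw [Finset.sum_comm]
  refine Finset.sum_bij' (fun r _ => -r) (fun r _ => -r) (fun r hr => hR r hr)
    (fun r hr => hR r hr) (fun r _ => neg_neg r) (fun r _ => neg_neg r) fun r hr => ?_
  rw [Finset.sum_eq_single (i + -r)]
  · refine Finset.sum_congr rfl fun ℓ _ => ?_
    rw [Finset.sum_eq_single p]
    · simp
    · intro ℓ' _ hℓ'; simp [hℓ']
    · simp
  · intro j _ hj
    have : j + r ≠ i := fun h => hj (by rw [← h]; abel)
    simp [this]
  · intro h; exact absurd (hi _ (hR r hr)) h

end Sums

/-- The commutator of the Hamiltonian with a generator. -/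
theorem partialSum_commutator {S : Finset (Fin D → ℤ)} {i : Fin D → ℤ}
    (hS : ∀ r ∈ H.rangeSet, i + r ∈ S) (s : Fin d ⊕ Fin d) :
    H.partialSum S * nambu (siteIndex i s) - nambu (siteIndex i s) * H.partialSum S
      = -∑ r ∈ H.rangeSet, ∑ t, H.dynamicalMatrix r s t • nambu (siteIndex (i + r) t) := by
  have hi : i ∈ S := by simpa using hS 0 H.zero_mem_rangeSet
  have hR : ∀ r ∈ H.rangeSet, -r ∈ H.rangeSet := fun r => H.neg_mem_rangeSet
  have expand : ∀ c : LatticeMode D d ⊕ LatticeMode D d,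
      H.partialSum S * nambu c - nambu c * H.partialSum S
      = ∑ j ∈ S, ∑ r ∈ H.rangeSet, ∑ ℓ, ∑ ℓ', H.K r ℓ ℓ' •
          (ccrForm (.inl (j + r, ℓ')) c • cre (j, ℓ) + ccrForm (.inr (j, ℓ)) c • ann (j + r, ℓ'))
        + (1 / 2 : ℂ) • ∑ j ∈ S, ∑ r ∈ H.rangeSet, ∑ ℓ, ∑ ℓ', (H.Δ r ℓ ℓ' •
          (ccrForm (.inr (j + r, ℓ')) c • cre (j, ℓ) + ccrForm (.inr (j, ℓ)) c • cre (j + r, ℓ'))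
          + starRingEnd ℂ (H.Δ r ℓ ℓ') • (ccrForm (.inl (j, ℓ)) c • ann (j + r, ℓ')
            + ccrForm (.inl (j + r, ℓ')) c • ann (j, ℓ))) := by
    intro c
    rw [partialSum, Finset.sum_mul, Finset.mul_sum, ← Finset.sum_sub_distrib, Finset.smul_sum,
      ← Finset.sum_add_distrib]
    refine Finset.sum_congr rfl fun j _ => ?_
    rw [siteTerm_eq, add_mul, mul_add, add_sub_add_comm, smul_mul_assoc, mul_smul_comm, ← smul_sub]
    congr 1
    · simp only [Finset.sum_mul, Finset.mul_sum, ← Finset.sum_sub_distrib, smul_mul_assoc,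
        mul_smul_comm, ← smul_sub]
      simp only [cre, ann, mul_nambu_commutator]
    · congr 1
      simp only [Finset.sum_mul, Finset.mul_sum, ← Finset.sum_sub_distrib, smul_mul_assoc,
        mul_smul_comm, add_mul, mul_add, add_sub_add_comm, ← smul_sub]
      simp only [cre, ann, mul_nambu_commutator]
  have hK : ∀ r ℓ p, H.K (-r) ℓ p = starRingEnd ℂ (H.K r p ℓ) := fun r ℓ p => by
    rw [← H.K_adj]; rfl
  have hΔ : ∀ r ℓ p, H.Δ (-r) ℓ p = H.Δ r p ℓ := fun r ℓ p => by
    rw [← H.Δ_transpose]; rfl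
  rw [expand]
  rcases s with p | p
  -- The minus sign of `[a†, a]` is put into `f`, so that the remaining coefficient is a plain
  -- Kronecker delta.
  · have e1 := sum_site_left (R := H.rangeSet) H.K (fun a => -(ann a : CCRAlgebra (LatticeMode D d)))
      p hi
    have e2 := sum_site_left (R := H.rangeSet) H.Δ (fun a => -(cre a : CCRAlgebra (LatticeMode D d)))
      p hi
    have e3 := sum_site_right H.Δ (fun a => -(cre a : CCRAlgebra (LatticeMode D d))) p hR hS
    have c1 : ∀ a : LatticeMode D d, ccrForm (.inl a) (siteIndex i (.inl p)) = 0 := fun a => rfl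
    have c2 : ∀ (a : LatticeMode D d) (Y : CCRAlgebra (LatticeMode D d)),
        ccrForm (.inr a) (siteIndex i (.inl p)) • Y
          = (if a = (i, p) then (1 : ℂ) else 0) • -Y := by
      intro a Y
      change (if a = (i, p) then (-1 : ℂ) else 0) • Y = _
      split_ifs <;> simp
    simp only [c1, c2, zero_smul, zero_add, add_zero, smul_zero, smul_add]
    simp only [smul_add, Finset.sum_add_distrib] at e1 e2 e3 ⊢
    rw [e1, e2, e3]
    -- By the symmetry of `Δ` the bonds that start and that end at `i` contribute equally, which
    -- cancels the factor `1/2`.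
    simp only [hΔ, Fintype.sum_sum_type, Finset.sum_add_distrib, smul_neg, Finset.sum_neg_distrib]
    simp only [dynamicalMatrix, Matrix.fromBlocks_apply₁₁, Matrix.fromBlocks_apply₁₂, siteIndex,
      Sum.map_inl, Sum.map_inr, cre, ann]
    module
  · have e1 := sum_site_right H.K (fun a => (cre a : CCRAlgebra (LatticeMode D d))) p hR hS
    have e2 := sum_site_left (R := H.rangeSet) (fun r => (H.Δ r).map (starRingEnd ℂ))
      (fun a => (ann a : CCRAlgebra (LatticeMode D d))) p hi
    have e3 := sum_site_right (fun r => (H.Δ r).map (starRingEnd ℂ))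
      (fun a => (ann a : CCRAlgebra (LatticeMode D d))) p hR hS
    have c1 : ∀ a : LatticeMode D d, ccrForm (.inr a) (siteIndex i (.inr p)) = 0 := fun a => rfl
    have c2 : ∀ a : LatticeMode D d, ccrForm (.inl a) (siteIndex i (.inr p))
          = (if a = (i, p) then (1 : ℂ) else 0) := fun a => rfl
    simp only [c1, c2, zero_smul, zero_add, add_zero, smul_zero, smul_add]
    simp only [smul_add, Finset.sum_add_distrib, Matrix.map_apply] at e1 e2 e3 ⊢
    rw [e1, e2, e3]
    simp only [hΔ, hK, Fintype.sum_sum_type, Finset.sum_add_distrib]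
    simp only [dynamicalMatrix, Matrix.fromBlocks_apply₂₁, Matrix.fromBlocks_apply₂₂, siteIndex,
      Sum.map_inl, Sum.map_inr, cre, ann, Matrix.neg_apply, Matrix.map_apply, neg_smul,
      Finset.sum_neg_distrib]
    module

theorem exists_siteIndex (c : LatticeMode D d ⊕ LatticeMode D d) : ∃ i s, c = siteIndex i s := by
  rcases c with ⟨i, p⟩ | ⟨i, p⟩
  · exact ⟨i, .inl p, rfl⟩
  · exact ⟨i, .inr p, rfl⟩

theorem eventually_commutator_nambu (i : Fin D → ℤ) (s : Fin d ⊕ Fin d) :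
    ∀ᶠ S in (Filter.atTop : Filter (Finset (Fin D → ℤ))),
      H.partialSum S * nambu (siteIndex i s) - nambu (siteIndex i s) * H.partialSum S
      = -∑ r ∈ H.rangeSet, ∑ t, H.dynamicalMatrix r s t • nambu (siteIndex (i + r) t) := by
  filter_upwards [Filter.eventually_ge_atTop (H.rangeSet.image (i + ·))] with S hS
  exact H.partialSum_commutator (fun r hr => hS (Finset.mem_image_of_mem _ hr)) s

/-- Locality: a generator fails to commute only with the terms of `H` within range, and the Leibniz
rule extends this to words. -/
theorem exists_commutator (Y : CCRAlgebra (LatticeMode D d)) :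
    ∃ Z, ∀ᶠ S in (Filter.atTop : Filter (Finset (Fin D → ℤ))),
      H.partialSum S * Y - Y * H.partialSum S = Z := by
  refine induction_word (p := fun Y => ∃ Z, ∀ᶠ S in (Filter.atTop : Filter (Finset (Fin D → ℤ))),
      H.partialSum S * Y - Y * H.partialSum S = Z) ?_ ?_ ?_ Y
  · intro l
    induction l with
    | nil => exact ⟨0, Filter.Eventually.of_forall fun S => by simp [word_nil]⟩
    | cons c l ih =>
      obtain ⟨Z, hZ⟩ := ih
      obtain ⟨i, s, rfl⟩ := exists_siteIndex c
      refine ⟨(-∑ r ∈ H.rangeSet, ∑ t, H.dynamicalMatrix r s t • nambu (siteIndex (i + r) t))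
        * word l + nambu (siteIndex i s) * Z, ?_⟩
      filter_upwards [hZ, H.eventually_commutator_nambu i s] with S h1 h2
      rw [← h1, ← h2, word_cons]
      noncomm_ring
  · rintro Y Y' ⟨Z, hZ⟩ ⟨Z', hZ'⟩
    refine ⟨Z + Z', ?_⟩
    filter_upwards [hZ, hZ'] with S h1 h2
    rw [← h1, ← h2]
    noncomm_ring
  · rintro c Y ⟨Z, hZ⟩
    refine ⟨c • Z, ?_⟩
    filter_upwards [hZ] with S h1
    rw [← h1, mul_smul_comm, smul_mul_assoc, smul_sub]

/-- The derivation `[H, ·]`. -/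
def commutatorFun (Y : CCRAlgebra (LatticeMode D d)) : CCRAlgebra (LatticeMode D d) :=
  (H.exists_commutator Y).choose

theorem eventually_commutatorFun (Y : CCRAlgebra (LatticeMode D d)) :
    ∀ᶠ S in (Filter.atTop : Filter (Finset (Fin D → ℤ))),
      H.partialSum S * Y - Y * H.partialSum S = H.commutatorFun Y :=
  (H.exists_commutator Y).choose_spec

theorem commutatorFun_eq {Y Z : CCRAlgebra (LatticeMode D d)}
    (h : ∀ᶠ S in (Filter.atTop : Filter (Finset (Fin D → ℤ))),
      H.partialSum S * Y - Y * H.partialSum S = Z) : H.commutatorFun Y = Z := by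
  obtain ⟨S, h1, h2⟩ := (h.and (H.eventually_commutatorFun Y)).exists
  rw [← h1, ← h2]

/-- The derivation `[H, ·]` as a linear map. -/
def commutatorMap : CCRAlgebra (LatticeMode D d) →ₗ[ℂ] CCRAlgebra (LatticeMode D d) where
  toFun := H.commutatorFun
  map_add' Y Z := by
    apply H.commutatorFun_eq
    filter_upwards [H.eventually_commutatorFun Y, H.eventually_commutatorFun Z] with S h1 h2
    rw [← h1, ← h2]
    noncomm_ring
  map_smul' c Y := by
    apply H.commutatorFun_eq
    filter_upwards [H.eventually_commutatorFun Y] with S h1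
    rw [← h1, mul_smul_comm, smul_mul_assoc, smul_sub, RingHom.id_apply]

theorem commutatorMap_mul (Y Z : CCRAlgebra (LatticeMode D d)) :
    H.commutatorMap (Y * Z) = H.commutatorMap Y * Z + Y * H.commutatorMap Z := by
  apply H.commutatorFun_eq
  filter_upwards [H.eventually_commutatorFun Y, H.eventually_commutatorFun Z] with S h1 h2
  change _ = H.commutatorFun Y * Z + Y * H.commutatorFun Z
  rw [← h1, ← h2]
  noncomm_ring

theorem commutatorMap_nambu (i : Fin D → ℤ) (s : Fin d ⊕ Fin d) :
    H.commutatorMap (nambu (siteIndex i s))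
      = -∑ r ∈ H.rangeSet, ∑ t, H.dynamicalMatrix r s t • nambu (siteIndex (i + r) t) :=
  H.commutatorFun_eq (H.eventually_commutator_nambu i s)

/-- Particle–hole symmetry. It makes `[H, ·]` compatible with the adjoint and relates the Bloch
matrices at `k` and `-k`. -/
theorem dynamicalMatrix_swap (r : Fin D → ℤ) (s t : Fin d ⊕ Fin d) :
    H.dynamicalMatrix r s.swap t.swap = -starRingEnd ℂ (H.dynamicalMatrix r s t) := by
  rcases s with p | p <;> rcases t with q | q <;> simp [dynamicalMatrix]

theorem siteIndex_swap (i : Fin D → ℤ) (s : Fin d ⊕ Fin d) :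
    (siteIndex i s).swap = siteIndex i s.swap := by
  rcases s with p | p <;> rfl

theorem commutatorMap_star (Y : CCRAlgebra (LatticeMode D d)) :
    H.commutatorMap (star Y) = -star (H.commutatorMap Y) := by
  have h1 : H.commutatorMap 1 = 0 := by simpa using H.commutatorMap_mul 1 1
  have hg : ∀ c, H.commutatorMap (star (nambu c)) = -star (H.commutatorMap (nambu c)) := by
    intro c
    obtain ⟨i, s, rfl⟩ := exists_siteIndex c
    rw [star_nambu, siteIndex_swap, commutatorMap_nambu, commutatorMap_nambu, star_neg, star_sum]
    congr 1
    rw [← Finset.sum_neg_distrib]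
    refine Finset.sum_congr rfl fun r _ => ?_
    rw [star_sum, ← Finset.sum_neg_distrib]
    refine Fintype.sum_equiv (Equiv.sumComm _ _) _ _ fun t => ?_
    have := H.dynamicalMatrix_swap r s t.swap
    rw [Sum.swap_swap] at this
    rw [this, star_smul, star_nambu, siteIndex_swap, Equiv.sumComm_apply, Sum.swap_swap, neg_smul]
    rfl
  refine induction_word (p := fun Y => H.commutatorMap (star Y) = -star (H.commutatorMap Y))
    ?_ ?_ ?_ Y
  · intro l
    induction l with
    | nil => simp [word_nil, h1]
    | cons c l ih =>
      rw [word_cons, star_mul, commutatorMap_mul, commutatorMap_mul, ih, hg, star_add, star_mul,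
        star_mul]
      noncomm_ring
  · intro Y Z hY hZ
    rw [star_add, map_add, map_add, star_add, hY, hZ]
    abel
  · intro c Y hY
    rw [star_smul, map_smul, map_smul, star_smul, hY, smul_neg]

theorem isEigenstate_iff (ω : CCRState (LatticeMode D d)) :
    H.IsEigenstate ω ↔ ∀ Y, ω.expect (H.commutatorMap Y) = 0 := by
  refine forall_congr' fun Y => ⟨fun h => ?_, fun h => ?_⟩
  · obtain ⟨S, h1, h2⟩ := (h.and (H.eventually_commutatorFun Y)).exists
    rw [h2] at h1
    exact h1
  · filter_upwards [H.eventually_commutatorFun Y] with S h1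
    rw [h1]
    exact h

end QBH

/-! ### Continuous functions on the torus acting on sequences -/

section MultiplicationOperators

open MeasureTheory
open scoped ENNReal

variable {X : Type*} [TopologicalSpace X] [CompactSpace X] [MeasurableSpace X] [BorelSpace X]
  (μ : Measure X) [IsFiniteMeasure μ]

/-- Multiplication by a continuous function on `L²`. -/
def mulOperator (f : C(X, ℂ)) : Lp ℂ 2 μ →L[ℂ] Lp ℂ 2 μ :=
  (ContinuousLinearMap.mul ℂ ℂ).holderL μ ∞ 2 2 (ContinuousMap.toLp ∞ μ ℂ f)

theorem coeFn_mulOperator (f : C(X, ℂ)) (g : Lp ℂ 2 μ) :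
    mulOperator μ f g =ᵐ[μ] fun x => f x * g x := by
  have h1 := (ContinuousLinearMap.mul ℂ ℂ).coeFn_holder (r := 2) (ContinuousMap.toLp ∞ μ ℂ f) g
  have h2 := ContinuousMap.coeFn_toLp (p := ∞) (𝕜 := ℂ) μ f
  filter_upwards [h1, h2] with x hx hx2
  rw [← hx2]
  exact hx

/-- Multiplication operators as a representation of continuous functions. -/
def mulRep : C(X, ℂ) →⋆ₐ[ℂ] (Lp ℂ 2 μ →L[ℂ] Lp ℂ 2 μ) where
  toFun := mulOperator μ
  map_one' := by
    ext1 g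
    refine Lp.ext ?_
    filter_upwards [coeFn_mulOperator μ 1 g] with x hx
    simpa using hx
  map_mul' f f' := by
    ext1 g
    refine Lp.ext ?_
    filter_upwards [coeFn_mulOperator μ (f * f') g, coeFn_mulOperator μ f (mulOperator μ f' g),
      coeFn_mulOperator μ f' g] with x h1 h2 h3
    change _ = (mulOperator μ f (mulOperator μ f' g)) x
    rw [h1, h2, h3, ContinuousMap.mul_apply, mul_assoc]
  map_zero' := by simp [mulOperator]
  map_add' f f' := by simp [mulOperator]
  commutes' c := by
    ext1 g
    refine Lp.ext ?_
    filter_upwards [coeFn_mulOperator μ (algebraMap ℂ _ c) g, Lp.coeFn_smul c g] with x h1 h2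
    rw [h1, Algebra.algebraMap_eq_smul_one]
    change _ = (c • g : Lp ℂ 2 μ) x
    rw [h2]
    simp
  map_star' f := by
    rw [ContinuousLinearMap.star_eq_adjoint, ContinuousLinearMap.eq_adjoint_iff]
    intro g h
    rw [L2.inner_def, L2.inner_def]
    refine integral_congr_ae ?_
    filter_upwards [coeFn_mulOperator μ (star f) g, coeFn_mulOperator μ f h] with x h1 h2
    rw [h1, h2]
    simp
    ring

theorem mulRep_apply (f : C(X, ℂ)) : mulRep μ f = mulOperator μ f := rfl

theorem mulRep_toLp (f g : C(X, ℂ)) :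
    mulRep μ f (ContinuousMap.toLp 2 μ ℂ g) = ContinuousMap.toLp 2 μ ℂ (f * g) := by
  refine Lp.ext ?_
  filter_upwards [coeFn_mulOperator μ f (ContinuousMap.toLp 2 μ ℂ g),
    ContinuousMap.coeFn_toLp (p := 2) (𝕜 := ℂ) μ g,
    ContinuousMap.coeFn_toLp (p := 2) (𝕜 := ℂ) μ (f * g)] with x h1 h2 h3
  rw [mulRep_apply, h1, h2, h3, ContinuousMap.mul_apply]

theorem continuous_mulRep : Continuous (mulRep μ) :=
  (((ContinuousLinearMap.mul ℂ ℂ).holderL μ ∞ 2 2).comp (ContinuousMap.toLp ∞ μ ℂ)).continuous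

end MultiplicationOperators

attribute [local instance] instMeasureSpaceUnitAddCircle

/-- Continuous functions on the torus act on sequences by convolution. -/
theorem exists_convolutionRep (D : ℕ) :
    ∃ m : C(UnitAddTorus (Fin D), ℂ) →⋆ₐ[ℂ]
      (lp (fun _ : Fin D → ℤ => ℂ) 2 →L[ℂ] lp (fun _ : Fin D → ℤ => ℂ) 2),
      Continuous m ∧ ∀ r j, m (UnitAddTorus.mFourier r) (lp.single 2 j 1)
        = lp.single 2 (j + r) (1 : ℂ) := by
  have : MeasureTheory.IsProbabilityMeasure (MeasureTheory.volume : MeasureTheory.Measure UnitAddCircle) :=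
    inferInstanceAs (MeasureTheory.IsProbabilityMeasure AddCircle.haarAddCircle)
  let b := UnitAddTorus.mFourierBasis (d := Fin D)
  let e := b.repr.conjStarAlgEquiv
  -- Multiplication on `L²` of the torus, transported by the unitary Fourier transform.
  refine ⟨(e : _ →⋆ₐ[ℂ] _).comp (mulRep MeasureTheory.volume), ?_, fun r j => ?_⟩
  · have h : ∀ f, e (mulRep MeasureTheory.volume f) =
        (b.repr.toContinuousLinearEquiv : _ →L[ℂ] _).comp ((mulRep MeasureTheory.volume f).comp
          (b.repr.symm.toContinuousLinearEquiv : _ →L[ℂ] _)) := fun f => rfl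
    change Continuous fun f => e (mulRep MeasureTheory.volume f)
    simp only [h]
    exact continuous_const.clm_comp ((continuous_mulRep _).clm_comp continuous_const)
  · change b.repr (mulRep MeasureTheory.volume (UnitAddTorus.mFourier r)
      (b.repr.symm (lp.single 2 j 1))) = _
    have hb : ∀ j, b j = ContinuousMap.toLp 2 MeasureTheory.volume ℂ (UnitAddTorus.mFourier j) :=
      fun j => congrFun UnitAddTorus.coe_mFourierBasis j
    rw [b.repr_symm_single, hb, mulRep_toLp, ← b.repr_self, hb]
    congr 2
    ext x
    rw [ContinuousMap.mul_apply, UnitAddTorus.mFourier_add, mul_comm]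


/-! ### Matrix functions on the torus acting on coefficient vectors -/

section BlochRepresentation

open scoped Matrix.Norms.L2Operator InnerProductSpace ComplexOrder
open NambuSpace

/-- The hypothesis keeps negative numbers out of the spectrum, so `cfc Real.sqrt A` is a
self-adjoint root. For matrix functions the invertibility can be tested pointwise. -/
theorem CStarAlgebra.exists_star_mul_self_eq {𝔄 : Type*} [CStarAlgebra 𝔄] {A : 𝔄}
    (hsa : IsSelfAdjoint A) (hA : ∀ a : ℝ, 0 < a → IsUnit (A + (a : ℂ) • 1)) :
    ∃ R : 𝔄, star R * R = A := by
  have hspec : ∀ a ∈ spectrum ℝ A, 0 ≤ a := by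
    intro a ha
    by_contra! hn
    rw [spectrum.mem_iff] at ha
    refine ha ?_
    have h1 := (hA (-a) (by linarith)).neg
    convert h1 using 1
    rw [Algebra.algebraMap_eq_smul_one, neg_add, Complex.ofReal_neg, neg_smul, neg_neg,
      Complex.coe_smul]
    abel
  refine ⟨cfc Real.sqrt A, ?_⟩
  have h1 : star (cfc Real.sqrt A) = cfc Real.sqrt A := (cfc_predicate Real.sqrt A : IsSelfAdjoint _)
  rw [h1, ← cfc_mul Real.sqrt Real.sqrt A]
  conv_rhs => rw [← cfc_id ℝ A]
  exact cfc_congr fun a ha => Real.mul_self_sqrt (hspec a ha)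

/-- Positive semidefinite matrix functions are squares. -/
theorem ContinuousMap.exists_star_mul_self_eq_of_posSemidef {X n : Type*} [TopologicalSpace X]
    [CompactSpace X] [Fintype n] [DecidableEq n] (A : C(X, Matrix n n ℂ))
    (hA : ∀ x, (A x).PosSemidef) : ∃ R : C(X, Matrix n n ℂ), star R * R = A := by
  refine CStarAlgebra.exists_star_mul_self_eq ?_ fun a ha => ?_
  · ext1 x
    exact (hA x).1
  · rw [ContinuousMap.isUnit_iff_forall_isUnit]
    intro x
    have h1 : ((a : ℂ) • (1 : Matrix n n ℂ)).PosDef :=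
      Matrix.PosDef.one.smul (by exact_mod_cast ha)
    exact (Matrix.PosDef.posSemidef_add (hA x) h1).isUnit

namespace QBH

variable {D d : ℕ}

theorem siteIndex_injective {i j : Fin D → ℤ} {s t : Fin d ⊕ Fin d}
    (h : siteIndex i s = siteIndex j t) : i = j ∧ s = t := by
  rcases s with p | p <;> rcases t with q | q <;> simp_all [siteIndex]

/-- The matrix function `x ↦ e^{2πi r·x} A`. -/
def monomialSymbol (r : Fin D → ℤ) (A : Matrix (Fin d ⊕ Fin d) (Fin d ⊕ Fin d) ℂ) :
    C(UnitAddTorus (Fin D), Matrix (Fin d ⊕ Fin d) (Fin d ⊕ Fin d) ℂ) where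
  toFun x := UnitAddTorus.mFourier r x • A
  continuous_toFun := by fun_prop

/-- Continuous matrix functions on the torus act on the coefficient vectors of the lattice. -/
theorem exists_blochRep (D d : ℕ) :
    ∃ ρ : C(UnitAddTorus (Fin D), Matrix (Fin d ⊕ Fin d) (Fin d ⊕ Fin d) ℂ) →⋆ₐ[ℂ]
      (NambuSpace (LatticeMode D d) →L[ℂ] NambuSpace (LatticeMode D d)),
      Continuous ρ ∧ ∀ r A j s, ρ (monomialSymbol r A) (basisVec (siteIndex j s))
        = ∑ t, A t s • basisVec (siteIndex (j + r) t) := by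
  obtain ⟨m, hm, hmF⟩ := exists_convolutionRep D
  have hon : ∀ s : Fin d ⊕ Fin d, Orthonormal ℂ fun j : Fin D → ℤ =>
      (basisVec (siteIndex j s) : NambuSpace (LatticeMode D d)) := by
    intro s
    rw [orthonormal_iff_ite]
    intro i j
    rw [inner_basisVec, basisVec_apply]
    exact if_congr ⟨fun h => (siteIndex_injective h).1, fun h => by rw [h]⟩ rfl rfl
  -- `J s` embeds scalar sequences as the component `s`. These isometries have orthogonal ranges
  -- (`hJJ`) that fill the space (`hJ1`), so `∑ J s ∘ m (A s t) ∘ (J t)†` is multiplicative and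
  -- unital.
  let J : Fin d ⊕ Fin d → (lp (fun _ : Fin D → ℤ => ℂ) 2 →L[ℂ] NambuSpace (LatticeMode D d)) :=
    fun s => (hon s).orthogonalFamily.linearIsometry.toContinuousLinearMap
  have hJ : ∀ s j, J s (lp.single 2 j (1 : ℂ)) = basisVec (siteIndex j s) := by
    intro s j
    refine ((hon s).orthogonalFamily.linearIsometry_apply_single (1 : ℂ)).trans ?_
    simp
  have hext : ∀ {E : Type} [NormedAddCommGroup E] [NormedSpace ℂ E]
      {A A' : lp (fun _ : Fin D → ℤ => ℂ) 2 →L[ℂ] E},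
      (∀ j, A (lp.single 2 j 1) = A' (lp.single 2 j 1)) → A = A' := by
    intro E _ _ A A' h
    ext1 F
    have h1 := lp.hasSum_single (p := 2) (by norm_num) F
    have h2 : ∀ j, lp.single 2 j (F j) = F j • lp.single (E := fun _ : Fin D → ℤ => ℂ) 2 j 1 := by
      intro j; rw [← lp.single_smul, smul_eq_mul, mul_one]
    simp only [h2] at h1
    have h3 := h1.mapL A
    have h4 := h1.mapL A'
    simp only [map_smul, h] at h3 h4
    exact h3.unique h4
  let J' : Fin d ⊕ Fin d → (NambuSpace (LatticeMode D d) →L[ℂ] lp (fun _ : Fin D → ℤ => ℂ) 2) :=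
    fun s => ContinuousLinearMap.adjoint (J s)
  have hJJ : ∀ s t, (J' s).comp (J t) = if s = t then 1 else 0 := by
    intro s t
    refine hext fun j => ?_
    rw [ContinuousLinearMap.comp_apply, hJ]
    ext i
    have h1 : ∀ F : lp (fun _ : Fin D → ℤ => ℂ) 2, F i = ⟪lp.single 2 i (1 : ℂ), F⟫_ℂ := by
      intro F
      rw [lp.inner_single_left]
      simp
    rw [h1, ContinuousLinearMap.adjoint_inner_right, hJ, inner_basisVec, basisVec_apply]
    by_cases hst : s = t
    · subst hst
      rw [if_pos rfl]
      change _ = (lp.single 2 j (1 : ℂ) : lp (fun _ : Fin D → ℤ => ℂ) 2) i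
      rw [lp.single_apply, Pi.single_apply]
      exact if_congr ⟨fun h => (siteIndex_injective h).1, fun h => by rw [h]⟩ rfl rfl
    · rw [if_neg hst, if_neg fun h => hst (siteIndex_injective h).2]
      rfl
  have hJ1 : ∑ s, (J s).comp (J' s) = 1 := by
    refine clm_ext fun c => ?_
    obtain ⟨j, t, rfl⟩ := exists_siteIndex c
    rw [sum_apply]
    change _ = basisVec (siteIndex j t)
    rw [← hJ t j, Finset.sum_eq_single t]
    · have := DFunLike.congr_fun (hJJ t t) (lp.single 2 j 1)
      rw [if_pos rfl] at this
      exact congrArg (J t) this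
    · intro s _ hs
      have := DFunLike.congr_fun (hJJ s t) (lp.single 2 j 1)
      rw [if_neg hs] at this
      exact (congrArg (J s) this).trans (map_zero _)
    · simp
  let en : Fin d ⊕ Fin d → Fin d ⊕ Fin d →
      C(UnitAddTorus (Fin D), Matrix (Fin d ⊕ Fin d) (Fin d ⊕ Fin d) ℂ) →
      C(UnitAddTorus (Fin D), ℂ) := fun s t A => ⟨fun x => A x s t, by
        exact (continuous_apply_apply s t).comp A.continuous⟩
  let ρ : C(UnitAddTorus (Fin D), Matrix (Fin d ⊕ Fin d) (Fin d ⊕ Fin d) ℂ) →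
      (NambuSpace (LatticeMode D d) →L[ℂ] NambuSpace (LatticeMode D d)) := fun A =>
    ∑ s, ∑ t, (J s).comp ((m (en s t A)).comp (J' t))
  have hρmul : ∀ A A', ρ (A * A') = ρ A * ρ A' := by
    intro A A'
    have h1 : ∀ s u v t, (J s).comp ((m (en s u A)).comp (J' u))
        * (J v).comp ((m (en v t A')).comp (J' t))
        = if u = v then (J s).comp ((m (en s u A * en v t A')).comp (J' t)) else 0 := by
      intro s u v t
      have h2 : (J s).comp ((m (en s u A)).comp (J' u)) * (J v).comp ((m (en v t A')).comp (J' t))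
          = (J s).comp ((m (en s u A)).comp (((J' u).comp (J v)).comp ((m (en v t A')).comp (J' t)))) :=
        rfl
      rw [h2, hJJ]
      split_ifs with h
      · rw [map_mul]; rfl
      · simp
    have h3 : ∀ s t, en s t (A * A') = ∑ u, en s u A * en u t A' := by
      intro s t
      ext x
      rw [ContinuousMap.sum_apply]
      change (A x * A' x) s t = _
      rw [Matrix.mul_apply]
      rfl
    have h4 : ρ A * ρ A' = ∑ s, ∑ t, ∑ u, (J s).comp ((m (en s u A * en u t A')).comp (J' t)) := by
      simp only [ρ, Finset.sum_mul, Finset.mul_sum, h1]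
      simp only [Finset.sum_ite_eq', Finset.mem_univ, if_true]
      rw [Finset.sum_comm, Finset.sum_comm (s := Finset.univ) (t := Finset.univ)
        (f := fun s t => ∑ u, (J s).comp ((m (en s u A * en u t A')).comp (J' t)))]
      exact Finset.sum_congr rfl fun t _ => Finset.sum_comm
    rw [h4]
    refine Finset.sum_congr rfl fun s _ => Finset.sum_congr rfl fun t _ => ?_
    rw [h3, map_sum, ContinuousLinearMap.finsetSum_comp, ContinuousLinearMap.comp_finsetSum]
  have hρalg : ∀ c : ℂ, ρ (algebraMap ℂ _ c) = algebraMap ℂ _ c := by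
    intro c
    have h1 : ∀ s t, en s t (algebraMap ℂ _ c) = if s = t then algebraMap ℂ _ c else 0 := by
      intro s t
      ext x
      change (algebraMap ℂ (Matrix (Fin d ⊕ Fin d) (Fin d ⊕ Fin d) ℂ) c) s t = _
      rw [Matrix.algebraMap_matrix_apply]
      split_ifs <;> rfl
    have h2 : ∀ s t, (J s).comp ((m (en s t (algebraMap ℂ _ c))).comp (J' t))
        = if s = t then c • (J s).comp (J' t) else 0 := by
      intro s t
      rw [h1]
      split_ifs with h
      · rw [AlgHomClass.commutes, Algebra.algebraMap_eq_smul_one]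
        ext1 F
        simp
      · simp
    simp only [ρ, h2, Finset.sum_ite_eq, Finset.mem_univ, if_true]
    rw [← Finset.smul_sum, hJ1, Algebra.algebraMap_eq_smul_one]
  have hρadd : ∀ A A', ρ (A + A') = ρ A + ρ A' := by
    intro A A'
    have h1 : ∀ s t, en s t (A + A') = en s t A + en s t A' := fun s t => rfl
    simp only [ρ, h1, map_add, ContinuousLinearMap.add_comp, ContinuousLinearMap.comp_add,
      Finset.sum_add_distrib]
  have hρstar : ∀ A, ρ (star A) = star (ρ A) := by
    intro A
    have h1 : ∀ s t, en s t (star A) = star (en t s A) := fun s t => rfl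
    simp only [ρ, h1, map_star, star_sum]
    rw [Finset.sum_comm]
    refine Finset.sum_congr rfl fun s _ => Finset.sum_congr rfl fun t _ => ?_
    simp only [J', ContinuousLinearMap.star_eq_adjoint, ContinuousLinearMap.adjoint_comp,
      ContinuousLinearMap.adjoint_adjoint, ContinuousLinearMap.comp_assoc]
  refine ⟨{ toFun := ρ, map_one' := ?_, map_mul' := hρmul, map_zero' := ?_, map_add' := hρadd,
            commutes' := hρalg, map_star' := hρstar }, ?_, ?_⟩
  · simpa using hρalg 1
  · simpa using hρalg 0
  · change Continuous ρ
    have h1 : ∀ s t, Continuous (en s t) := by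
      intro s t
      let f : C(Matrix (Fin d ⊕ Fin d) (Fin d ⊕ Fin d) ℂ, ℂ) :=
        ⟨fun M => M s t, continuous_apply_apply s t⟩
      exact ContinuousMap.continuous_postcomp f
    refine continuous_finsetSum _ fun s _ => continuous_finsetSum _ fun t _ => ?_
    exact continuous_const.clm_comp ((hm.comp (h1 s t)).clm_comp continuous_const)
  · intro r A j s
    change ρ _ _ = _
    have h1 : ∀ t u, en t u (monomialSymbol r A) = A t u • UnitAddTorus.mFourier r := by
      intro t u
      ext x
      exact mul_comm _ _
    simp only [ρ, sum_apply]
    refine Finset.sum_congr rfl fun t _ => ?_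
    rw [Finset.sum_eq_single s]
    · have h2 := DFunLike.congr_fun (hJJ s s) (lp.single 2 j 1)
      rw [if_pos rfl, ContinuousLinearMap.comp_apply, hJ] at h2
      rw [ContinuousLinearMap.comp_apply, ContinuousLinearMap.comp_apply, h2, h1, map_smul]
      change J t (A t s • m (UnitAddTorus.mFourier r) (lp.single 2 j 1)) = _
      rw [hmF, map_smul, hJ]
    · intro u _ hu
      have h2 := DFunLike.congr_fun (hJJ u s) (lp.single 2 j 1)
      rw [if_neg hu, ContinuousLinearMap.comp_apply, hJ] at h2
      rw [ContinuousLinearMap.comp_apply, ContinuousLinearMap.comp_apply, h2]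
      simp
    · simp

end QBH

end BlochRepresentation

/-! ### The sign of a Krein self-adjoint matrix -/

namespace KreinMatrix

open scoped ComplexOrder
open NambuSpace QBH Polynomial

variable {d : ℕ}

/-- The matrices that act on the components at one site. -/
abbrev SiteMatrix (d : ℕ) : Type := Matrix (Fin d ⊕ Fin d) (Fin d ⊕ Fin d) ℂ

/-- The matrix `τ₃`. -/
def tau (d : ℕ) : SiteMatrix d := Matrix.diagonal kreinSign

theorem tau_mul_tau : tau d * tau d = 1 := by
  rw [tau, Matrix.diagonal_mul_diagonal, ← Matrix.diagonal_one]
  congr 1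
  funext s
  exact kreinSign_mul_self s

theorem tau_conjTranspose : (tau d)ᴴ = tau d := by
  rw [tau, Matrix.diagonal_conjTranspose]
  congr 1
  funext s
  exact conj_kreinSign s

theorem tau_transpose : (tau d)ᵀ = tau d := Matrix.diagonal_transpose _

/-- The Krein inner product. -/
def kreinInner (x y : Fin d ⊕ Fin d → ℂ) : ℂ := star x ⬝ᵥ (tau d *ᵥ y)

theorem kreinInner_add_left (x x' y : Fin d ⊕ Fin d → ℂ) :
    kreinInner (x + x') y = kreinInner x y + kreinInner x' y := by
  simp [kreinInner, add_dotProduct]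

theorem kreinInner_add_right (x y y' : Fin d ⊕ Fin d → ℂ) :
    kreinInner x (y + y') = kreinInner x y + kreinInner x y' := by
  simp [kreinInner, Matrix.mulVec_add, dotProduct_add]

theorem kreinInner_smul_left (c : ℂ) (x y : Fin d ⊕ Fin d → ℂ) :
    kreinInner (c • x) y = starRingEnd ℂ c * kreinInner x y := by
  simp [kreinInner]

theorem kreinInner_smul_right (c : ℂ) (x y : Fin d ⊕ Fin d → ℂ) :
    kreinInner x (c • y) = c * kreinInner x y := by
  simp [kreinInner, Matrix.mulVec_smul]

theorem kreinInner_sum_left {κ : Type*} (s : Finset κ) (x : κ → Fin d ⊕ Fin d → ℂ)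
    (y : Fin d ⊕ Fin d → ℂ) : kreinInner (∑ i ∈ s, x i) y = ∑ i ∈ s, kreinInner (x i) y := by
  simp [kreinInner, sum_dotProduct]

theorem kreinInner_sum_right {κ : Type*} (s : Finset κ) (x : Fin d ⊕ Fin d → ℂ)
    (y : κ → Fin d ⊕ Fin d → ℂ) : kreinInner x (∑ i ∈ s, y i) = ∑ i ∈ s, kreinInner x (y i) := by
  simp [kreinInner, Matrix.mulVec_sum, dotProduct_sum]

theorem kreinInner_conj (x y : Fin d ⊕ Fin d → ℂ) :
    starRingEnd ℂ (kreinInner x y) = kreinInner y x := by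
  simp only [kreinInner, tau, Matrix.mulVec_diagonal, dotProduct, map_sum, map_mul, Pi.star_apply,
    conj_kreinSign]
  refine Finset.sum_congr rfl fun s _ => ?_
  simp
  ring

theorem kreinInner_self (x : Fin d ⊕ Fin d → ℂ) : kreinInner x x = (kreinForm x : ℂ) := by
  simp only [kreinInner, tau, Matrix.mulVec_diagonal, dotProduct, Fintype.sum_sum_type, kreinForm,
    kreinSign, Pi.star_apply]
  push_cast
  simp only [one_mul, neg_one_mul, mul_neg, Finset.sum_neg_distrib, ← sub_eq_add_neg]
  congr 1 <;> refine Finset.sum_congr rfl fun s _ => ?_ <;> exact Complex.conj_mul' _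

/-- Matrices that are self-adjoint for the Krein inner product. -/
def IsKreinSelfAdjoint (g : SiteMatrix d) : Prop := gᴴ * tau d = tau d * g

theorem IsKreinSelfAdjoint.kreinInner_eq {g : SiteMatrix d} (hg : IsKreinSelfAdjoint g)
    (x y : Fin d ⊕ Fin d → ℂ) : kreinInner (g *ᵥ x) y = kreinInner x (g *ᵥ y) := by
  rw [kreinInner, kreinInner, Matrix.star_mulVec, ← Matrix.dotProduct_mulVec, Matrix.mulVec_mulVec,
    Matrix.mulVec_mulVec, hg]

theorem IsKreinSelfAdjoint.kreinInner_eq_zero {g : SiteMatrix d} (hg : IsKreinSelfAdjoint g)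
    {x y : Fin d ⊕ Fin d → ℂ} {a b : ℝ} (hx : g *ᵥ x = (a : ℂ) • x) (hy : g *ᵥ y = (b : ℂ) • y)
    (hab : a ≠ b) : kreinInner x y = 0 := by
  have h := hg.kreinInner_eq x y
  rw [hx, hy, kreinInner_smul_left, kreinInner_smul_right, Complex.conj_ofReal] at h
  have h2 : ((a : ℂ) - b) * kreinInner x y = 0 := by rw [sub_mul, h, sub_self]
  refine (mul_eq_zero.1 h2).resolve_left (sub_ne_zero.2 ?_)
  exact_mod_cast hab

/-- No eigenvalue has eigenvectors of both Krein signatures. -/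
def HasNoCollision (g : SiteMatrix d) : Prop :=
  ∀ (a : ℝ) (x y : Fin d ⊕ Fin d → ℂ), g *ᵥ x = (a : ℂ) • x → g *ᵥ y = (a : ℂ) • y →
    0 < kreinForm x → ¬ kreinForm y < 0

section Diagonalizable

variable {g P : SiteMatrix d} {ev : Fin d ⊕ Fin d → ℝ}

theorem mulVec_col (hgP : g * P = P * Matrix.diagonal fun s => (ev s : ℂ)) (i : Fin d ⊕ Fin d) :
    g *ᵥ P.col i = (ev i : ℂ) • P.col i := by
  have h : (g * P).col i = (P * Matrix.diagonal fun s => (ev s : ℂ)).col i := by rw [hgP]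
  funext s
  have h2 := congrFun h s
  simp only [Matrix.col_apply, Matrix.mul_diagonal] at h2
  simpa [Matrix.mulVec, dotProduct, Matrix.mul_apply, mul_comm] using h2

/-- The eigenvectors span and the form is nondegenerate, so a neutral eigenvector `x` pairs
nontrivially with some column of `P`, necessarily of the same eigenvalue. Rescaled to a vector `y`
of pairing `1`, it yields `x + α y` and `x - α y` of opposite signatures for small `α`, a collision.
-/
theorem kreinForm_ne_zero (hg : IsKreinSelfAdjoint g) (hP : IsUnit P)
    (hgP : g * P = P * Matrix.diagonal fun s => (ev s : ℂ)) (hc : HasNoCollision g) {a : ℝ}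
    {x : Fin d ⊕ Fin d → ℂ} (hx : g *ᵥ x = (a : ℂ) • x) (hx0 : x ≠ 0) : kreinForm x ≠ 0 := by
  intro h0
  have h1 : kreinInner (tau d *ᵥ x) x ≠ 0 := by
    rw [kreinInner]
    exact fun h => hx0 (by
      rw [dotProduct_star_self_eq_zero] at h
      have := congrArg (fun v => tau d *ᵥ v) h
      simpa [Matrix.mulVec_mulVec, tau_mul_tau] using this)
  obtain ⟨b, hb⟩ : ∃ b, P *ᵥ b = tau d *ᵥ x := by
    refine ⟨P⁻¹ *ᵥ (tau d *ᵥ x), ?_⟩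
    rw [Matrix.mulVec_mulVec, Matrix.mul_nonsing_inv _ ((Matrix.isUnit_iff_isUnit_det _).1 hP),
      Matrix.one_mulVec]
  have h2 : P *ᵥ b = ∑ i, b i • P.col i := by
    funext s
    simp [Matrix.mulVec, dotProduct, mul_comm]
  rw [← hb, h2, kreinInner_sum_left] at h1
  obtain ⟨i, -, hi⟩ := Finset.exists_ne_zero_of_sum_ne_zero h1
  rw [kreinInner_smul_left] at hi
  have hi := right_ne_zero_of_mul hi
  have hei : ev i = a := by
    by_contra hne
    exact hi (hg.kreinInner_eq_zero (mulVec_col hgP i) hx hne)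
  set t := kreinInner (P.col i) x with ht
  set y := (starRingEnd ℂ t)⁻¹ • P.col i with hy
  have hyx : kreinInner y x = 1 := by
    rw [hy, kreinInner_smul_left, ← ht, map_inv₀, Complex.conj_conj, inv_mul_cancel₀ hi]
  have hgy : g *ᵥ y = (a : ℂ) • y := by
    rw [hy, Matrix.mulVec_smul, mulVec_col hgP i, hei, smul_comm]
  clear_value y
  have hform : ∀ α : ℝ, kreinForm (x + (α : ℂ) • y) = 2 * α + α ^ 2 * kreinForm y := by
    intro α
    have hxy : kreinInner x y = 1 := by rw [← kreinInner_conj, hyx, map_one]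
    have h3 : kreinInner (x + (α : ℂ) • y) (x + (α : ℂ) • y)
        = ((2 * α + α ^ 2 * kreinForm y : ℝ) : ℂ) := by
      rw [kreinInner_add_left, kreinInner_add_right, kreinInner_add_right, kreinInner_smul_left,
        kreinInner_smul_right, kreinInner_smul_right, kreinInner_smul_left, kreinInner_self,
        kreinInner_self, hyx, hxy, h0, Complex.conj_ofReal]
      push_cast
      ring
    rw [kreinInner_self] at h3
    exact_mod_cast h3
  have hgxy : ∀ α : ℝ, g *ᵥ (x + (α : ℂ) • y) = (a : ℂ) • (x + (α : ℂ) • y) := by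
    intro α
    rw [Matrix.mulVec_add, Matrix.mulVec_smul, hx, hgy, smul_add, smul_comm]
  -- Small enough for the linear term `2 α` to outweigh `α ^ 2 * kreinForm y`.
  set α := 1 / (1 + |kreinForm y|) with hα
  have hpos : 0 < 1 + |kreinForm y| := by positivity
  have hα0 : 0 < α := by positivity
  have hαk : α * |kreinForm y| ≤ 1 := by
    rw [hα, one_div, inv_mul_le_iff₀ hpos]; linarith
  have habs := abs_le.1 (le_refl |kreinForm y|)
  refine hc a _ _ (hgxy α) (hgxy (-α)) ?_ ?_
  · rw [hform]
    nlinarith [mul_le_mul_of_nonneg_left habs.1 hα0.le]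
  · rw [hform]
    nlinarith [mul_le_mul_of_nonneg_left habs.2 hα0.le]

open Classical in
/-- The Krein signature of an eigenvalue. -/
def signature (g : SiteMatrix d) (a : ℝ) : ℝ :=
  if ∃ x : Fin d ⊕ Fin d → ℂ, g *ᵥ x = (a : ℂ) • x ∧ 0 < kreinForm x then 1 else -1

theorem signature_mul_self (g : SiteMatrix d) (a : ℝ) : signature g a * signature g a = 1 := by
  rw [signature]; split_ifs <;> norm_num

theorem signature_mul_kreinForm (hg : IsKreinSelfAdjoint g) (hP : IsUnit P)
    (hgP : g * P = P * Matrix.diagonal fun s => (ev s : ℂ)) (hc : HasNoCollision g) {a : ℝ}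
    {x : Fin d ⊕ Fin d → ℂ} (hx : g *ᵥ x = (a : ℂ) • x) (hx0 : x ≠ 0) :
    0 < signature g a * kreinForm x := by
  rcases lt_or_gt_of_ne (kreinForm_ne_zero hg hP hgP hc hx hx0) with h | h
  · have h1 : ¬ ∃ x : Fin d ⊕ Fin d → ℂ, g *ᵥ x = (a : ℂ) • x ∧ 0 < kreinForm x := by
      rintro ⟨z, hz, hz0⟩
      exact hc a z x hz hx hz0 h
    rw [signature, if_neg h1]
    linarith
  · rw [signature, if_pos ⟨x, hx, h⟩]
    linarith

theorem signature_cases (hg : IsKreinSelfAdjoint g) (hP : IsUnit P)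
    (hgP : g * P = P * Matrix.diagonal fun s => (ev s : ℂ)) (hc : HasNoCollision g)
    (i : Fin d ⊕ Fin d) :
    (signature g (ev i) = 1 ∧ ∃ x : Fin d ⊕ Fin d → ℂ, g *ᵥ x = (ev i : ℂ) • x ∧ 0 < kreinForm x) ∨
    (signature g (ev i) = -1 ∧ ∃ x : Fin d ⊕ Fin d → ℂ,
      g *ᵥ x = (ev i : ℂ) • x ∧ kreinForm x < 0) := by
  have hx := mulVec_col hgP i
  have hx0 : P.col i ≠ 0 := by
    intro h
    have h2 : P *ᵥ Pi.single i 1 = 0 := by rw [Matrix.mulVec_single_one, h]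
    have h3 := congrArg (fun v => P⁻¹ *ᵥ v) h2
    simp only [Matrix.mulVec_mulVec, Matrix.nonsing_inv_mul _ ((Matrix.isUnit_iff_isUnit_det _).1 hP),
      Matrix.one_mulVec, Matrix.mulVec_zero] at h3
    simpa using congrFun h3 i
  have h := signature_mul_kreinForm hg hP hgP hc hx hx0
  by_cases hs : ∃ x : Fin d ⊕ Fin d → ℂ, g *ᵥ x = (ev i : ℂ) • x ∧ 0 < kreinForm x
  · exact Or.inl ⟨if_pos hs, hs⟩
  · have h1 : signature g (ev i) = -1 := if_neg hs
    rw [h1] at h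
    exact Or.inr ⟨h1, _, hx, by linarith⟩

theorem aeval_mul_of_mul_diagonal {Q : SiteMatrix d} {e : Fin d ⊕ Fin d → ℂ}
    (h : g * Q = Q * Matrix.diagonal e) (p : ℂ[X]) :
    aeval g p * Q = Q * Matrix.diagonal fun i => p.eval (e i) := by
  induction p using Polynomial.induction_on' with
  | add p q hp hq =>
    rw [map_add, add_mul, hp, hq, ← mul_add, Matrix.diagonal_add]
    simp
  | monomial n a =>
    have h1 : ∀ n : ℕ, g ^ n * Q = Q * Matrix.diagonal fun i => e i ^ n := by
      intro n
      induction n with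
      | zero => simp
      | succ n ih =>
        rw [pow_succ', mul_assoc, ih, ← mul_assoc, h, mul_assoc, Matrix.diagonal_mul_diagonal]
        congr 2
        funext i
        ring
    rw [aeval_monomial, ← Algebra.smul_def, smul_mul_assoc, h1, ← mul_smul_comm,
      ← Matrix.diagonal_smul]
    congr 2
    funext i
    simp

/-- The Krein sign of a Krein self-adjoint matrix. -/
theorem exists_krein_sign (hg : IsKreinSelfAdjoint g) (hP : IsUnit P)
    (hgP : g * P = P * Matrix.diagonal fun s => (ev s : ℂ)) (hc : HasNoCollision g) :
    ∃ (S : SiteMatrix d) (p : ℂ[X]), aeval g p = S ∧ S * S = 1 ∧ (tau d * S).PosDef ∧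
      ∀ i, p.eval (ev i : ℂ) = signature g (ev i) := by
  classical
  -- Real coefficients make `S` Krein self-adjoint, that is, `tau d * S` Hermitian.
  let p : ℝ[X] := Lagrange.interpolate (Finset.univ.image ev) id (signature g)
  have hp : ∀ i, p.eval (ev i) = signature g (ev i) := fun i =>
    Lagrange.eval_interpolate_at_node (signature g) (Set.injOn_id _)
      (Finset.mem_image_of_mem ev (Finset.mem_univ i))
  let q : ℂ[X] := p.map (algebraMap ℝ ℂ)
  have hq : ∀ i, q.eval (ev i : ℂ) = signature g (ev i) := by
    intro i
    rw [← hp i]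
    exact (Polynomial.eval_map_algebraMap p (ev i : ℂ)).trans
      (Polynomial.aeval_algebraMap_apply ℂ (ev i) p)
  set S := aeval g q with hS
  have hSP : S * P = P * Matrix.diagonal fun i => ((signature g (ev i) : ℝ) : ℂ) := by
    rw [hS, aeval_mul_of_mul_diagonal hgP]
    simp only [hq]
  have hherm : Sᴴ * tau d = tau d * S := by
    have h1 : ∀ n : ℕ, (g ^ n)ᴴ * tau d = tau d * g ^ n := by
      intro n
      induction n with
      | zero => simp
      | succ n ih =>
        rw [pow_succ, Matrix.conjTranspose_mul, mul_assoc, ih, ← mul_assoc, hg, mul_assoc,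
          ← pow_succ', pow_succ]
    have h2 : ∀ p : ℝ[X], (aeval g (p.map (algebraMap ℝ ℂ)))ᴴ * tau d
        = tau d * aeval g (p.map (algebraMap ℝ ℂ)) := by
      intro p
      induction p using Polynomial.induction_on' with
      | add p q hp hq =>
        rw [Polynomial.map_add, map_add, Matrix.conjTranspose_add, add_mul, mul_add, hp, hq]
      | monomial n a =>
        rw [Polynomial.map_monomial, aeval_monomial, ← Algebra.smul_def, Matrix.conjTranspose_smul,
          smul_mul_assoc, mul_smul_comm, h1]
        simp
    exact h2 p
  have hPinv := (Matrix.isUnit_iff_isUnit_det _).1 hP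
  refine ⟨S, q, rfl, ?_, ?_, hq⟩
  · have h1 : S * S * P = P := by
      rw [mul_assoc, hSP, ← mul_assoc, hSP, mul_assoc, Matrix.diagonal_mul_diagonal]
      have : (fun i => ((signature g (ev i) : ℝ) : ℂ) * ((signature g (ev i) : ℝ) : ℂ))
          = fun _ => 1 := by
        funext i
        exact_mod_cast signature_mul_self g (ev i)
      rw [this, Matrix.diagonal_one, mul_one]
    exact hP.mul_right_cancel (by rw [h1, one_mul])
  · refine Matrix.PosDef.of_dotProduct_mulVec_pos ?_ fun v hv => ?_
    · rw [Matrix.IsHermitian, Matrix.conjTranspose_mul, tau_conjTranspose, hherm]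
    · rw [← Matrix.mulVec_mulVec]
      change 0 < kreinInner v (S *ᵥ v)
      -- `v` is decomposed into components `x a` in the eigenspaces of `g`. These are Krein
      -- orthogonal, so the form becomes a sum of `signature g a * kreinForm (x a)`, nonnegative
      -- term by term.
      set c := P⁻¹ *ᵥ v with hc'
      have hv' : P *ᵥ c = v := by
        rw [hc', Matrix.mulVec_mulVec, Matrix.mul_nonsing_inv _ hPinv, Matrix.one_mulVec]
      let Λ := Finset.univ.image ev
      let x : ℝ → Fin d ⊕ Fin d → ℂ := fun a => P *ᵥ fun i => if ev i = a then c i else 0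
      have hdiag : ∀ e c : Fin d ⊕ Fin d → ℂ, P *ᵥ (fun i => e i * c i)
          = (P * Matrix.diagonal e) *ᵥ c := by
        intro e c
        rw [← Matrix.mulVec_mulVec]
        congr 1
        funext i
        rw [Matrix.mulVec_diagonal]
      have hsum : ∀ f : ℝ → ℂ, ∑ a ∈ Λ, f a • x a = P *ᵥ fun i => f (ev i) * c i := by
        intro f
        simp only [x, ← Matrix.mulVec_smul, ← Matrix.mulVec_sum]
        congr 1
        funext i
        rw [Finset.sum_apply, Finset.sum_eq_single (ev i)]
        · simp
        · intro b _ hb; simp [Ne.symm hb]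
        · intro h; exact absurd (Finset.mem_image_of_mem ev (Finset.mem_univ i)) h
      have hvx : v = ∑ a ∈ Λ, x a := by
        have := hsum fun _ => 1
        simp only [one_smul, one_mul] at this
        rw [this]; exact hv'.symm
      have hSx : S *ᵥ v = ∑ a ∈ Λ, ((signature g a : ℝ) : ℂ) • x a := by
        rw [hsum fun a => ((signature g a : ℝ) : ℂ), hdiag, ← hSP, ← Matrix.mulVec_mulVec, hv']
      have hgx : ∀ a, g *ᵥ x a = (a : ℂ) • x a := by
        intro a
        simp only [x]
        rw [Matrix.mulVec_mulVec, hgP, ← hdiag, ← Matrix.mulVec_smul]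
        congr 1
        funext i
        by_cases h : ev i = a
        · simp [h]
        · simp [h]
      have hfin : kreinInner v (S *ᵥ v)
          = ((∑ a ∈ Λ, signature g a * kreinForm (x a) : ℝ) : ℂ) := by
        rw [hSx, kreinInner_sum_right]
        push_cast
        refine Finset.sum_congr rfl fun a ha => ?_
        rw [kreinInner_smul_right, hvx, kreinInner_sum_left, Finset.sum_eq_single a, kreinInner_self]
        · intro b _ hb
          exact hg.kreinInner_eq_zero (hgx b) (hgx a) hb
        · intro h; exact absurd ha h
      rw [hfin]
      have hpos : 0 < ∑ a ∈ Λ, signature g a * kreinForm (x a) := by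
        have h1 : ∀ a ∈ Λ, 0 ≤ signature g a * kreinForm (x a) := by
          intro a _
          by_cases h : x a = 0
          · rw [h]; simp [kreinForm]
          · exact (signature_mul_kreinForm hg hP hgP hc (hgx a) h).le
        refine Finset.sum_pos' h1 ?_
        by_contra! hno
        apply hv
        rw [hvx]
        refine Finset.sum_eq_zero fun a ha => ?_
        by_contra h
        exact absurd (signature_mul_kreinForm hg hP hgP hc (hgx a) h) (not_lt.2 (hno a ha))
      exact_mod_cast hpos

end Diagonalizable

end KreinMatrix

/-! ### Continuity of the Krein sign -/

namespace KreinMatrix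

open scoped ComplexOrder Matrix.Norms.L2Operator Topology
open NambuSpace QBH Polynomial Filter

variable {d : ℕ}

theorem isClosed_posSemidef {n : Type*} [Fintype n] [DecidableEq n] :
    IsClosed {A : Matrix n n ℂ | A.PosSemidef} := by
  simp only [Matrix.posSemidef_iff_dotProduct_mulVec, Matrix.IsHermitian, Set.ofPred_and,
    Set.ofPred_forall]
  refine (isClosed_eq (by fun_prop) continuous_id).inter (isClosed_iInter fun v => ?_)
  refine isClosed_le continuous_const ?_
  fun_prop

/-- A commuting pair of roots `N * N = c ^ 2` and `S * S = 1`, positive for the Krein form. -/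
theorem eq_smul_of_mul_self {N S : SiteMatrix d} {c : ℝ} (hc : 0 ≤ c)
    (hN : N * N = ((c : ℂ) ^ 2) • (1 : SiteMatrix d)) (hNpos : (tau d * N).PosSemidef)
    (hS : S * S = 1) (hSpos : (tau d * S).PosDef) (hNS : N * S = S * N) : N = (c : ℂ) • S := by
  rcases hc.eq_or_lt with rfl | hc
  -- For `c = 0`, `Nᴴ (τ S) N = τ S N² = 0`, and definiteness of `τ S` gives `N = 0`.
  · have hNh : Nᴴ * tau d = tau d * N := by
      have := hNpos.1
      rwa [Matrix.IsHermitian, Matrix.conjTranspose_mul, tau_conjTranspose] at this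
    have h0 : Nᴴ * (tau d * S) * N = 0 := by
      rw [← mul_assoc, hNh, mul_assoc, mul_assoc, ← hNS, ← mul_assoc N, hN]
      simp
    have h1 : N = 0 := by
      by_contra hne
      obtain ⟨v, hv⟩ : ∃ v, N *ᵥ v ≠ 0 := by
        by_contra! h
        exact hne (Matrix.ext_of_mulVec_single fun i => by rw [h, Matrix.zero_mulVec])
      have h2 := hSpos.dotProduct_mulVec_pos hv
      rw [Matrix.star_mulVec, ← Matrix.dotProduct_mulVec, Matrix.mulVec_mulVec,
        Matrix.mulVec_mulVec, h0] at h2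
      simp at h2
    simp [h1]
  -- For `c > 0` the factor `N + c S` is invertible, and `(N - c S)(N + c S) = 0`.
  · have hu : (tau d * (N + (c : ℂ) • S)).PosDef := by
      rw [mul_add, mul_smul_comm]
      exact Matrix.PosDef.posSemidef_add hNpos (hSpos.smul (by exact_mod_cast hc))
    have hunit : IsUnit (N + (c : ℂ) • S) := by
      have h1 := hu.isUnit
      have h2 : IsUnit (tau d) := IsUnit.of_mul_eq_one _ tau_mul_tau
      have h3 := h2.mul h1
      rwa [← mul_assoc, tau_mul_tau, one_mul] at h3
    have h0 : (N - (c : ℂ) • S) * (N + (c : ℂ) • S) = 0 := by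
      rw [sub_mul, mul_add, mul_add, hN, smul_mul_smul_comm, hS, mul_smul_comm, smul_mul_assoc, hNS,
        ← pow_two]
      abel
    exact sub_eq_zero.1 ((hunit.mul_left_eq_zero).1 h0)

/-- The Krein sign depends continuously on the matrix. -/
theorem continuous_of_isSign {X : Type*} [TopologicalSpace X] [Nonempty (Fin d)]
    {m S : X → SiteMatrix d} (hm : Continuous m) (hS : ∀ x, S x * S x = 1)
    (hpos : ∀ x, (tau d * S x).PosDef)
    (hcomm : ∀ x Z, Z * m x = m x * Z → Z * S x = S x * Z) : Continuous S := by
  rw [continuous_iff_continuousAt]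
  intro x₀
  rw [ContinuousAt, tendsto_iff_ultrafilter]
  intro U hU
  have hU' : Tendsto id (U : Filter X) (𝓝 x₀) := hU
  have hν : ∀ x, 1 ≤ ‖S x‖ := by
    intro x
    have h1 : (1 : ℝ) = ‖(1 : SiteMatrix d)‖ := CStarRing.norm_one.symm
    have h2 : ‖(1 : SiteMatrix d)‖ ≤ ‖S x‖ * ‖S x‖ := by
      rw [← hS x]; exact norm_mul_le _ _
    rw [← h1] at h2
    nlinarith [norm_nonneg (S x)]
  have hν0 : ∀ x, ‖S x‖ ≠ 0 := fun x => by linarith [hν x]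
  -- No bound on `S` near `x₀` is known, so limits along the ultrafilter are taken of `N = S / ‖S‖`
  -- and `c = 1 / ‖S‖`, which stay in compact sets. The limits satisfy `N₀ = c₀ S(x₀)` by
  -- `eq_smul_of_mul_self`. As `N₀` has norm `1`, `c₀` is nonzero, and `S = N / c` converges to `S
  -- x₀`.
  let c : X → ℝ := fun x => ‖S x‖⁻¹
  let N : X → SiteMatrix d := fun x => (c x : ℂ) • S x
  have hNnorm : ∀ x, N x ∈ Metric.sphere (0 : SiteMatrix d) 1 := by
    intro x
    rw [mem_sphere_zero_iff_norm]
    simp only [N, c]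
    rw [norm_smul, Complex.norm_real, norm_inv, norm_norm, inv_mul_cancel₀ (hν0 x)]
  obtain ⟨N₀, hN₀, hNlim⟩ := (isCompact_sphere (0 : SiteMatrix d) 1).ultrafilter_le_nhds (U.map N)
    (by
      rw [le_principal_iff]
      exact Filter.mem_map.2 (Filter.univ_mem' hNnorm))
  have hcmem : ∀ x, c x ∈ Set.Icc (0 : ℝ) 1 := fun x =>
    ⟨by positivity, inv_le_one_of_one_le₀ (hν x)⟩
  obtain ⟨c₀, hc₀, hclim⟩ := (isCompact_Icc (a := (0 : ℝ)) (b := 1)).ultrafilter_le_nhds (U.map c)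
    (by
      rw [le_principal_iff]
      exact Filter.mem_map.2 (Filter.univ_mem' hcmem))
  have hNt : Tendsto N U (𝓝 N₀) := hNlim
  have hct : Tendsto c U (𝓝 c₀) := hclim
  have hcC : Tendsto (fun x => (c x : ℂ)) U (𝓝 (c₀ : ℂ)) :=
    (Complex.continuous_ofReal.tendsto _).comp hct
  have hmt : Tendsto m U (𝓝 (m x₀)) := (hm.tendsto x₀).mono_left hU
  have hmS : ∀ x, m x * S x = S x * m x := fun x => hcomm x _ rfl
  have e1 : N₀ * N₀ = ((c₀ : ℂ) ^ 2) • (1 : SiteMatrix d) := by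
    refine tendsto_nhds_unique (hNt.mul hNt) ?_
    have : (fun x => N x * N x) = fun x => ((c x : ℂ) ^ 2) • (1 : SiteMatrix d) := by
      funext x
      simp only [N]
      rw [smul_mul_smul_comm, hS, pow_two]
    rw [this]
    exact (hcC.pow 2).smul_const _
  have e2 : (tau d * N₀).PosSemidef := by
    refine isClosed_posSemidef.mem_of_tendsto (hNt.const_mul (tau d)) (Eventually.of_forall fun x => ?_)
    change (tau d * N x).PosSemidef
    simp only [N]
    rw [mul_smul_comm]
    exact (hpos x).posSemidef.smul (by exact_mod_cast (hcmem x).1)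
  have e3 : N₀ * m x₀ = m x₀ * N₀ := by
    refine tendsto_nhds_unique (hNt.mul hmt) ?_
    have : (fun x => N x * m x) = fun x => m x * N x := by
      funext x
      simp only [N]
      rw [smul_mul_assoc, mul_smul_comm, hmS]
    rw [this]
    exact hmt.mul hNt
  have e4 := eq_smul_of_mul_self hc₀.1 e1 e2 (hS x₀) (hpos x₀) (hcomm x₀ _ e3)
  have hc0 : (c₀ : ℂ) ≠ 0 := by
    intro h
    rw [h, zero_smul] at e4
    rw [e4, mem_sphere_zero_iff_norm, norm_zero] at hN₀
    exact zero_ne_one hN₀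
  have h5 := (hcC.inv₀ hc0).smul hNt
  rw [e4, smul_smul, inv_mul_cancel₀ hc0, one_smul] at h5
  refine h5.congr fun x => ?_
  simp only [N, c]
  rw [smul_smul, inv_mul_cancel₀ (by exact_mod_cast inv_ne_zero (hν0 x)), one_smul]

end KreinMatrix

/-! ### Bloch matrices, particle–hole symmetry and Krein gaps -/

namespace QBH

open scoped ComplexOrder Matrix.Norms.L2Operator
open NambuSpace Polynomial KreinMatrix

variable {D d : ℕ} (H : QBH D d)

/-- The phase `e^{i k·r}`. -/
def phase (k : Fin D → ℝ) (r : Fin D → ℤ) : ℂ :=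
  Complex.exp (Complex.I * ((∑ i, k i * (r i : ℝ) : ℝ) : ℂ))

theorem conj_phase (k : Fin D → ℝ) (r : Fin D → ℤ) :
    starRingEnd ℂ (phase k r) = phase (-k) r := by
  rw [phase, ← Complex.exp_conj, map_mul, Complex.conj_I, Complex.conj_ofReal, phase]
  simp

theorem phase_neg_neg (k : Fin D → ℝ) (r : Fin D → ℤ) : phase (-k) (-r) = phase k r := by
  simp [phase]

theorem bloch_apply (k : Fin D → ℝ) (s t : Fin d ⊕ Fin d) :
    H.bloch k s t = ∑ r ∈ H.rangeSet, phase k r * H.dynamicalMatrix r s t := by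
  have hK : H.K.support ⊆ H.rangeSet := fun r hr => by
    simp only [rangeSet, Finset.mem_insert, Finset.mem_union]; tauto
  have hΔ : H.Δ.support ⊆ H.rangeSet := fun r hr => by
    simp only [rangeSet, Finset.mem_insert, Finset.mem_union]; tauto
  have h1 : ∀ (M : (Fin D → ℤ) →₀ Matrix (Fin d) (Fin d) ℂ), M.support ⊆ H.rangeSet →
      ∀ k p q, QBH.fourier M k p q = ∑ r ∈ H.rangeSet, phase k r * M r p q := by
    intro M hM k p q
    rw [QBH.fourier, Finsupp.sum_of_support_subset _ hM _ (fun r _ => by simp), Matrix.sum_apply]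
    rfl
  have h2 : ∀ (M : (Fin D → ℤ) →₀ Matrix (Fin d) (Fin d) ℂ), M.support ⊆ H.rangeSet →
      ∀ p q, -(starRingEnd ℂ) (QBH.fourier M (-k) p q)
        = ∑ r ∈ H.rangeSet, phase k r * -(starRingEnd ℂ) (M r p q) := by
    intro M hM p q
    rw [h1 M hM, map_sum, ← Finset.sum_neg_distrib]
    refine Finset.sum_congr rfl fun r _ => ?_
    rw [map_mul, conj_phase, neg_neg, mul_neg]
  rcases s with p | p <;> rcases t with q | q
  · exact h1 _ hK _ _ _
  · exact h1 _ hΔ _ _ _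
  · exact h2 _ hΔ _ _
  · exact h2 _ hK _ _

theorem bloch_neg_swap (k : Fin D → ℝ) (s t : Fin d ⊕ Fin d) :
    H.bloch (-k) s.swap t.swap = -starRingEnd ℂ (H.bloch k s t) := by
  rw [bloch_apply, bloch_apply, map_sum, ← Finset.sum_neg_distrib]
  refine Finset.sum_congr rfl fun r _ => ?_
  rw [dynamicalMatrix_swap, map_mul, conj_phase, mul_neg]

theorem isKreinSelfAdjoint_bloch (k : Fin D → ℝ) : IsKreinSelfAdjoint (H.bloch k) := by
  have hK : ∀ r ℓ p, H.K (-r) ℓ p = starRingEnd ℂ (H.K r p ℓ) := fun r ℓ p => by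
    rw [← H.K_adj]; rfl
  have hΔ : ∀ r ℓ p, H.Δ (-r) ℓ p = H.Δ r p ℓ := fun r ℓ p => by
    rw [← H.Δ_transpose]; rfl
  have hg : ∀ r s t, starRingEnd ℂ (H.dynamicalMatrix r t s) * kreinSign t
      = kreinSign s * H.dynamicalMatrix (-r) s t := by
    intro r s t
    rcases s with p | p <;> rcases t with q | q <;>
      simp [dynamicalMatrix, kreinSign, hK, hΔ]
  rw [IsKreinSelfAdjoint]
  ext s t
  rw [tau, Matrix.mul_diagonal, Matrix.diagonal_mul, Matrix.conjTranspose_apply, bloch_apply,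
    bloch_apply, star_sum, Finset.sum_mul, Finset.mul_sum]
  refine Finset.sum_bij' (fun r _ => -r) (fun r _ => -r) (fun r hr => H.neg_mem_rangeSet hr)
    (fun r hr => H.neg_mem_rangeSet hr) (fun r _ => neg_neg r) (fun r _ => neg_neg r) fun r hr => ?_
  have h1 : phase k (-r) = starRingEnd ℂ (phase k r) := by
    rw [conj_phase, ← phase_neg_neg (-k) r, neg_neg]
  rw [h1, mul_left_comm, ← hg, star_mul']
  exact mul_assoc _ _ _

/-- Conjugating a vector and swapping its blocks reverses momentum, eigenvalue and signature at
once. This makes a collision visible to the gaps, which involve positive signatures only. -/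
theorem neg_mem_quasiparticleEnergies {k : Fin D → ℝ} {a : ℝ} {v : Fin d ⊕ Fin d → ℂ}
    (hv : H.bloch k *ᵥ v = (a : ℂ) • v) (hneg : kreinForm v < 0) :
    -a ∈ H.quasiparticleEnergies (-k) := by
  refine ⟨fun s => starRingEnd ℂ (v s.swap), ?_, ?_⟩
  · funext s
    have h1 := congrArg (starRingEnd ℂ) (congrFun hv s.swap)
    simp only [Matrix.mulVec, dotProduct, map_sum, map_mul, Pi.smul_apply, smul_eq_mul,
      Complex.conj_ofReal] at h1 ⊢
    rw [Complex.ofReal_neg, neg_mul, ← h1, ← Finset.sum_neg_distrib]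
    refine Fintype.sum_equiv (Equiv.sumComm _ _) _ _ fun t => ?_
    have h2 := H.bloch_neg_swap k s.swap t.swap
    rw [Sum.swap_swap, Sum.swap_swap] at h2
    rw [h2, Equiv.sumComm_apply, neg_mul]
  · simp only [kreinForm, Sum.swap_inl, Sum.swap_inr, RCLike.norm_conj] at hneg ⊢
    linarith

theorem neg_mem_brillouinZone {k : Fin D → ℝ} (hk : k ∈ brillouinZone D) :
    -k ∈ brillouinZone D := fun i => by
  have := hk i
  simp only [Set.mem_Icc, Pi.neg_apply] at this ⊢
  constructor <;> linarith [this.1, this.2]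

theorem indirectKreinGap_le {k k' : Fin D → ℝ} (hk : k ∈ brillouinZone D)
    (hk' : k' ∈ brillouinZone D) {w w' : ℝ} (hw : w ∈ H.quasiparticleEnergies k)
    (hw' : w' ∈ H.quasiparticleEnergies k') : H.indirectKreinGap ≤ |w + w'| := by
  refine csInf_le ⟨0, ?_⟩ ⟨k, hk, k', hk', w, hw, w', hw', rfl⟩
  rintro _ ⟨_, _, _, _, _, _, _, _, rfl⟩
  exact abs_nonneg _

theorem kreinGap_le {k : Fin D → ℝ} (hk : k ∈ brillouinZone D) {w w' : ℝ}
    (hw : w ∈ H.quasiparticleEnergies k) (hw' : w' ∈ H.quasiparticleEnergies (-k)) :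
    H.kreinGap ≤ |w + w'| := by
  refine csInf_le ⟨0, ?_⟩ ⟨k, hk, w, hw, w', hw', rfl⟩
  rintro _ ⟨_, _, _, _, _, _, rfl⟩
  exact abs_nonneg _

theorem nonempty_of_mem_quasiparticleEnergies {k : Fin D → ℝ} {w : ℝ}
    (hw : w ∈ H.quasiparticleEnergies k) : Nonempty (Fin d) := by
  obtain ⟨v, -, hv⟩ := hw
  by_contra h
  rw [not_nonempty_iff] at h
  simp [kreinForm] at hv

/-- For `d = 0` there are no energies, and `sInf ∅ = 0` in the reals. -/
theorem nonempty_of_kreinGap_pos (h : 0 < H.kreinGap) : Nonempty (Fin d) := by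
  by_contra hd
  have : H.kreinGap = 0 := by
    rw [kreinGap]
    convert Real.sInf_empty
    rw [Set.eq_empty_iff_forall_notMem]
    rintro _ ⟨_, _, w, hw, _⟩
    exact hd (H.nonempty_of_mem_quasiparticleEnergies hw)
  linarith

theorem nonempty_of_indirectKreinGap_pos (h : 0 < H.indirectKreinGap) : Nonempty (Fin d) := by
  by_contra hd
  have : H.indirectKreinGap = 0 := by
    rw [indirectKreinGap]
    convert Real.sInf_empty
    rw [Set.eq_empty_iff_forall_notMem]
    rintro _ ⟨_, _, _, _, w, hw, _⟩
    exact hd (H.nonempty_of_mem_quasiparticleEnergies hw)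
  linarith

/-- A collision at `a` gives the energies `a` at `k` and `-a` at `-k`, with sum zero. -/
theorem hasNoCollision_of_kreinGap_pos (h : 0 < H.kreinGap) {k : Fin D → ℝ}
    (hk : k ∈ brillouinZone D) : HasNoCollision (H.bloch k) := by
  intro a x y hx hy hxpos hyneg
  have := H.kreinGap_le hk ⟨x, hx, hxpos⟩ (H.neg_mem_quasiparticleEnergies hy hyneg)
  rw [add_neg_cancel, abs_zero] at this
  linarith

theorem hasNoCollision_of_indirectKreinGap_pos (h : 0 < H.indirectKreinGap) {k : Fin D → ℝ}
    (hk : k ∈ brillouinZone D) : HasNoCollision (H.bloch k) := by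
  intro a x y hx hy hxpos hyneg
  have := H.indirectKreinGap_le hk (neg_mem_brillouinZone hk) ⟨x, hx, hxpos⟩
    (H.neg_mem_quasiparticleEnergies hy hyneg)
  rw [add_neg_cancel, abs_zero] at this
  linarith

/-- The symbol of the derivation `[H, ·]` on the generators. -/
def symbol : C(UnitAddTorus (Fin D), SiteMatrix d) :=
  -∑ r ∈ H.rangeSet, monomialSymbol r (H.dynamicalMatrix r)ᵀ

/-- Torus coordinates have representatives in `[-1/2, 1/2)`, and `2π` times these lie in the
Brillouin zone. The transpose appears because the symbol acts on coefficients and the Bloch matrix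
on operators. -/
theorem exists_symbol_eq (x : UnitAddTorus (Fin D)) :
    ∃ k ∈ brillouinZone D, H.symbol x = -(H.bloch k)ᵀ := by
  have h1 : ∀ i, ∃ t : ℝ, t ∈ Set.Ico (-(1 / 2) : ℝ) (-(1 / 2) + 1) ∧ (t : UnitAddCircle) = x i := by
    intro i
    have : x i ∈ (QuotientAddGroup.mk '' Set.Ico (-(1 / 2) : ℝ) (-(1 / 2) + 1) :
        Set (AddCircle (1 : ℝ))) := by
      rw [AddCircle.coe_image_Ico_eq]; trivial
    exact this
  choose t ht htx using h1
  have hphase : ∀ r, UnitAddTorus.mFourier r x = phase (fun i => 2 * Real.pi * t i) r := by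
    intro r
    change ∏ i, _root_.fourier (r i) (x i) = _
    rw [phase]
    push_cast
    rw [Finset.mul_sum, Complex.exp_sum]
    refine Finset.prod_congr rfl fun i _ => ?_
    rw [← htx i, fourier_coe_apply]
    congr 1
    push_cast
    ring
  refine ⟨fun i => 2 * Real.pi * t i, fun i => ?_, ?_⟩
  · have := ht i
    have hpi := Real.pi_pos
    constructor <;> nlinarith [this.1, this.2]
  · ext s s'
    rw [symbol, ContinuousMap.neg_apply, Matrix.neg_apply, Matrix.neg_apply, Matrix.transpose_apply,
      bloch_apply, ContinuousMap.sum_apply, Matrix.sum_apply]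
    congr 1
    refine Finset.sum_congr rfl fun r _ => ?_
    rw [← hphase]
    rfl

end QBH

/-! ### The sign of the symbol -/

namespace QBH

open scoped ComplexOrder Matrix.Norms.L2Operator
open NambuSpace Polynomial KreinMatrix

variable {D d : ℕ} (H : QBH D d)

theorem commute_aeval {A : Type*} [Ring A] [Algebra ℂ A] {Z a : A} (h : Commute Z a) (p : ℂ[X]) :
    Commute Z (aeval a p) := by
  induction p using Polynomial.induction_on' with
  | add p q hp hq => rw [map_add]; exact hp.add_right hq
  | monomial n c =>
    rw [aeval_monomial]
    exact (Algebra.commute_algebraMap_right c Z).mul_right (h.pow_right n)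

theorem aeval_transpose (g : SiteMatrix d) (p : ℂ[X]) : aeval gᵀ p = (aeval g p)ᵀ := by
  induction p using Polynomial.induction_on' with
  | add p q hp hq => rw [map_add, map_add, Matrix.transpose_add, hp, hq]
  | monomial n a =>
    rw [aeval_monomial, aeval_monomial, ← Algebra.smul_def, ← Algebra.smul_def,
      Matrix.transpose_smul, Matrix.transpose_pow]

theorem mulVec_tau_injective : Function.Injective (tau d).mulVec := by
  intro v w h
  have := congrArg (fun u => tau d *ᵥ u) h
  simpa [Matrix.mulVec_mulVec, tau_mul_tau] using this

/-- `(τ S)ᵀ = Sᵀ τ` is positive definite, and conjugating it by `τ` gives `τ Sᵀ`. -/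
theorem posDef_tau_mul_transpose {S : SiteMatrix d} (h : (tau d * S).PosDef) :
    (tau d * Sᵀ).PosDef := by
  have h1 := h.transpose.conjTranspose_mul_mul_same (mulVec_tau_injective (d := d))
  rwa [Matrix.transpose_mul, tau_transpose, tau_conjTranspose, mul_assoc, mul_assoc, tau_mul_tau,
    mul_one] at h1

theorem isKreinSelfAdjoint_symbol (x : UnitAddTorus (Fin D)) : IsKreinSelfAdjoint (H.symbol x) := by
  obtain ⟨k, -, hk⟩ := H.exists_symbol_eq x
  have h := congrArg Matrix.transpose (H.isKreinSelfAdjoint_bloch k)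
  rw [Matrix.transpose_mul, Matrix.transpose_mul, tau_transpose] at h
  have h2 := congrArg (fun A => tau d * A * tau d) h
  simp only [← mul_assoc, tau_mul_tau, one_mul] at h2
  rw [mul_assoc _ (tau d) (tau d), tau_mul_tau, mul_one] at h2
  rw [IsKreinSelfAdjoint, hk, Matrix.conjTranspose_neg, neg_mul, mul_neg, ← h2]
  rfl

/-- The pointwise sign of the symbol. -/
theorem exists_symbol_sign (hH : H.DynamicallyStable)
    (hc : ∀ k ∈ brillouinZone D, HasNoCollision (H.bloch k)) (x : UnitAddTorus (Fin D)) :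
    ∃ (S Q : SiteMatrix d) (ev : Fin d ⊕ Fin d → ℝ) (p : ℂ[X]), IsUnit Q ∧
      H.symbol x * Q = Q * (Matrix.diagonal fun i => (ev i : ℂ)) ∧ aeval (H.symbol x) p = S ∧
      S * S = 1 ∧ (tau d * S).PosDef ∧ ∀ i,
        (p.eval (ev i : ℂ) = 1 ∧ ∃ k ∈ brillouinZone D, -ev i ∈ H.quasiparticleEnergies k) ∨
        (p.eval (ev i : ℂ) = -1 ∧ ∃ k ∈ brillouinZone D, ev i ∈ H.quasiparticleEnergies k) := by
  obtain ⟨k, hkB, hk⟩ := H.exists_symbol_eq x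
  obtain ⟨P, ev, hP, hgP⟩ := hH k hkB
  have hg := H.isKreinSelfAdjoint_bloch k
  obtain ⟨S, p, hpS, hSS, hSpos, hp⟩ := exists_krein_sign hg hP hgP (hc k hkB)
  have hdet := (Matrix.isUnit_iff_isUnit_det _).1 hP
  -- The data of the Bloch matrix `g` are carried over to `-gᵀ`: the eigenbasis becomes `(P⁻¹)ᵀ`,
  -- the eigenvalues change sign, and composing `p` with `-X` undoes that change.
  refine ⟨Sᵀ, (P⁻¹)ᵀ, fun i => -ev i, p.comp (-X), ?_, ?_, ?_, ?_, posDef_tau_mul_transpose hSpos, ?_⟩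
  · rw [Matrix.isUnit_transpose, Matrix.isUnit_nonsing_inv_iff]
    exact hP
  · have h1 : P⁻¹ * H.bloch k = (Matrix.diagonal fun s => (ev s : ℂ)) * P⁻¹ := by
      refine hP.mul_right_cancel ?_
      rw [mul_assoc, hgP, ← mul_assoc, Matrix.nonsing_inv_mul _ hdet, one_mul, mul_assoc,
        Matrix.nonsing_inv_mul _ hdet, mul_one]
    have h2 := congrArg Matrix.transpose h1
    rw [Matrix.transpose_mul, Matrix.transpose_mul, Matrix.diagonal_transpose] at h2
    rw [hk, neg_mul, h2, ← mul_neg, Matrix.diagonal_neg]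
    congr 2
    funext i
    simp
  · rw [aeval_comp, hk, map_neg, aeval_X, neg_neg, aeval_transpose, hpS]
  · rw [← Matrix.transpose_mul, hSS, Matrix.transpose_one]
  · intro i
    have he : (p.comp (-X)).eval ((-ev i : ℝ) : ℂ) = signature (H.bloch k) (ev i) := by
      rw [← hp i, eval_comp]
      simp
    rw [he, neg_neg]
    rcases signature_cases hg hP hgP (hc k hkB) i with ⟨h1, v, hv⟩ | ⟨h1, v, hv, hv0⟩
    · exact Or.inl ⟨by rw [h1]; simp, k, hkB, v, hv⟩
    · exact Or.inr ⟨by rw [h1]; simp, -k, neg_mem_brillouinZone hkB,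
        H.neg_mem_quasiparticleEnergies hv hv0⟩

/-- A continuous function that separates the signs, in the presence of an indirect gap. -/
theorem exists_continuous_sign (h : 0 < H.indirectKreinGap) : ∃ f : ℂ → ℂ, Continuous f ∧
    (∀ a : ℝ, (∃ k ∈ brillouinZone D, -a ∈ H.quasiparticleEnergies k) → f a = 1) ∧
    (∀ a : ℝ, (∃ k ∈ brillouinZone D, a ∈ H.quasiparticleEnergies k) → f a = -1) := by
  set Ω : Set ℝ := {w | ∃ k ∈ brillouinZone D, w ∈ H.quasiparticleEnergies k} with hΩ
  let δ := H.indirectKreinGap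
  -- For an energy `a`, the indirect gap keeps `-a` at distance at least `δ` from `Ω`, so the slope
  -- `2 / δ` brings the function down to the cut-off `-1`. At points of `-Ω` the distance is zero
  -- and the value is `1`.
  refine ⟨fun z => ((max (-1) (1 - 2 / δ * Metric.infDist (-z.re) Ω) : ℝ) : ℂ), ?_, ?_, ?_⟩
  · refine Complex.continuous_ofReal.comp (continuous_const.max (continuous_const.sub
      (continuous_const.mul ((Metric.continuous_infDist_pt Ω).comp Complex.continuous_re.neg))))
  · intro a ha
    have h0 : Metric.infDist (-a) Ω = 0 := Metric.infDist_zero_of_mem ha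
    simp [h0]
  · intro a ha
    have hne : Ω.Nonempty := ⟨a, ha⟩
    have h0 : δ ≤ Metric.infDist (-a) Ω := by
      rw [Metric.le_infDist hne]
      rintro w ⟨k', hk', hw⟩
      obtain ⟨k, hk, hak⟩ := ha
      have := H.indirectKreinGap_le hk hk' hak hw
      rwa [Real.dist_eq, ← abs_neg, neg_sub, sub_neg_eq_add, add_comm w a]
    have h1 : 2 ≤ 2 / δ * Metric.infDist (-a) Ω := by
      rw [div_mul_eq_mul_div, le_div_iff₀ h]
      nlinarith
    simp only [Complex.ofReal_re]
    rw [max_eq_left (by linarith)]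
    simp

/-- The sign of the symbol as a continuous matrix function. -/
theorem exists_continuous_symbol_sign [Nonempty (Fin d)] (hH : H.DynamicallyStable)
    (hc : ∀ k ∈ brillouinZone D, HasNoCollision (H.bloch k)) :
    ∃ S : C(UnitAddTorus (Fin D), SiteMatrix d), S * S = 1 ∧ (∀ x, (tau d * S x).PosDef) ∧
      S * H.symbol = H.symbol * S ∧
      ∀ x, ∃ (Q : SiteMatrix d) (ev : Fin d ⊕ Fin d → ℝ) (p : ℂ[X]), IsUnit Q ∧
        H.symbol x * Q = Q * (Matrix.diagonal fun i => (ev i : ℂ)) ∧ aeval (H.symbol x) p = S x ∧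
        ∀ i,
        (p.eval (ev i : ℂ) = 1 ∧ ∃ k ∈ brillouinZone D, -ev i ∈ H.quasiparticleEnergies k) ∨
        (p.eval (ev i : ℂ) = -1 ∧ ∃ k ∈ brillouinZone D, ev i ∈ H.quasiparticleEnergies k) := by
  choose S Q ev p hQ hSQ hpS hSS hpos hcase using H.exists_symbol_sign hH hc
  have hcomm : ∀ x Z, Z * H.symbol x = H.symbol x * Z → Z * S x = S x * Z := by
    intro x Z hZ
    rw [← hpS x]
    exact commute_aeval hZ (p x)
  have hcont := continuous_of_isSign H.symbol.continuous hSS hpos hcomm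
  refine ⟨⟨S, hcont⟩, ?_, hpos, ?_, fun x => ⟨Q x, ev x, p x, hQ x, hSQ x, hpS x, hcase x⟩⟩
  · ext1 x
    exact hSS x
  · ext1 x
    exact (hcomm x _ rfl).symm

end QBH

/-! ### Operators that commute with the symbol commute with its sign -/

section CStar

open Polynomial

/-- Conjugation by `R` makes `M` self-adjoint, and what commutes with a self-adjoint element
commutes with its continuous functional calculus. As `Z` lives in `𝔅` only, the calculus is first
moved through `φ`. -/
theorem commute_map_cfc_conj {𝔄 𝔅 : Type*} [CStarAlgebra 𝔄] [CStarAlgebra 𝔅] (φ : 𝔄 →⋆ₐ[ℂ] 𝔅)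
    (hφ : Continuous φ) {M R R' : 𝔄} (h : R * R' = 1) (h' : R' * R = 1)
    (hA : IsSelfAdjoint (R * M * R')) {f : ℂ → ℂ} (hf : Continuous f) {Z : 𝔅}
    (hZ : Commute Z (φ M)) : Commute Z (φ (R' * cfc f (R * M * R') * R)) := by
  have hn : IsStarNormal (R * M * R') := hA.isStarNormal
  have hA' : IsSelfAdjoint (φ (R * M * R')) := hA.map φ
  have hn' : IsStarNormal (φ (R * M * R')) := hA'.isStarNormal
  have hφR : φ R * φ R' = 1 := by rw [← map_mul, h, map_one]
  have hφR' : φ R' * φ R = 1 := by rw [← map_mul, h', map_one]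
  have h1 : φ (cfc f (R * M * R')) = cfc f (φ (R * M * R')) :=
    StarAlgHomClass.map_cfc φ f _ hf.continuousOn hφ hn hn'
  have h2 : Commute (φ (R * M * R')) (φ R * Z * φ R') := by
    rw [commute_iff_eq, map_mul, map_mul]
    calc φ R * φ M * φ R' * (φ R * Z * φ R') = φ R * (φ M * (φ R' * φ R) * Z) * φ R' := by
          simp only [mul_assoc]
      _ = φ R * (Z * (φ R' * φ R) * φ M) * φ R' := by rw [hφR', mul_one, mul_one, hZ.eq]
      _ = φ R * Z * φ R' * (φ R * φ M * φ R') := by simp only [mul_assoc]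
  have h3 : Commute (cfc f (φ (R * M * R'))) (φ R * Z * φ R') :=
    Commute.cfc h2 (by rw [hA'.star_eq]; exact h2) f
  rw [commute_iff_eq, map_mul, map_mul, h1]
  set c := cfc f (φ (R * M * R'))
  calc Z * (φ R' * c * φ R) = (φ R' * φ R) * Z * φ R' * c * φ R := by
        rw [hφR', one_mul]; simp only [mul_assoc]
    _ = φ R' * ((φ R * Z * φ R') * c) * φ R := by simp only [mul_assoc]
    _ = φ R' * (c * (φ R * Z * φ R')) * φ R := by rw [h3.eq]
    _ = φ R' * c * φ R * Z * (φ R' * φ R) := by simp only [mul_assoc]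
    _ = φ R' * c * φ R * Z := by rw [hφR', mul_one]

theorem cfc_eq_aeval_of_forall_spectrum {𝔄 : Type*} [CStarAlgebra 𝔄] {A : 𝔄} (hA : IsSelfAdjoint A)
    {f : ℂ → ℂ} {p : ℂ[X]} (h : ∀ z ∈ spectrum ℂ A, f z = p.eval z) : cfc f A = aeval A p := by
  rw [cfc_congr (g := fun z => p.eval z) fun z hz => h z hz]
  exact cfc_polynomial p A hA.isStarNormal

/-- The functional calculus of a continuous function with values in a C*-algebra is pointwise. -/
theorem ContinuousMap.cfc_apply {X 𝔄 : Type*} [TopologicalSpace X] [CompactSpace X] [CStarAlgebra 𝔄]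
    {A : C(X, 𝔄)} (hA : IsSelfAdjoint A) {f : ℂ → ℂ} (hf : Continuous f) (x : X) :
    (cfc f A) x = cfc f (A x) := by
  let φ : C(X, 𝔄) →⋆ₐ[ℂ] 𝔄 :=
    { toFun := fun B => B x
      map_one' := rfl
      map_mul' := fun _ _ => rfl
      map_zero' := rfl
      map_add' := fun _ _ => rfl
      commutes' := fun _ => rfl
      map_star' := fun _ => rfl }
  have hAx : IsSelfAdjoint (φ A) := hA.map φ
  exact StarAlgHomClass.map_cfc φ f A hf.continuousOn (continuous_eval_const x)
    hA.isStarNormal hAx.isStarNormal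

end CStar

namespace QBH

open scoped ComplexOrder Matrix.Norms.L2Operator
open NambuSpace Polynomial KreinMatrix

variable {D d : ℕ} (H : QBH D d)

theorem aeval_units_conj {A : Type*} [Ring A] [Algebra ℂ A] (u : Aˣ) (a : A) (p : ℂ[X]) :
    aeval (u * a * ↑u⁻¹) p = u * aeval a p * ↑u⁻¹ := by
  induction p using Polynomial.induction_on' with
  | add p q hp hq => rw [map_add, map_add, mul_add, add_mul, hp, hq]
  | monomial n c =>
    rw [aeval_monomial, aeval_monomial, Units.conj_pow, ← Algebra.smul_def, ← Algebra.smul_def,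
      mul_smul_comm, smul_mul_assoc]

theorem exists_isUnit_star_mul_self {S : C(UnitAddTorus (Fin D), SiteMatrix d)}
    (hS : ∀ x, (tau d * S x).PosDef) : ∃ R : C(UnitAddTorus (Fin D), SiteMatrix d),
      star R * R = ContinuousMap.const _ (tau d) * S ∧ IsUnit R := by
  obtain ⟨R, hR⟩ := ContinuousMap.exists_star_mul_self_eq_of_posSemidef
    (ContinuousMap.const _ (tau d) * S) fun x => (hS x).posSemidef
  refine ⟨R, hR, ?_⟩
  rw [ContinuousMap.isUnit_iff_forall_isUnit]
  intro x
  have h1 : star (R x) * R x = tau d * S x := DFunLike.congr_fun hR x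
  have h2 := (hS x).isUnit
  rw [← h1, Matrix.isUnit_iff_isUnit_det, Matrix.det_mul] at h2
  exact (Matrix.isUnit_iff_isUnit_det _).2 (isUnit_of_mul_isUnit_right h2)

/-- With an indirect gap the sign of the symbol is a continuous function of the symbol. -/
theorem commute_sign_of_indirectKreinGap_pos (h : 0 < H.indirectKreinGap)
    {S : C(UnitAddTorus (Fin D), SiteMatrix d)} (hpos : ∀ x, (tau d * S x).PosDef)
    (hSM : S * H.symbol = H.symbol * S)
    (hS : ∀ x, ∃ (Q : SiteMatrix d) (ev : Fin d ⊕ Fin d → ℝ) (p : ℂ[X]), IsUnit Q ∧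
        H.symbol x * Q = Q * (Matrix.diagonal fun i => (ev i : ℂ)) ∧ aeval (H.symbol x) p = S x ∧
        ∀ i,
        (p.eval (ev i : ℂ) = 1 ∧ ∃ k ∈ brillouinZone D, -ev i ∈ H.quasiparticleEnergies k) ∨
        (p.eval (ev i : ℂ) = -1 ∧ ∃ k ∈ brillouinZone D, ev i ∈ H.quasiparticleEnergies k))
    {𝔅 : Type*} [CStarAlgebra 𝔅] (φ : C(UnitAddTorus (Fin D), SiteMatrix d) →⋆ₐ[ℂ] 𝔅)
    (hφ : Continuous φ) {Z : 𝔅} (hZ : Commute Z (φ H.symbol)) : Commute Z (φ S) := by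
  -- The symbol is Krein self-adjoint and commutes with `S`, so it is self-adjoint for the positive
  -- form of `τ S = R† R`; equivalently, `R M R⁻¹` is self-adjoint.
  obtain ⟨R, hR, ⟨u, rfl⟩⟩ := exists_isUnit_star_mul_self hpos
  obtain ⟨f, hf, hf1, hf2⟩ := H.exists_continuous_sign h
  set M := H.symbol with hM
  have hKrein : star M * ContinuousMap.const _ (tau d) = ContinuousMap.const _ (tau d) * M := by
    ext1 x
    exact H.isKreinSelfAdjoint_symbol x
  have hsa : IsSelfAdjoint (u * M * ↑u⁻¹) := by
    have h1 : star M * (star (u : C(UnitAddTorus (Fin D), SiteMatrix d)) * u)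
        = (star (u : C(UnitAddTorus (Fin D), SiteMatrix d)) * u) * M := by
      rw [hR, ← mul_assoc, hKrein, mul_assoc, mul_assoc, hSM]
    have h2 : star (u * M * ↑u⁻¹ : C(UnitAddTorus (Fin D), SiteMatrix d)) * u
        = (u * M * ↑u⁻¹) * u := by
      have h3 : IsUnit (star (u : C(UnitAddTorus (Fin D), SiteMatrix d))) := u.isUnit.star
      have h4 : star (u : C(UnitAddTorus (Fin D), SiteMatrix d))
          * star (↑u⁻¹ : C(UnitAddTorus (Fin D), SiteMatrix d)) = 1 := by
        have h5 := congrArg star u.inv_mul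
        rwa [star_mul, star_one] at h5
      refine h3.mul_left_cancel ?_
      rw [star_mul, star_mul, mul_assoc (_ * M), u.inv_mul, mul_one, ← mul_assoc (star _) _ M, ← h1,
        ← mul_assoc, ← mul_assoc, h4, one_mul, mul_assoc]
    exact u.isUnit.mul_right_cancel h2
  -- At each point `f` agrees on the spectrum with the polynomial `p` of that point; one `f`
  -- replaces all of these polynomials.
  have hcfc : (↑u⁻¹ * cfc f (u * M * ↑u⁻¹) * u : C(UnitAddTorus (Fin D), SiteMatrix d)) = S := by
    ext1 x
    obtain ⟨Q, ev, p, hQ, hMQ, hpS, hcase⟩ := hS x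
    have hux : (u : C(UnitAddTorus (Fin D), SiteMatrix d)) x
        * (↑u⁻¹ : C(UnitAddTorus (Fin D), SiteMatrix d)) x = 1 := DFunLike.congr_fun u.mul_inv x
    have hux' : (↑u⁻¹ : C(UnitAddTorus (Fin D), SiteMatrix d)) x
        * (u : C(UnitAddTorus (Fin D), SiteMatrix d)) x = 1 := DFunLike.congr_fun u.inv_mul x
    set a := (u : C(UnitAddTorus (Fin D), SiteMatrix d)) x
    set b := (↑u⁻¹ : C(UnitAddTorus (Fin D), SiteMatrix d)) x
    change b * (cfc f (u * M * ↑u⁻¹ : C(UnitAddTorus (Fin D), SiteMatrix d))) x * a = S x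
    rw [ContinuousMap.cfc_apply hsa hf]
    have hax : IsSelfAdjoint (a * M x * b) := DFunLike.congr_fun hsa x
    change b * cfc f (a * M x * b) * a = S x
    let w : (SiteMatrix d)ˣ := ⟨a, b, hux, hux'⟩
    have hspec : spectrum ℂ (a * M x * b) = Set.range fun i => (ev i : ℂ) := by
      obtain ⟨q, rfl⟩ := hQ
      have h1 : spectrum ℂ (a * M x * b) = spectrum ℂ (M x) := spectrum.units_conjugate (u := w)
      have h2 : M x = q * (Matrix.diagonal fun i => (ev i : ℂ)) * ↑q⁻¹ := by
        rw [← hMQ, mul_assoc, q.mul_inv, mul_one]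
      rw [h1, h2, spectrum.units_conjugate, spectrum_diagonal]
    rw [cfc_eq_aeval_of_forall_spectrum (p := p) hax, ← hpS]
    · have h3 : a * M x * b = w * M x * ↑w⁻¹ := rfl
      rw [h3, aeval_units_conj]
      change b * (a * aeval (M x) p * b) * a = _
      rw [mul_assoc a, ← mul_assoc, hux', one_mul, mul_assoc, hux', mul_one]
    · rw [hspec]
      rintro _ ⟨i, rfl⟩
      rcases hcase i with ⟨h1, h2⟩ | ⟨h1, h2⟩
      · rw [hf1 _ h2]; exact h1.symm
      · rw [hf2 _ h2]; exact h1.symm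
  have := commute_map_cfc_conj φ hφ u.mul_inv u.inv_mul hsa hf hZ
  rwa [hcfc] at this

/-- Scalar functions as matrix functions. -/
def scalarSymbol (d : ℕ) (f : C(UnitAddTorus (Fin D), ℂ)) : C(UnitAddTorus (Fin D), SiteMatrix d) where
  toFun x := f x • 1
  continuous_toFun := by fun_prop

/-- The commutator with `Z` is linear and continuous in `f` and vanishes on the characters, whose
span is dense. -/
theorem commute_scalarSymbol {𝔅 : Type*} [NormedRing 𝔅] [NormedAlgebra ℂ 𝔅]
    (φ : C(UnitAddTorus (Fin D), SiteMatrix d) →ₐ[ℂ] 𝔅) (hφ : Continuous φ) {Z : 𝔅}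
    (hZ : ∀ r, Commute Z (φ (monomialSymbol r 1))) (f : C(UnitAddTorus (Fin D), ℂ)) :
    Commute Z (φ (scalarSymbol d f)) := by
  let L : C(UnitAddTorus (Fin D), ℂ) →ₗ[ℂ] 𝔅 :=
    { toFun := fun f => Z * φ (scalarSymbol d f) - φ (scalarSymbol d f) * Z
      map_add' := fun f g => by
        have : scalarSymbol d (f + g) = scalarSymbol d f + scalarSymbol d g := by
          ext1 x; exact add_smul _ _ _
        rw [this, map_add, mul_add, add_mul]; abel
      map_smul' := fun c f => by
        have : scalarSymbol d (c • f) = c • scalarSymbol d f := by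
          ext1 x; exact smul_assoc c (f x) (1 : SiteMatrix d)
        rw [this, map_smul, mul_smul_comm, smul_mul_assoc, smul_sub, RingHom.id_apply] }
  have hcs : Continuous (scalarSymbol (D := D) d) := by
    let g : C(ℂ, SiteMatrix d) := ⟨fun z => z • 1, by fun_prop⟩
    exact ContinuousMap.continuous_postcomp g
  have hL : Continuous L :=
    (continuous_const.mul (hφ.comp hcs)).sub ((hφ.comp hcs).mul continuous_const)
  have h1 : Submodule.span ℂ (Set.range (UnitAddTorus.mFourier (d := Fin D))) ≤ LinearMap.ker L := by
    rw [Submodule.span_le]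
    rintro _ ⟨r, rfl⟩
    exact sub_eq_zero.2 (hZ r)
  have h2 := Submodule.topologicalClosure_minimal _ h1 (isClosed_singleton.preimage hL)
  rw [UnitAddTorus.span_mFourier_closure_eq_top] at h2
  exact sub_eq_zero.1 (h2 (Submodule.mem_top (x := f)))

/-- Elements that are pointwise polynomials of `M` lie in the closed algebra that is generated by
`M` and the scalar functions. -/
theorem commute_of_forall_aeval {𝔅 : Type*} [NormedRing 𝔅] [NormedAlgebra ℂ 𝔅]
    (φ : C(UnitAddTorus (Fin D), SiteMatrix d) →ₐ[ℂ] 𝔅) (hφ : Continuous φ) {Z : 𝔅}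
    {M S : C(UnitAddTorus (Fin D), SiteMatrix d)} (hM : Commute Z (φ M))
    (hZ : ∀ r, Commute Z (φ (monomialSymbol r 1))) (hS : ∀ x, ∃ p : ℂ[X], aeval (M x) p = S x) :
    Commute Z (φ S) := by
  choose p hp using hS
  have heval : ∀ x (q : ℂ[X]), (aeval M q) x = aeval (M x) q := by
    intro x q
    let ev : C(UnitAddTorus (Fin D), SiteMatrix d) →ₐ[ℂ] SiteMatrix d :=
      { toFun := fun B => B x
        map_one' := rfl
        map_mul' := fun _ _ => rfl
        map_zero' := rfl
        map_add' := fun _ _ => rfl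
        commutes' := fun _ => rfl }
    exact (aeval_algHom_apply ev M q).symm
  have hclosed : IsClosed {N | Commute Z (φ N)} :=
    isClosed_eq (continuous_const.mul hφ) (hφ.mul continuous_const)
  change S ∈ {N | Commute Z (φ N)}
  rw [← hclosed.closure_eq, Metric.mem_closure_iff]
  intro ε hε
  -- Near `x`, `S` is close to the fixed polynomial `p x` of `M`; a partition of unity glues these
  -- approximations with scalar coefficients.
  let O : UnitAddTorus (Fin D) → Set (UnitAddTorus (Fin D)) := fun x =>
    {y | ‖S y - (aeval M (p x)) y‖ < ε / 2}
  have hO : ∀ x, IsOpen (O x) := fun x => isOpen_lt (by fun_prop) continuous_const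
  have hxO : ∀ x, x ∈ O x := by
    intro x
    change ‖S x - (aeval M (p x)) x‖ < ε / 2
    rw [heval, hp, sub_self, norm_zero]
    linarith
  obtain ⟨t, ht⟩ := isCompact_univ.elim_finite_subcover O hO fun x _ => Set.mem_iUnion.2 ⟨x, hxO x⟩
  obtain ⟨f, hf⟩ := PartitionOfUnity.exists_isSubordinate isClosed_univ (fun x : t => O x)
    (fun x => hO x) (by simpa [Set.iUnion_subtype] using ht)
  let F : t → C(UnitAddTorus (Fin D), ℂ) := fun i => ⟨fun y => (f i y : ℂ), by fun_prop⟩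
  refine ⟨∑ i : t, scalarSymbol d (F i) * aeval M (p i), ?_, ?_⟩
  · change Commute Z (φ _)
    rw [map_sum]
    refine Commute.sum_right _ _ _ fun i _ => ?_
    rw [map_mul, ← aeval_algHom_apply]
    exact (commute_scalarSymbol φ hφ hZ (F i)).mul_right (commute_aeval hM _)
  · rw [dist_eq_norm]
    refine lt_of_le_of_lt ((ContinuousMap.norm_le _ (by linarith : (0 : ℝ) ≤ ε / 2)).2 fun y => ?_)
      (by linarith)
    have h1 : ∑ i : t, f i y = 1 := by
      rw [← finsum_eq_sum_of_fintype]
      exact f.sum_eq_one (Set.mem_univ y)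
    have h2 : (S - ∑ i : t, scalarSymbol d (F i) * aeval M (p i)) y
        = ∑ i : t, (f i y : ℂ) • (S y - (aeval M (p i)) y) := by
      simp only [smul_sub, Finset.sum_sub_distrib, ← Finset.sum_smul]
      rw [← Complex.ofReal_sum, h1, Complex.ofReal_one, one_smul, ContinuousMap.sub_apply,
        ContinuousMap.sum_apply]
      congr 1
      refine Finset.sum_congr rfl fun i _ => ?_
      change ((f i y : ℂ) • (1 : SiteMatrix d)) * _ = _
      rw [smul_mul_assoc, one_mul]
    rw [h2]
    refine (norm_sum_le _ _).trans ?_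
    calc ∑ i : t, ‖(f i y : ℂ) • (S y - (aeval M (p i)) y)‖ ≤ ∑ i : t, f i y * (ε / 2) := by
          refine Finset.sum_le_sum fun i _ => ?_
          rw [norm_smul, Complex.norm_real, Real.norm_of_nonneg (f.nonneg i y)]
          by_cases h0 : f i y = 0
          · rw [h0]; simp
          · have hy : y ∈ O i := hf i (subset_closure h0)
            exact mul_le_mul_of_nonneg_left (le_of_lt hy) (f.nonneg i y)
      _ = ε / 2 := by rw [← Finset.sum_mul, h1, one_mul]

end QBH

/-! ### Vacua of the Hamiltonian as fundamental symmetries -/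

namespace QBH

open scoped ComplexOrder Matrix.Norms.L2Operator
open NambuSpace CCRAlgebra Polynomial KreinMatrix

variable {D d : ℕ} (H : QBH D d)

/-- The matrix functions act on the generators by `e^{2πi r·x} A ↦ (j ↦ j + r) ⊗ A`. -/
abbrev IsBlochRep (ρ : C(UnitAddTorus (Fin D), SiteMatrix d) →⋆ₐ[ℂ]
    (NambuSpace (LatticeMode D d) →L[ℂ] NambuSpace (LatticeMode D d))) : Prop :=
  ∀ r A j s, ρ (monomialSymbol r A) (basisVec (siteIndex j s))
    = ∑ t, A t s • basisVec (siteIndex (j + r) t)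

section Representation

variable {ρ : C(UnitAddTorus (Fin D), SiteMatrix d) →⋆ₐ[ℂ]
    (NambuSpace (LatticeMode D d) →L[ℂ] NambuSpace (LatticeMode D d))}
  {ω : CCRState (LatticeMode D d)} {T : Bogoliubov (LatticeMode D d)}

theorem blochRep_symbol_basisVec (hρ : IsBlochRep ρ) (j : Fin D → ℤ) (s : Fin d ⊕ Fin d) :
    ρ H.symbol (basisVec (siteIndex j s))
      = -∑ r ∈ H.rangeSet, ∑ t, H.dynamicalMatrix r s t • basisVec (siteIndex (j + r) t) := by
  rw [symbol, map_neg, map_sum, neg_apply, sum_apply]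
  simp only [hρ, Matrix.transpose_apply]

theorem blochRep_translation_basisVec (hρ : IsBlochRep ρ) (r j : Fin D → ℤ) (s : Fin d ⊕ Fin d) :
    ρ (monomialSymbol r 1) (basisVec (siteIndex j s)) = basisVec (siteIndex (j + r) s) := by
  rw [hρ, Finset.sum_eq_single s]
  · simp
  · intro t _ ht; simp [Matrix.one_apply_ne ht]
  · simp

theorem blochRep_tau (hρ : IsBlochRep ρ) : ρ (ContinuousMap.const _ (tau d)) = kreinOp := by
  have h1 : ContinuousMap.const _ (tau d) = monomialSymbol (D := D) 0 (tau d) := by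
    ext1 x
    change tau d = UnitAddTorus.mFourier 0 x • tau d
    rw [UnitAddTorus.mFourier_zero]
    exact (one_smul ℂ _).symm
  refine clm_ext fun c => ?_
  obtain ⟨j, s, rfl⟩ := exists_siteIndex c
  rw [h1, hρ, Finset.sum_eq_single s]
  · ext c
    rw [kreinOp_apply, add_zero]
    change tau d s s * (basisVec (siteIndex j s) : NambuSpace (LatticeMode D d)) c = _
    rw [basisVec_apply, tau, Matrix.diagonal_apply_eq]
    split_ifs with h
    · subst h; rcases s with p | p <;> rfl
    · simp
  · intro t _ ht; simp [tau, Matrix.diagonal_apply_ne _ ht]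
  · simp

theorem conjOp_blochRep_symbol (hρ : IsBlochRep ρ) : conjOp (ρ H.symbol) = -ρ H.symbol := by
  refine clm_ext fun c => ?_
  obtain ⟨j, s, rfl⟩ := exists_siteIndex c
  have hsum : ∀ {κ : Type} (S : Finset κ) (f : κ → NambuSpace (LatticeMode D d)),
      (∑ i ∈ S, f i).conj = ∑ i ∈ S, (f i).conj := by
    intro κ S f
    induction S using Finset.cons_induction with
    | empty => simp [NambuSpace.conj_zero]
    | cons a S ha ih => rw [Finset.sum_cons, Finset.sum_cons, NambuSpace.conj_add, ih]
  rw [conjOp_apply, conj_basisVec, siteIndex_swap, H.blochRep_symbol_basisVec hρ,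
    neg_apply, H.blochRep_symbol_basisVec hρ, NambuSpace.conj_neg, hsum]
  congr 1
  rw [← Finset.sum_neg_distrib]
  refine Finset.sum_congr rfl fun r _ => ?_
  rw [hsum, ← Finset.sum_neg_distrib]
  refine Fintype.sum_equiv (Equiv.sumComm _ _) _ _ fun t => ?_
  have := H.dynamicalMatrix_swap r s t.swap
  rw [Sum.swap_swap] at this
  rw [NambuSpace.conj_smul, conj_basisVec, siteIndex_swap, this, Equiv.sumComm_apply, map_neg,
    Complex.conj_conj, neg_smul]

theorem conjOp_blochRep_translation (hρ : IsBlochRep ρ) (r : Fin D → ℤ) :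
    conjOp (ρ (monomialSymbol r 1)) = ρ (monomialSymbol r 1) := by
  refine clm_ext fun c => ?_
  obtain ⟨j, s, rfl⟩ := exists_siteIndex c
  rw [conjOp_apply, conj_basisVec, siteIndex_swap, blochRep_translation_basisVec hρ,
    blochRep_translation_basisVec hρ, conj_basisVec, siteIndex_swap, Sum.swap_swap]

theorem isEigenstate_iff_commute (hρ : IsBlochRep ρ) (h : ω.IsVacuumOf T.symmetry) :
    H.IsEigenstate ω ↔ Commute T.symmetry (ρ H.symbol) := by
  rw [isEigenstate_iff]
  refine h.derivation_invariant_iff (fun F => ?_) H.commutatorMap H.commutatorMap_mul (fun c => ?_)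
    H.commutatorMap_star
  · have h1 := DFunLike.congr_fun (H.conjOp_blochRep_symbol hρ) F
    rw [conjOp_apply, neg_apply] at h1
    rw [← NambuSpace.conj_conj (ρ H.symbol F.conj), h1, NambuSpace.conj_neg]
  · obtain ⟨j, s, rfl⟩ := exists_siteIndex c
    refine ⟨-∑ r ∈ H.rangeSet, ∑ t,
      Finsupp.single (siteIndex (j + r) t) (H.dynamicalMatrix r s t), ?_, ?_⟩
    · rw [← Finsupp.linearCombination_apply, H.blochRep_symbol_basisVec hρ]
      simp only [map_neg, map_sum, Finsupp.linearCombination_single]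
    · rw [← Finsupp.linearCombination_apply, commutatorMap_nambu]
      simp only [map_neg, map_sum, Finsupp.linearCombination_single]

theorem translationInvariant_iff_commute (hρ : IsBlochRep ρ) (h : ω.IsVacuumOf T.symmetry) :
    ω.TranslationInvariant ↔ ∀ r, Commute T.symmetry (ρ (monomialSymbol r 1)) := by
  refine forall_congr' fun r => h.relabel_invariant_iff _ fun c => ?_
  obtain ⟨j, s, rfl⟩ := exists_siteIndex c
  rw [blochRep_translation_basisVec hρ]
  rcases s with p | p <;> rfl

/-- A sign of the symbol defines a Bogoliubov transformation. -/
theorem exists_bogoliubov_of_sign (hρ : IsBlochRep ρ) {S : C(UnitAddTorus (Fin D), SiteMatrix d)} (hSS : S * S = 1)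
    (hpos : ∀ x, (tau d * S x).PosDef) (hSM : Commute S H.symbol)
    (hS : ∀ Z, Commute Z (ρ H.symbol) → (∀ r, Commute Z (ρ (monomialSymbol r 1))) →
      Commute Z (ρ S)) :
    ∃ T : Bogoliubov (LatticeMode D d), T.symmetry = ρ S ∧ Commute T.symmetry (ρ H.symbol) ∧
      ∀ r, Commute T.symmetry (ρ (monomialSymbol r 1)) := by
  have hG : Commute (ρ S) (ρ H.symbol) := hSM.map ρ
  have hU : ∀ r, Commute (ρ S) (ρ (monomialSymbol r 1)) := by
    intro r
    refine Commute.map (?_ : Commute S (monomialSymbol r 1)) ρ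
    ext1 x
    change S x * (UnitAddTorus.mFourier r x • 1) = (UnitAddTorus.mFourier r x • 1) * S x
    rw [mul_smul_comm, smul_mul_assoc, mul_one, one_mul]
  have hF : IsFundamentalSymmetry (ρ S) := by
    refine ⟨by rw [← map_mul, hSS, map_one], ?_⟩
    obtain ⟨R, hR, -⟩ := exists_isUnit_star_mul_self hpos
    rw [← blochRep_tau hρ, ← map_mul, ← hR, map_mul, map_star, ContinuousLinearMap.nonneg_iff_isPositive]
    exact ContinuousLinearMap.isPositive_adjoint_comp_self (ρ R)
  -- `conjOp` negates the symbol and fixes the shifts, so this second fundamental symmetry commutes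
  -- with both, hence with `ρ S`, and the two coincide. That is the compatibility with the adjoint
  -- required of a Bogoliubov transformation.
  have hF' : IsFundamentalSymmetry (-conjOp (ρ S)) := by
    refine ⟨?_, ?_⟩
    · rw [neg_mul_neg, ← conjOp_mul, hF.mul_self, conjOp_one]
    · have h1 := conjOp_nonneg hF.nonneg
      rwa [conjOp_mul, conjOp_kreinOp, neg_mul, ← mul_neg] at h1
  have hc : Commute (-conjOp (ρ S)) (ρ S) := by
    refine hS _ ?_ fun r => ?_
    · have h1 := congrArg conjOp hG.eq
      rw [conjOp_mul, conjOp_mul, H.conjOp_blochRep_symbol hρ, mul_neg, neg_mul] at h1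
      exact Commute.neg_left (neg_injective h1)
    · have h1 := congrArg conjOp (hU r).eq
      rw [conjOp_mul, conjOp_mul, conjOp_blochRep_translation hρ] at h1
      exact Commute.neg_left h1
  obtain ⟨T, hT⟩ := Bogoliubov.exists_symmetry_eq hF (by
    rw [← neg_eq_iff_eq_neg]; exact hF'.eq_of_commute hF hc)
  exact ⟨T, hT, by rw [hT]; exact hG, by rw [hT]; exact hU⟩

end Representation

end QBH

/-! ### Existence and uniqueness of the quasiparticle vacuum -/

namespace QBH

open NambuSpace CCRAlgebra KreinMatrix

variable {D d : ℕ} (H : QBH D d)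

theorem exists_translationInvariant_qpv [Nonempty (Fin d)] (hH : H.DynamicallyStable)
    (hc : ∀ k ∈ brillouinZone D, HasNoCollision (H.bloch k)) :
    ∃ ω₀ : CCRState (LatticeMode D d), H.IsQPV ω₀ ∧ ω₀.TranslationInvariant ∧
      (∀ ω, H.IsQPV ω → ω.TranslationInvariant → ω = ω₀) ∧
      (0 < H.indirectKreinGap → ∀ ω, H.IsQPV ω → ω = ω₀) := by
  obtain ⟨S, hSS, hpos, hSM, hS⟩ := H.exists_continuous_symbol_sign hH hc
  obtain ⟨ρ, hρc, hρ⟩ := exists_blochRep D d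
  have hcomm : ∀ Z, Commute Z (ρ H.symbol) → (∀ r, Commute Z (ρ (monomialSymbol r 1))) →
      Commute Z (ρ S) := by
    intro Z hZ hZ'
    refine commute_of_forall_aeval ρ.toAlgHom hρc hZ hZ' fun x => ?_
    obtain ⟨_, _, p, _, _, hp, _⟩ := hS x
    exact ⟨p, hp⟩
  obtain ⟨T₀, hT₀, hG, hU⟩ := H.exists_bogoliubov_of_sign hρ hSS hpos hSM hcomm
  obtain ⟨ω₀, hω₀⟩ := CCRState.exists_isVacuumOf T₀
  -- Commuting with `ρ S` already forces the symmetry of a competing vacuum to be `ρ S`, and the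
  -- symmetry determines the state.
  have huniq : ∀ (ω : CCRState (LatticeMode D d)) (T : Bogoliubov (LatticeMode D d)),
      ω.IsVacuumOf T.symmetry → Commute T.symmetry (ρ S) → ω = ω₀ := by
    intro ω T hω hT
    have h1 : T.symmetry = T₀.symmetry := by
      rw [hT₀]
      exact T.isFundamentalSymmetry_symmetry.eq_of_commute
        (hT₀ ▸ T₀.isFundamentalSymmetry_symmetry) hT
    exact CCRState.IsVacuumOf.unique (T := T₀) (h1 ▸ hω) hω₀
  refine ⟨ω₀, ⟨(CCRState.isQuasiparticleVacuum_iff ω₀).2 ⟨T₀, hω₀⟩,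
    (H.isEigenstate_iff_commute hρ hω₀).2 hG⟩, (translationInvariant_iff_commute hρ hω₀).2 hU,
    ?_, ?_⟩
  · rintro ω ⟨hω, hE⟩ ht
    obtain ⟨T, hT⟩ := (CCRState.isQuasiparticleVacuum_iff ω).1 hω
    exact huniq ω T hT (hcomm _ ((H.isEigenstate_iff_commute hρ hT).1 hE)
      ((translationInvariant_iff_commute hρ hT).1 ht))
  -- The sign is now a continuous function of the symbol alone, so the eigenstate condition
  -- suffices.
  · rintro hgap ω ⟨hω, hE⟩
    obtain ⟨T, hT⟩ := (CCRState.isQuasiparticleVacuum_iff ω).1 hω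
    exact huniq ω T hT (H.commute_sign_of_indirectKreinGap_pos hgap hpos hSM hS ρ hρc
      ((H.isEigenstate_iff_commute hρ hT).1 hE))

end QBH

end

theorem theorem1 {D d : ℕ} (H : QBH D d) (hH : H.DynamicallyStable) :
    (0 < H.indirectKreinGap →
      (∃! ω : CCRState (LatticeMode D d), H.IsQPV ω) ∧
        ∀ ω : CCRState (LatticeMode D d), H.IsQPV ω → ω.TranslationInvariant) ∧
    (0 < H.kreinGap →
      ∃! ω : CCRState (LatticeMode D d), H.IsQPV ω ∧ ω.TranslationInvariant) := by
  constructor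
  · intro h
    have := H.nonempty_of_indirectKreinGap_pos h
    obtain ⟨ω₀, h0, ht, -, huniq⟩ := H.exists_translationInvariant_qpv hH fun k hk =>
      H.hasNoCollision_of_indirectKreinGap_pos h hk
    refine ⟨⟨ω₀, h0, huniq h⟩, fun ω hω => ?_⟩
    rw [huniq h ω hω]
    exact ht
  · intro h
    have := H.nonempty_of_kreinGap_pos h
    obtain ⟨ω₀, h0, ht, huniq, -⟩ := H.exists_translationInvariant_qpv hH fun k hk =>
      H.hasNoCollision_of_kreinGap_pos h hk
    exact ⟨ω₀, ⟨h0, ht⟩, fun ω hω => huniq ω hω.1 hω.2⟩
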